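/- **Notation.** For a subset $S$ of a real vector space let $C(S)=\{rs : s\in S,\ r\ge 0\}$ (and $C(\emptyset)=\{0\}$). For a polytope $P\subseteq\mathbb R^n$ let $P^*=\{u : \langle p,u\rangle\ge -1\ \forall p\in P\}$; for a function $\varphi$ on $\mathbb R^n$ let $\mathrm{Newt}(\varphi)=\{u:\langle u,v\rangle\ge-\varphi(v)\ \forall v\}$. For a (lower) convex piecewise linear function $\varphi$ let $\Sigma_\varphi$ be the fan consisting of the maximal domains of linearity of $\varphi$ and all their faces. A cone is *crepant* with respect to $P$ if it is $C(\mathrm{Conv}(v_1,\dots,v_k))$ with $v_1,\dots,v_k$ lattice points contained in a common proper face of $P$. For $S\subseteq\mathbb R^n\times\mathbb R$ let $\lambda_S(x)=\inf\{r : (x,r)\in C(\mathrm{Conv}(S))\}$, the function whose graph is the lower boundary of the cone over $\mathrm{Conv}(S)$; when the lower boundary of $\mathrm{Conv}(S)$ is itself the graph of a piecewise linear function restricted to a neighbourhood of the origin, $\lambda_S$ is that function. Let $\Delta_{P(2,4)}\subseteq\mathbb R^4$ be the convex hull of $f_1,f_2,f_3,f_4,-f_1-f_2-f_3,f_1+f_2-f_4$,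 where $f_1,\dots,f_4$ is the standard basis. The vertices of $\Delta^*_{P(2,4)}$ are $$v_1=(-1,-1,-1,-1),\ v_2=(3,-1,-1,-1),\ v_3=(-1,3,-1,-1),$$ $$v_4=(-1,-1,3,-1),\ v_5=(3,-1,-1,3),\ v_6=(-1,3,-1,3).$$ Put $t_1=(1,-1,0,-1)$, $t_2=(-1,1,0,1)$, $t_3=(-1,-1,2,-1)$, $t_4=(-1,-1,0,-1)$, $c=(1,1,-1,1)$. For $\varepsilon>0$ let $h_\varepsilon=\lambda_S$, where $S$ is the union of the vertical rays going up from the points $(v_i,1)$ for $1\le i\le 6$, $(t_i,1-\varepsilon)$ for $1\le i\le 4$, $(c,1-\varepsilon)$ and $(0,0)$. On $\mathbb R^5$ let $\varphi_1,\varphi_2$ be the piecewise linear functions, linear on the cones of the fan of $\mathbb P^5$ with rays $e_1,\dots,e_5,-e_1-\cdots-e_5$, such that $\varphi_1=1,\ \varphi_2=0$ at $e_1,\dots,e_4$ and $\varphi_1=0,\ \varphi_2=1$ at $e_5$ and $-e_1-\cdots-e_5$. Let $\nabla=\mathrm{Conv}(\mathrm{Newt}(\varphi_1),\mathrm{Newt}(\varphi_2))$,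 and let $\varphi_\nabla$ be the piecewise linear function equal to $1$ on $\partial\nabla$. Let $\Sigma'$ be the set of cones $C(f)$ of dimension at most $3$, with $f$ a proper (possibly empty) face of $\nabla$ that contains neither $(0,0,0,0,1)$ nor $(0,0,0,0,-1)$ and contains at most two of the points $(3,-1,-1,-1,0)$, $(-1,3,-1,-1,0)$, $(-1,-1,3,-1,0)$, $(-1,-1,-1,3,0)$. Let $g^*:\mathbb R^5\to\mathbb R^4$ be $$g^*(n_1,\dots,n_5)=(-n_2-n_3-n_4-n_5,\ n_2+n_5,\ n_3,\ -n_1-n_3-n_4-n_5).$$ An *MPCP function* for $\Delta^*_{P(2,4)}$ is a convex piecewise linear function $h':\mathbb R^4\to\mathbb R$ with integral linear parts such that every cone of $\Sigma_{h'}$ is crepant with respect to $\Delta^*_{P(2,4)}$ and every nonzero lattice point of $\Delta^*_{P(2,4)}$ spans a ray of $\Sigma_{h'}$. Given such an $h'$, let $j=\lambda_S$ with $S=\{(\ell,r) : \ell\in\nabla\cap\mathbb Z^5,\ r\ge h'(g^*(\ell))\}$, put $j'=j+\varphi_\nabla$, and let $\Sigma'_{j'}$ be the set of cones of $\Sigma_{j'}$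 that are contained in some cone of $\Sigma'$. **Proposition.** For all sufficiently small $\varepsilon>0$ the following holds for every MPCP function $h'$ for $\Delta^*_{P(2,4)}$ such that every cone of $\Sigma_{h'}$ is contained in a cone of $\Sigma_{h_\varepsilon}$. 1. $\Sigma'_{j'}$ is a partial crepant resolution of $\Sigma'$: it is a fan (of strictly convex rational polyhedral cones), each cone of $\Sigma'_{j'}$ is contained in a cone of $\Sigma'$, each cone of $\Sigma'$ is the union of the cones of $\Sigma'_{j'}$ contained in it, and each cone of $\Sigma'_{j'}$ is crepant with respect to $\nabla$. 2. $g^*$ induces a map of fans from $\Sigma'_{j'}$ to $\Sigma_{h'}$, that is, for every cone $C$ of $\Sigma'_{j'}$ the image $g^*(C)$ is contained in some cone of $\Sigma_{h'}$. -/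

import Mathlib

namespace ConifoldMirror

/-! ### Cones, faces, fans and piecewise linear functions on `ℝⁿ`

The real vector spaces `M_ℝ`, `N_ℝ` (dimension 4) and `M'_ℝ`, `N'_ℝ` (dimension 5) are written in
coordinates as `Fin n → ℝ`; dual spaces carry the dual basis, so the pairing is the dot product
and the lattice consists of the integer vectors. -/

/-- The lattice `ℤⁿ ⊆ ℝⁿ`. -/
def lattice (n : ℕ) : Set (Fin n → ℝ) :=
  Set.range fun z : Fin n → ℤ => fun i => (z i : ℝ)

/-- The cone `C(S) = {r s | s ∈ S, r ≥ 0}` over a set, based at the origin. The origin is added so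
that the cone over the empty set is the zero cone. -/
def coneOver {V : Type*} [AddCommGroup V] [Module ℝ V] (S : Set V) : Set V :=
  insert 0 {y | ∃ r : ℝ, 0 ≤ r ∧ ∃ x ∈ S, y = r • x}

/-- `F` is a proper face of the polytope `P` (the empty face is allowed). -/
def IsProperFace {n : ℕ} (P F : Set (Fin n → ℝ)) : Prop :=
  IsExposed ℝ P F ∧ F ≠ P

/-- A crepant cone with respect to the polytope `P`: a cone over `Conv(v₁, …, v_k)` with
`v₁, …, v_k` lattice points contained in a common proper face of `P`. -/
def IsCrepantCone {n : ℕ} (P C : Set (Fin n → ℝ)) : Prop :=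
  ∃ s : Set (Fin n → ℝ), s.Finite ∧ s ⊆ lattice n ∧
    (∃ F, IsProperFace P F ∧ s ⊆ F) ∧ C = coneOver (convexHull ℝ s)

/-- A fan: a finite nonempty set of strictly convex rational polyhedral cones, closed under taking
faces, any two of which meet in a common face. -/
structure IsFan {n : ℕ} (T : Set (Set (Fin n → ℝ))) : Prop where
  finite : T.Finite
  nonempty : T.Nonempty
  rational : ∀ C ∈ T, ∃ s : Set (Fin n → ℝ), s.Finite ∧ s ⊆ lattice n ∧
    C = coneOver (convexHull ℝ s)
  pointed : ∀ C ∈ T, ∀ x ∈ C, -x ∈ C → x = 0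
  face_mem : ∀ C ∈ T, ∀ F, F.Nonempty → IsExposed ℝ C F → F ∈ T
  inter_face : ∀ C ∈ T, ∀ D ∈ T, IsExposed ℝ C (C ∩ D) ∧ IsExposed ℝ D (C ∩ D)

/-- Every cone of `T` is contained in some cone of `T₀`. -/
def Refines {n : ℕ} (T T₀ : Set (Set (Fin n → ℝ))) : Prop :=
  ∀ C ∈ T, ∃ D ∈ T₀, C ⊆ D

/-- A partial crepant resolution of `T₀` (a set of cones over proper faces of `P`): a fan which is
a subdivision of `T₀` and all of whose cones are crepant with respect to `P`. -/
structure IsPartialCrepantResolution {n : ℕ} (P : Set (Fin n → ℝ))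
    (T T₀ : Set (Set (Fin n → ℝ))) : Prop where
  isFan : IsFan T
  refines : Refines T T₀
  covers : ∀ D ∈ T₀, D = ⋃₀ {C ∈ T | C ⊆ D}
  crepant : ∀ C ∈ T, IsCrepantCone P C

/-- (Homogeneous) piecewise linear functions: continuous functions which are at each point equal
to one of finitely many linear functions. -/
def IsPiecewiseLinear {n : ℕ} (φ : (Fin n → ℝ) → ℝ) : Prop :=
  Continuous φ ∧ ∃ T : Finset ((Fin n → ℝ) →ₗ[ℝ] ℝ), ∀ x, ∃ L ∈ T, φ x = L x

/-- The maximal domains of linearity of a lower convex piecewise linear function `φ`: the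
full-dimensional sets of the form `{x | φ x = L x}` with `L` linear. -/
def IsLinearityDomain {n : ℕ} (φ : (Fin n → ℝ) → ℝ) (K : Set (Fin n → ℝ)) : Prop :=
  (interior K).Nonempty ∧ ∃ L : (Fin n → ℝ) →ₗ[ℝ] ℝ, K = {x | φ x = L x}

/-- The fan `Σ_φ` on which the lower convex piecewise linear function `φ` is strictly convex: all
(nonempty) faces of the maximal domains of linearity of `φ`. -/
def linearityFan {n : ℕ} (φ : (Fin n → ℝ) → ℝ) : Set (Set (Fin n → ℝ)) :=
  {C | C.Nonempty ∧ ∃ K, IsLinearityDomain φ K ∧ IsExposed ℝ K C}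

/-- For a set `S ⊆ ℝⁿ × ℝ`, the function whose graph is the lower boundary of the cone
`C(Conv(S))`. If the part of the epigraph of a positively homogeneous function `φ` over a
neighbourhood of the origin equals `Conv(S)`, then this function is `φ`; see
`lowerFunction_eq`. -/
noncomputable def lowerFunction {n : ℕ} (S : Set ((Fin n → ℝ) × ℝ)) (x : Fin n → ℝ) : ℝ :=
  sInf {r : ℝ | (x, r) ∈ coneOver (convexHull ℝ S)}

/-- If the lower boundary of `Conv(S)` is the graph, over a set `P` that absorbs the space, of
(the restriction of) a positively homogeneous function, then `lowerFunction S` is that function. -/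
theorem lowerFunction_eq {n : ℕ} {S : Set ((Fin n → ℝ) × ℝ)} {P : Set (Fin n → ℝ)}
    {φ : (Fin n → ℝ) → ℝ} (hP : ∀ x, ∃ t : ℝ, 0 < t ∧ t • x ∈ P)
    (hφ : ∀ (t : ℝ) (x : Fin n → ℝ), 0 ≤ t → φ (t • x) = t * φ x)
    (hS : convexHull ℝ S = {p | p.1 ∈ P ∧ φ p.1 ≤ p.2}) : lowerFunction S = φ := by
  funext x
  have h0 : φ 0 = 0 := by simpa using hφ 0 0 le_rfl
  have key : IsLeast {r : ℝ | (x, r) ∈ coneOver (convexHull ℝ S)} (φ x) := by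
    constructor
    · obtain ⟨t, ht, htx⟩ := hP x
      refine Or.inr ⟨t⁻¹, by positivity, (t • x, φ (t • x)), ?_, ?_⟩
      · rw [hS]; exact ⟨htx, le_rfl⟩
      · rw [hφ t x ht.le]
        ext1
        · simp [smul_smul, ht.ne']
        · simp [ht.ne']
    · rintro r (hr | ⟨c, hc, p, hp, hr⟩)
      · simp only [Prod.mk_eq_zero] at hr
        rw [hr.1, hr.2, h0]
      · rw [hS] at hp
        have h1 : x = c • p.1 := congrArg Prod.fst hr
        have h2 : r = c * p.2 := congrArg Prod.snd hr
        rw [h1, h2, hφ c _ hc]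
        exact mul_le_mul_of_nonneg_left hp.2 hc
  exact key.csInf_eq

/-- The dual polytope `P* = {u | ⟨p, u⟩ ≥ -1 for all p ∈ P}`. -/
def dualPolytope {n : ℕ} (P : Set (Fin n → ℝ)) : Set (Fin n → ℝ) :=
  {u | ∀ p ∈ P, -1 ≤ p ⬝ᵥ u}

/-- The Newton polytope `Newt(φ) = {u | ⟨u, v⟩ ≥ -φ(v) for all v}`. -/
def newt {n : ℕ} (φ : (Fin n → ℝ) → ℝ) : Set (Fin n → ℝ) :=
  {u | ∀ v, -φ v ≤ u ⬝ᵥ v}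

/-- An MPCP function for the reflexive polytope `P`: a lower convex piecewise linear function `φ`,
with integral linear parts, such that the fan `Σ_φ` is a crepant subdivision of the fan `Σ(P)` of
cones over proper faces of `P`, and is maximal in the sense that each nonzero lattice point of `P`
spans a ray of `Σ_φ`. -/
structure IsMPCPFunction {n : ℕ} (P : Set (Fin n → ℝ)) (φ : (Fin n → ℝ) → ℝ) : Prop where
  convex : ConvexOn ℝ Set.univ φ
  piecewiseLinear : IsPiecewiseLinear φ
  integral : ∀ L : (Fin n → ℝ) →ₗ[ℝ] ℝ, IsLinearityDomain φ {x | φ x = L x} →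
    ∀ x ∈ lattice n, ∃ k : ℤ, L x = k
  crepant : ∀ C ∈ linearityFan φ, IsCrepantCone P C
  maximal : ∀ x ∈ P ∩ lattice n, x ≠ 0 → coneOver {x} ∈ linearityFan φ

/-! ### The polytope `Δ*_{P(2,4)}` and the function `h` -/

/-- The polytope `Δ_{P(2,4)} = Conv(u₁, …, u₆)`. -/
def deltaP24 : Set (Fin 4 → ℝ) :=
  convexHull ℝ {![1, 0, 0, 0], ![0, 1, 0, 0], ![0, 0, 1, 0], ![0, 0, 0, 1],
    ![-1, -1, -1, 0], ![1, 1, 0, -1]}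

/-- The reflexive polytope `Δ*_{P(2,4)} ⊆ N_ℝ`. -/
def deltaStarP24 : Set (Fin 4 → ℝ) := dualPolytope deltaP24

/-- The six vertices `v₁, …, v₆` of `Δ*_{P(2,4)}`. -/
def vertexPoints : Set (Fin 4 → ℝ) :=
  {![-1, -1, -1, -1], ![3, -1, -1, -1], ![-1, 3, -1, -1], ![-1, -1, 3, -1],
    ![3, -1, -1, 3], ![-1, 3, -1, 3]}

/-- The points `t₁, …, t₄` (the images under `g*` of the vertices `(2,0,0,0,-1)`, `(0,2,0,0,-1)`,
`(0,0,2,0,-1)`, `(0,0,0,2,-1)` of `∇`) and the centre `(1,1,-1,1)` of the square face of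
`Δ*_{P(2,4)}`. -/
def loweredPoints : Set (Fin 4 → ℝ) :=
  {![1, -1, 0, -1], ![-1, 1, 0, 1], ![-1, -1, 2, -1], ![-1, -1, 0, -1], ![1, 1, -1, 1]}

/-- The piecewise linear function `h = h_ε` for which the unbounded polytope
`{(m, r) | m ∈ Δ*_{P(2,4)}, r ≥ h(m)}` has the vertices `(vᵢ, 1)`, `(tᵢ, 1 - ε)`,
`((1,1,-1,1), 1 - ε)` and the origin, `ε > 0` being small. -/
noncomputable def hFun (ε : ℝ) : (Fin 4 → ℝ) → ℝ :=
  lowerFunction ({p | p.1 ∈ vertexPoints ∧ 1 ≤ p.2} ∪ {p | p.1 ∈ loweredPoints ∧ 1 - ε ≤ p.2} ∪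
    {p | p.1 = 0 ∧ 0 ≤ p.2})

/-! ### The polytope `∇`, the fan `Σ'` and the map `g*` -/

/-- Minus the coefficient of `-e₁-⋯-e₅` when `x ∈ M'_ℝ` is written as a nonnegative combination of
five of the six rays `e₁, …, e₅, -e₁-⋯-e₅` of the fan of `ℙ⁵`. -/
noncomputable def minCoord (x : Fin 5 → ℝ) : ℝ := min 0 (⨅ i, x i)

/-- The function on `M'_ℝ` that is linear on the cones of the fan of `ℙ⁵`, with value `b i` at
`e_i` and `b₀` at `-e₁-⋯-e₅`; see `plP5_apply`. -/
noncomputable def plP5 (b : Fin 5 → ℝ) (b₀ : ℝ) (x : Fin 5 → ℝ) : ℝ :=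
  ∑ i, b i * (x i - minCoord x) + b₀ * (-minCoord x)

theorem plP5_apply (b : Fin 5 → ℝ) (b₀ : ℝ) (c : Fin 5 → ℝ) (c₀ : ℝ) (hc : ∀ i, 0 ≤ c i)
    (hc₀ : 0 ≤ c₀) (h : c₀ = 0 ∨ ∃ i, c i = 0) :
    plP5 b b₀ (∑ i, c i • (Pi.single i 1 : Fin 5 → ℝ) + c₀ • (fun _ => (-1 : ℝ))) =
      ∑ i, c i * b i + c₀ * b₀ := by
  have hx : (∑ i, c i • (Pi.single i 1 : Fin 5 → ℝ) + c₀ • (fun _ => (-1 : ℝ))) =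
      fun i => c i - c₀ := by
    funext j
    simp [Finset.sum_apply, Pi.single_apply, sub_eq_add_neg]
  have hm : minCoord (fun i => c i - c₀) = -c₀ := by
    have hb : BddBelow (Set.range fun i => c i - c₀) := (Set.finite_range _).bddBelow
    have hle : -c₀ ≤ ⨅ i, (c i - c₀) := le_ciInf fun i => by linarith [hc i]
    unfold minCoord
    rcases h with h | ⟨i, hi⟩
    · rw [min_eq_left (by linarith)]; simp [h]
    · have : (⨅ i, (c i - c₀)) ≤ -c₀ := (ciInf_le hb i).trans (by rw [hi]; linarith)
      rw [le_antisymm this hle, min_eq_right (by linarith)]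
  rw [hx]
  simp only [plP5, hm]
  congr 1
  · exact Finset.sum_congr rfl fun i _ => by ring
  · ring

/-- `φ₁`, with associated line bundle `𝒪(4)`. -/
noncomputable def phi1 : (Fin 5 → ℝ) → ℝ := plP5 ![1, 1, 1, 1, 0] 0

/-- `φ₂`, with associated line bundle `𝒪(2)`. -/
noncomputable def phi2 : (Fin 5 → ℝ) → ℝ := plP5 ![0, 0, 0, 0, 1] 1

/-- The polytope `∇ = Conv(Newt(φ₁), Newt(φ₂)) ⊆ N'_ℝ`. -/
noncomputable def nabla : Set (Fin 5 → ℝ) := convexHull ℝ (newt phi1 ∪ newt phi2)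

/-- The four vertices of `∇` used in the removal condition. -/
def removalPoints : Set (Fin 5 → ℝ) :=
  {![3, -1, -1, -1, 0], ![-1, 3, -1, -1, 0], ![-1, -1, 3, -1, 0], ![-1, -1, -1, 3, 0]}

/-- The faces of `∇` whose cones are removed: those containing `(0,0,0,0,±1)` or at least three of
the four points above. -/
def IsRemoved (f : Set (Fin 5 → ℝ)) : Prop :=
  ![0, 0, 0, 0, 1] ∈ f ∨ ![0, 0, 0, 0, -1] ∈ f ∨ 3 ≤ (f ∩ removalPoints).ncard

/-- The fan `Σ'`: the cones of dimension at most three over proper faces of `∇` (including the zero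
cone, over the empty face), with the cones over the removed faces taken out. -/
noncomputable def sigmaPrime : Set (Set (Fin 5 → ℝ)) :=
  {C | ∃ f, IsProperFace nabla f ∧ C = coneOver f ∧
    Module.finrank ℝ (Submodule.span ℝ C) ≤ 3 ∧ ¬ IsRemoved f}

/-- The matrix of `g : M → M'`. -/
def gMatrix : Matrix (Fin 5) (Fin 4) ℝ :=
  !![0, 0, 0, -1;
    -1, 1, 0, 0;
    -1, 0, 1, -1;
    -1, 0, 0, -1;
    -1, 1, 0, -1]

/-- The dual map `g* : N'_ℝ → N_ℝ`. -/
noncomputable def gStar : (Fin 5 → ℝ) →ₗ[ℝ] (Fin 4 → ℝ) := gMatrix.transpose.mulVecLin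

/-- The function `j` on `N'_ℝ` obtained from `h' ∘ g*` and `∇`: the lower boundary of the convex
hull of the vertical rays `{(ℓ, r) | r ≥ h'(g*(ℓ))}`, `ℓ` a lattice point of `∇`, extended
homogeneously. -/
noncomputable def jFun (h' : (Fin 4 → ℝ) → ℝ) : (Fin 5 → ℝ) → ℝ :=
  lowerFunction {p | p.1 ∈ nabla ∩ lattice 5 ∧ h' (gStar p.1) ≤ p.2}

/-- `j' = j + φ_∇`, where `φ_∇`, the piecewise linear function equal to `1` on the boundary of `∇`,
is the gauge of `∇`. -/
noncomputable def jPrime (h' : (Fin 4 → ℝ) → ℝ) (x : Fin 5 → ℝ) : ℝ :=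
  jFun h' x + gauge nabla x

/-- `Σ'_{j'}`: the cones of `Σ_{j'}` which are contained in some cone of `Σ'`. -/
noncomputable def sigmaPrimeJ (h' : (Fin 4 → ℝ) → ℝ) : Set (Set (Fin 5 → ℝ)) :=
  {C ∈ linearityFan (jPrime h') | ∃ D ∈ sigmaPrime, C ⊆ D}

end ConifoldMirror

/-! Everything rests on the lifting property `HasLatticeLift`: each point `x` of a cone of `Σ'` is a
nonnegative combination of lattice points of `∇`, of total weight at most the gauge of `x`, along
which `h' ∘ g*` is additive.

Granting this, both claims are formal. The function `h' ∘ g*` is a sublinear minorant of `j`, and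
`j` is at most `h' ∘ g*` at lattice points of `∇`, so the two agree on the cones of `Σ'`. If a
linear `L ≤ j'` touches `j'` at `x`, then it touches `j'` at every lattice point used for `x`, and
these points lie on the boundary of `∇` (`HasLatticeLift.exists_tight`). Hence the cones of
`Σ'_{j'}` are generated by lattice points of a single face. The summand `φ_∇` makes each cone of
`Σ'` meet each domain of linearity of `j'` in a face, which gives the subdivision. On one cone `h' ∘
g*` is linear minus the gauge, and comparing its values at the generators and at their sum puts the
image into one domain of linearity of `h'`.

To lift `x`, decompose `g*(x)` in a maximal cone of `Σ_{h'}` into lattice points `m i` of one proper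
face of `Δ*`; both `h'` and `h_ε` are additive along this decomposition. The kernel of `g*` is a
line, and over `m i` there are lattice points of `∇` with last coordinates `fibreLower (m i) - 1`
and `1 - fibreUpper (m i)`. Mixing these two lifts reaches `x` as soon as its last coordinate lies
between the two weighted sums; copies of the origin of `Δ*` pad the weight up to the gauge.

The ends of the fibres are only piecewise linear in `m`, so the `m i` must not straddle the walls
that matter. This is the purpose of `h_ε`: lowering `c` breaks the square `v₂v₃v₆v₅` along `m₃ = m₀`
and `m₃ = m₁`, the walls of `fibreUpper` and of the first summand of `fibreLower`; lowering the `tᵢ`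
breaks the triangles `v₁v₂v₄` and `v₁v₆v₄` along the walls of the second summand.
`IsDecomposition.separate` transfers these walls to the `m i`. The dimension bound and the removal
condition leave a short list of faces of `∇`, collected in `hasLatticeLift_of_complementary`. -/

namespace ConifoldMirror

/-! ### Convex cones and their exposed faces -/

/-- A convex cone containing the origin. -/
structure IsConvexCone {V : Type*} [AddCommGroup V] [Module ℝ V] (K : Set V) : Prop where
  zero_mem : (0 : V) ∈ K
  add_mem : ∀ x ∈ K, ∀ y ∈ K, x + y ∈ K
  smul_mem : ∀ t : ℝ, 0 ≤ t → ∀ x ∈ K, t • x ∈ K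

namespace IsConvexCone

variable {V : Type*} [AddCommGroup V] [Module ℝ V]

theorem convex {K : Set V} (h : IsConvexCone K) : Convex ℝ K := by
  intro x hx y hy a b ha hb _
  exact h.add_mem _ (h.smul_mem a ha x hx) _ (h.smul_mem b hb y hy)

theorem sum_mem {K : Set V} (h : IsConvexCone K) {ι : Type*} (s : Finset ι) (f : ι → V)
    (hf : ∀ i ∈ s, f i ∈ K) : ∑ i ∈ s, f i ∈ K := by
  classical
  induction s using Finset.induction_on with
  | empty => simpa using h.zero_mem
  | insert a s has ih =>
    rw [Finset.sum_insert has]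
    exact h.add_mem _ (hf a (by simp)) _ (ih fun i hi => hf i (by simp [hi]))

theorem inter {K L : Set V} (hK : IsConvexCone K) (hL : IsConvexCone L) :
    IsConvexCone (K ∩ L) :=
  ⟨⟨hK.zero_mem, hL.zero_mem⟩,
    fun x hx y hy => ⟨hK.add_mem x hx.1 y hy.1, hL.add_mem x hx.2 y hy.2⟩,
    fun t ht x hx => ⟨hK.smul_mem t ht x hx.1, hL.smul_mem t ht x hx.2⟩⟩

theorem coneOver_subset {K S : Set V} (hK : IsConvexCone K) (h : S ⊆ K) :
    coneOver (convexHull ℝ S) ⊆ K := by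
  rintro y (rfl | ⟨r, hr, x, hx, rfl⟩)
  · exact hK.zero_mem
  · exact hK.smul_mem r hr x (convexHull_min h hK.convex hx)

end IsConvexCone

theorem sum_mem_coneOver {V : Type*} [AddCommGroup V] [Module ℝ V] {S : Set V} (hS : Convex ℝ S)
    {ι : Type*} (t : Finset ι) (c : ι → ℝ) (p : ι → V) (hc : ∀ i ∈ t, 0 ≤ c i)
    (hp : ∀ i ∈ t, p i ∈ S) : ∑ i ∈ t, c i • p i ∈ coneOver S := by
  rcases (Finset.sum_nonneg hc).eq_or_lt with h | h
  · left
    refine Finset.sum_eq_zero fun i hi => ?_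
    rw [(Finset.sum_eq_zero_iff_of_nonneg hc).1 h.symm i hi, zero_smul]
  · right
    refine ⟨∑ i ∈ t, c i, h.le, t.centerMass c p, hS.centerMass_mem hc h hp, ?_⟩
    rw [Finset.centerMass, smul_smul, mul_inv_cancel₀ h.ne', one_smul]

theorem isConvexCone_coneOver {V : Type*} [AddCommGroup V] [Module ℝ V] {S : Set V}
    (hS : Convex ℝ S) : IsConvexCone (coneOver S) where
  zero_mem := Or.inl rfl
  add_mem := by
    rintro x (rfl | ⟨r, hr, p, hp, rfl⟩) y hy
    · simpa using hy
    rcases hy with rfl | ⟨r', hr', p', hp', rfl⟩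
    · rw [add_zero]; exact Or.inr ⟨r, hr, p, hp, rfl⟩
    have := sum_mem_coneOver hS Finset.univ ![r, r'] ![p, p']
      (by intro i _; fin_cases i <;> simpa) (by intro i _; fin_cases i <;> simpa)
    simpa using this
  smul_mem := by
    rintro t ht x (rfl | ⟨r, hr, p, hp, rfl⟩)
    · rw [smul_zero]; exact Or.inl rfl
    · exact Or.inr ⟨t * r, by positivity, p, hp, by rw [smul_smul]⟩

theorem subset_coneOver {V : Type*} [AddCommGroup V] [Module ℝ V] (S : Set V) : S ⊆ coneOver S :=
  fun x hx => Or.inr ⟨1, zero_le_one, x, hx, by simp⟩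

/-- A point of the cone over the convex hull of `S` is a nonnegative combination of points
of `S`. -/
theorem exists_sum_of_mem_coneOver {V : Type*} [AddCommGroup V] [Module ℝ V] {S : Set V} {x : V}
    (hx : x ∈ coneOver (convexHull ℝ S)) :
    ∃ (ι : Type) (_ : Fintype ι) (c : ι → ℝ) (p : ι → V), (∀ i, 0 < c i) ∧ (∀ i, p i ∈ S) ∧
      x = ∑ i, c i • p i := by
  classical
  let K : Set V := {x | ∃ (ι : Type) (_ : Fintype ι) (c : ι → ℝ) (p : ι → V),
    (∀ i, 0 < c i) ∧ (∀ i, p i ∈ S) ∧ x = ∑ i, c i • p i}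
  have hK : IsConvexCone K := by
    refine ⟨⟨Empty, inferInstance, Empty.elim, Empty.elim, by simp, by simp, by simp⟩, ?_, ?_⟩
    · rintro x ⟨ι, _, c, p, hc, hp, rfl⟩ y ⟨κ, _, d, q, hd, hq, rfl⟩
      refine ⟨ι ⊕ κ, inferInstance, Sum.elim c d, Sum.elim p q, ?_, ?_, by simp⟩
      · rintro (i | i) <;> simp [hc, hd]
      · rintro (i | i) <;> simp [hp, hq]
    · rintro t ht x ⟨ι, _, c, p, hc, hp, rfl⟩
      rcases ht.eq_or_lt with rfl | ht
      · exact ⟨Empty, inferInstance, Empty.elim, Empty.elim, by simp, by simp, by simp⟩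
      · exact ⟨ι, inferInstance, fun i => t * c i, p, fun i => mul_pos ht (hc i), hp, by
          simp [Finset.smul_sum, smul_smul]⟩
  refine hK.coneOver_subset (fun x hx => ?_) hx
  exact ⟨Unit, inferInstance, fun _ => 1, fun _ => x, by simp, by simpa using hx, by simp⟩

theorem isExposed_of_le_zero {n : ℕ} {K : Set (Fin n → ℝ)} (l : (Fin n → ℝ) →ₗ[ℝ] ℝ)
    (h0 : (0 : Fin n → ℝ) ∈ K) (hl : ∀ x ∈ K, l x ≤ 0) : IsExposed ℝ K {x ∈ K | l x = 0} := by
  intro _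
  refine ⟨LinearMap.toContinuousLinearMap l, ?_⟩
  ext x
  simp only [Set.mem_ofPred_eq, LinearMap.coe_toContinuousLinearMap']
  constructor
  · rintro ⟨hx, h⟩
    exact ⟨hx, fun y hy => by rw [h]; exact hl y hy⟩
  · rintro ⟨hx, h⟩
    have := h 0 h0
    rw [map_zero] at this
    exact ⟨hx, le_antisymm (hl x hx) this⟩

/-- A linear function bounded above on a cone has maximum zero: scaling a maximiser by `2` and by
`0` cannot increase the value. -/
theorem IsConvexCone.exists_of_isExposed {n : ℕ} {K F : Set (Fin n → ℝ)} (hK : IsConvexCone K)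
    (hF : IsExposed ℝ K F) (hne : F.Nonempty) :
    ∃ l : (Fin n → ℝ) →ₗ[ℝ] ℝ, (∀ x ∈ K, l x ≤ 0) ∧ F = {x ∈ K | l x = 0} := by
  obtain ⟨l, hl⟩ := hF hne
  obtain ⟨x₀, hx₀⟩ := hne
  have hx₀' := hx₀
  rw [hl] at hx₀'
  have h0 : l x₀ = 0 := by
    have h1 := hx₀'.2 _ (hK.smul_mem 2 (by norm_num) _ hx₀'.1)
    have h2 := hx₀'.2 _ hK.zero_mem
    simp only [map_smul, smul_eq_mul, map_zero] at h1 h2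
    linarith
  refine ⟨l, fun x hx => h0 ▸ hx₀'.2 x hx, ?_⟩
  rw [hl]
  ext x
  simp only [Set.mem_ofPred_eq]
  refine and_congr_right fun hx => ⟨fun h => ?_, fun h y hy => ?_⟩
  · exact le_antisymm (h0 ▸ hx₀'.2 x hx) (h0 ▸ h x₀ hx₀'.1)
  · exact (hx₀'.2 y hy).trans (by rw [h0]; exact h.ge)

theorem IsConvexCone.of_isExposed {n : ℕ} {K F : Set (Fin n → ℝ)} (hK : IsConvexCone K)
    (hF : IsExposed ℝ K F) (hne : F.Nonempty) : IsConvexCone F := by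
  obtain ⟨l, hl, rfl⟩ := hK.exists_of_isExposed hF hne
  refine ⟨⟨hK.zero_mem, map_zero l⟩, ?_, ?_⟩
  · rintro x ⟨hx, hx'⟩ y ⟨hy, hy'⟩
    exact ⟨hK.add_mem x hx y hy, by rw [map_add, hx', hy', add_zero]⟩
  · rintro t ht x ⟨hx, hx'⟩
    exact ⟨hK.smul_mem t ht x hx, by rw [map_smul, hx', smul_zero]⟩

/-- If a nonnegative combination of elements of a convex cone lies in an exposed face, so do the
elements with positive coefficients. -/
theorem IsConvexCone.mem_of_sum_mem {n : ℕ} {K F : Set (Fin n → ℝ)} (hK : IsConvexCone K)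
    (hF : IsExposed ℝ K F) {ι : Type*} [Fintype ι] {c : ι → ℝ} {p : ι → Fin n → ℝ}
    (hc : ∀ i, 0 ≤ c i) (hp : ∀ i, 0 < c i → p i ∈ K) (h : ∑ i, c i • p i ∈ F) (i : ι)
    (hi : 0 < c i) : p i ∈ F := by
  obtain ⟨l, hl, rfl⟩ := hK.exists_of_isExposed hF ⟨_, h⟩
  have h2 := h.2
  simp only [map_sum, map_smul, smul_eq_mul] at h2
  have hle : ∀ i ∈ Finset.univ, c i * l (p i) ≤ 0 := by
    intro i _
    rcases (hc i).eq_or_lt with h | h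
    · simp [← h]
    · exact mul_nonpos_of_nonneg_of_nonpos (hc i) (hl _ (hp i h))
  have := (Finset.sum_eq_zero_iff_of_nonpos hle).1 h2 i (Finset.mem_univ i)
  exact ⟨hp i hi, (mul_eq_zero.1 this).resolve_left hi.ne'⟩

/-- Nonempty extreme subcones of a polyhedral cone are exposed. -/
theorem isExposed_of_isExtreme {n : ℕ} (s : Finset ((Fin n → ℝ) →ₗ[ℝ] ℝ)) {K F : Set (Fin n → ℝ)}
    (hK : K = {x | ∀ A ∈ s, A x ≤ 0}) (hF : IsExtreme ℝ K F) (hFc : IsConvexCone F) :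
    IsExposed ℝ K F := by
  classical
  have hK0 : (0 : Fin n → ℝ) ∈ K := hF.1 hFc.zero_mem
  have hex : ∀ A : (Fin n → ℝ) →ₗ[ℝ] ℝ, ∃ x ∈ F, (∃ z ∈ F, A z ≠ 0) → A x ≠ 0 := by
    intro A
    by_cases h : ∃ z ∈ F, A z ≠ 0
    · obtain ⟨z, hz, hz'⟩ := h
      exact ⟨z, hz, fun _ => hz'⟩
    · exact ⟨0, hFc.zero_mem, fun h' => absurd h' h⟩
  choose q hqF hq using hex
  have hle : ∀ A ∈ s, ∀ x ∈ F, A x ≤ 0 := fun A hA x hx => by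
    have := hF.1 hx
    rw [hK] at this
    exact this A hA
  -- A relatively interior point of `F`: every constraint that is not identically zero on `F` is
  -- strict at `x₀`.
  set x₀ := ∑ A ∈ s, q A with hx₀
  have hx₀F : x₀ ∈ F := hFc.sum_mem s q fun A _ => hqF A
  have hneg : ∀ A ∈ s, (∃ z ∈ F, A z ≠ 0) → A x₀ < 0 := by
    intro A hA hz
    rw [hx₀, map_sum]
    refine (Finset.sum_lt_sum (g := fun _ => (0 : ℝ)) (fun B _ => hle A hA _ (hqF B))
      ⟨A, hA, lt_of_le_of_ne (hle A hA _ (hqF A)) (hq A hz)⟩).trans_eq (by simp)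
  let I := s.filter fun A => ∀ z ∈ F, A z = 0
  let l : (Fin n → ℝ) →ₗ[ℝ] ℝ := ∑ A ∈ I, A
  have hlx : ∀ x, l x = ∑ A ∈ I, A x := fun x => by simp [l]
  have hIle : ∀ x ∈ K, ∀ A ∈ I, A x ≤ 0 := fun x hx A hA => by
    rw [hK] at hx
    exact hx A (Finset.mem_filter.1 hA).1
  have hlK : ∀ x ∈ K, l x ≤ 0 := fun x hx => by
    rw [hlx]
    exact Finset.sum_nonpos (hIle x hx)
  have hEq : F = {x ∈ K | l x = 0} := by
    apply Set.Subset.antisymm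
    · intro x hx
      refine ⟨hF.1 hx, ?_⟩
      rw [hlx]
      exact Finset.sum_eq_zero fun A hA => (Finset.mem_filter.1 hA).2 x hx
    · rintro y ⟨hy, hly⟩
      rw [hlx, Finset.sum_eq_zero_iff_of_nonpos (hIle y hy)] at hly
      -- For small `δ > 0` the point `x₀ - δ y` still lies in `K`. Then `x₀` is the midpoint of `2δ
      -- y` and `2(x₀ - δ y)`, so extremality of `F` gives `y ∈ F`.
      have hev : ∀ᶠ δ in nhdsWithin (0 : ℝ) (Set.Ioi 0), ∀ A ∈ s, A x₀ - δ * A y ≤ 0 := by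
        rw [Filter.eventually_all_finset]
        intro A hA
        by_cases hAF : ∃ z ∈ F, A z ≠ 0
        · have hcont : Filter.Tendsto (fun δ : ℝ => A x₀ - δ * A y)
              (nhdsWithin (0 : ℝ) (Set.Ioi 0)) (nhds (A x₀ - 0 * A y)) :=
            ((by fun_prop : Continuous fun δ : ℝ => A x₀ - δ * A y).tendsto 0).mono_left
              nhdsWithin_le_nhds
          refine (hcont.eventually_lt_const (u := 0) (by simpa using hneg A hA hAF)).mono
            fun δ h => h.le
        · push Not at hAF
          have h1 : A y = 0 := hly A (Finset.mem_filter.2 ⟨hA, hAF⟩)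
          have h2 : A x₀ = 0 := hAF x₀ hx₀F
          simp [h1, h2]
      obtain ⟨δ, hδ, hδ0⟩ := (hev.and self_mem_nhdsWithin).exists
      have hδ0 : 0 < δ := hδ0
      have hmem1 : (2 : ℝ) • (x₀ - δ • y) ∈ K := by
        rw [hK]
        intro A hA
        have := hδ A hA
        simp only [map_smul, map_sub, smul_eq_mul]
        linarith
      have hmem2 : (2 * δ) • y ∈ K := by
        rw [hK] at hy ⊢
        intro A hA
        have := hy A hA
        simp only [map_smul, smul_eq_mul]
        exact mul_nonpos_of_nonneg_of_nonpos (by positivity) this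
      have hseg : x₀ ∈ openSegment ℝ ((2 * δ) • y) ((2 : ℝ) • (x₀ - δ • y)) := by
        refine ⟨1 / 2, 1 / 2, by norm_num, by norm_num, by norm_num, ?_⟩
        module
      have := hF.left_mem_of_mem_openSegment hmem2 hmem1 hx₀F hseg
      have h3 := hFc.smul_mem (2 * δ)⁻¹ (by positivity) _ this
      rwa [smul_smul, inv_mul_cancel₀ (by positivity), one_smul] at h3
  rw [hEq]
  exact isExposed_of_le_zero l hK0 hlK

/-! ### Sublinear and piecewise linear functions -/

/-- Sublinear functions. -/
structure IsSublinear {n : ℕ} (φ : (Fin n → ℝ) → ℝ) : Prop where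
  add_le : ∀ x y, φ (x + y) ≤ φ x + φ y
  smul : ∀ (t : ℝ) (x : Fin n → ℝ), 0 ≤ t → φ (t • x) = t * φ x

namespace IsSublinear

variable {n : ℕ} {φ ψ : (Fin n → ℝ) → ℝ}

theorem map_zero (h : IsSublinear φ) : φ 0 = 0 := by
  simpa using h.smul 0 0 le_rfl

theorem sum_le (h : IsSublinear φ) {ι : Type*} (s : Finset ι) (c : ι → ℝ) (p : ι → Fin n → ℝ)
    (hc : ∀ i ∈ s, 0 ≤ c i) : φ (∑ i ∈ s, c i • p i) ≤ ∑ i ∈ s, c i * φ (p i) := by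
  classical
  induction s using Finset.induction_on with
  | empty => simp [h.map_zero]
  | insert a s has ih =>
    rw [Finset.sum_insert has, Finset.sum_insert has]
    refine (h.add_le _ _).trans (add_le_add ?_ (ih fun i hi => hc i (by simp [hi])))
    rw [h.smul _ _ (hc a (by simp))]

theorem convexOn (h : IsSublinear φ) : ConvexOn ℝ Set.univ φ := by
  refine ⟨convex_univ, fun x _ y _ a b ha hb _ => ?_⟩
  refine (h.add_le _ _).trans ?_
  rw [h.smul _ _ ha, h.smul _ _ hb, smul_eq_mul, smul_eq_mul]

theorem add (h : IsSublinear φ) (h' : IsSublinear ψ) : IsSublinear (fun x => φ x + ψ x) := by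
  refine ⟨fun x y => ?_, fun t x ht => ?_⟩
  · linarith [h.add_le x y, h'.add_le x y]
  · simp only [h.smul t x ht, h'.smul t x ht]; ring

theorem isConvexCone (h : IsSublinear φ) {L : (Fin n → ℝ) →ₗ[ℝ] ℝ} (hL : ∀ x, L x ≤ φ x) :
    IsConvexCone {x | φ x = L x} := by
  refine ⟨by simp [h.map_zero], fun x hx y hy => ?_, fun t ht x hx => ?_⟩
  · have hx : φ x = L x := hx
    have hy : φ y = L y := hy
    refine le_antisymm ((h.add_le x y).trans ?_) (hL _)
    rw [map_add, hx, hy]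
  · have hx : φ x = L x := hx
    show φ _ = L _
    rw [h.smul t x ht, hx, map_smul, smul_eq_mul]

/-- Every value of a sublinear function is attained by a linear function below it. -/
theorem exists_linear (h : IsSublinear φ) (x : Fin n → ℝ) :
    ∃ L : (Fin n → ℝ) →ₗ[ℝ] ℝ, L x = φ x ∧ ∀ y, L y ≤ φ y := by
  have hneg : 0 ≤ φ x + φ (-x) := by
    have := h.add_le x (-x)
    rwa [add_neg_cancel, h.map_zero] at this
  by_cases hx : x = 0
  · obtain ⟨g, -, hg⟩ := exists_extension_of_le_sublinear (⊥ : (Fin n → ℝ) →ₗ.[ℝ] ℝ) φ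
      (fun c hc x => h.smul c x hc.le) h.add_le (by
        rintro ⟨y, hy⟩
        have : y = 0 := (Submodule.mem_bot ℝ).1 hy
        subst this
        rw [h.map_zero]
        exact (LinearMap.map_zero _).le)
    exact ⟨g, by rw [hx, _root_.map_zero, h.map_zero], hg⟩
  · obtain ⟨g, hg, hg'⟩ := exists_extension_of_le_sublinear
      (LinearPMap.mkSpanSingleton x (φ x) hx) φ
      (fun c hc x => h.smul c x hc.le) h.add_le (by
        rintro ⟨y, hy⟩
        obtain ⟨t, rfl⟩ := Submodule.mem_span_singleton.1 hy
        rw [LinearPMap.mkSpanSingleton'_apply]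
        simp only [smul_eq_mul, RingHom.id_apply]
        rcases le_total 0 t with ht | ht
        · rw [h.smul t x ht]
        · have := h.smul (-t) (-x) (by linarith)
          rw [smul_neg, neg_smul, neg_neg] at this
          rw [this]
          nlinarith)
    refine ⟨g, ?_, hg'⟩
    have := hg ⟨x, Submodule.mem_span_singleton_self x⟩
    rw [this]
    exact LinearPMap.mkSpanSingleton_apply ℝ ℝ hx (φ x)

end IsSublinear

theorem IsPiecewiseLinear.add {n : ℕ} {φ ψ : (Fin n → ℝ) → ℝ} (h : IsPiecewiseLinear φ)
    (h' : IsPiecewiseLinear ψ) : IsPiecewiseLinear (fun x => φ x + ψ x) := by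
  classical
  obtain ⟨h1, T, hT⟩ := h
  obtain ⟨h1', T', hT'⟩ := h'
  refine ⟨h1.add h1', Finset.image (fun p => p.1 + p.2) (T ×ˢ T'), fun x => ?_⟩
  obtain ⟨L, hL, hLx⟩ := hT x
  obtain ⟨L', hL', hLx'⟩ := hT' x
  exact ⟨L + L', Finset.mem_image.2 ⟨(L, L'), Finset.mem_product.2 ⟨hL, hL'⟩, rfl⟩, by simp [hLx, hLx']⟩

/-- A linear function that agrees with a convex function on a set with nonempty interior lies
below it. -/
theorem le_of_interior_nonempty {n : ℕ} {φ : (Fin n → ℝ) → ℝ} (hφ : ConvexOn ℝ Set.univ φ)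
    {L : (Fin n → ℝ) →ₗ[ℝ] ℝ} (hL : (interior {x | φ x = L x}).Nonempty) (z : Fin n → ℝ) :
    L z ≤ φ z := by
  obtain ⟨u, hu⟩ := hL
  -- Move from the interior point `u` slightly away from `z`. Then `u` lies between the new point
  -- and `z`, and convexity on this segment bounds `L z`.
  have hcont : Filter.Tendsto (fun s : ℝ => u + s • (u - z)) (nhdsWithin (0 : ℝ) (Set.Ioi 0))
      (nhds (u + (0 : ℝ) • (u - z))) :=
    ((by fun_prop : Continuous fun s : ℝ => u + s • (u - z)).tendsto 0).mono_left
      nhdsWithin_le_nhds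
  rw [zero_smul, add_zero] at hcont
  obtain ⟨s, hs, hs0⟩ := ((hcont.eventually (mem_interior_iff_mem_nhds.1 hu)).and
    self_mem_nhdsWithin).exists
  have hs0 : 0 < s := hs0
  have hs : φ (u + s • (u - z)) = L (u + s • (u - z)) := hs
  have hu' : φ u = L u := (interior_subset hu : u ∈ {x | φ x = L x})
  have hconv := hφ.2
  have key := hconv (Set.mem_univ (u + s • (u - z))) (Set.mem_univ z)
    (by positivity : 0 ≤ 1 / (1 + s)) (by positivity : 0 ≤ s / (1 + s)) (by field_simp)
  have he : (1 / (1 + s)) • (u + s • (u - z)) + (s / (1 + s)) • z = u := by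
    ext i
    simp
    field_simp
    ring
  rw [he, hu', hs] at key
  simp only [map_add, map_smul, map_sub, smul_eq_mul] at key
  have h2 : (1 + s) * L u ≤ (L u + s * (L u - L z)) + s * φ z := by
    have := mul_le_mul_of_nonneg_left key (by positivity : 0 ≤ 1 + s)
    refine this.trans_eq ?_
    field_simp
  nlinarith

/-- The maximal domains of linearity of a piecewise linear function cover the space. -/
theorem IsPiecewiseLinear.exists_finset {n : ℕ} {φ : (Fin n → ℝ) → ℝ}
    (h : IsPiecewiseLinear φ) :
    ∃ T : Finset ((Fin n → ℝ) →ₗ[ℝ] ℝ), (∀ L ∈ T, (interior {x | φ x = L x}).Nonempty) ∧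
      ∀ x, ∃ L ∈ T, φ x = L x := by
  classical
  obtain ⟨hc, T, hT⟩ := h
  have hclosed : ∀ L : (Fin n → ℝ) →ₗ[ℝ] ℝ, IsClosed {x | φ x = L x} := fun L =>
    isClosed_eq hc (LinearMap.continuous_of_finiteDimensional L)
  let P : ((Fin n → ℝ) →ₗ[ℝ] ℝ) → Prop := fun L => (interior {x | φ x = L x}).Nonempty
  refine ⟨T.filter P, fun L hL => (Finset.mem_filter.1 hL).2, fun x => ?_⟩
  by_contra hx
  push Not at hx
  let U : Set (Fin n → ℝ) := ⋂ L ∈ (T.filter P : Set ((Fin n → ℝ) →ₗ[ℝ] ℝ)), {x | φ x = L x}ᶜ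
  have hU : IsOpen U := (Finset.finite_toSet _).isOpen_biInter fun L _ => (hclosed L).isOpen_compl
  have hxU : x ∈ U := by
    simp only [U, Set.mem_iInter]
    intro L hL
    exact hx L hL
  -- The pieces with empty interior have dense open complements, finitely many of which still meet
  -- the open set `U` avoiding all full-dimensional pieces; at such a point no piece is left.
  have hd : Dense (⋂ L ∈ ((T.filter fun L => ¬ P L : Finset _) : Set ((Fin n → ℝ) →ₗ[ℝ] ℝ)),
      {x | φ x = L x}ᶜ) := by
    refine dense_biInter_of_isOpen (fun L _ => (hclosed L).isOpen_compl)
      (Finset.finite_toSet _).countable fun L hL => ?_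
    have : ¬ P L := (Finset.mem_filter.1 (Finset.mem_coe.1 hL)).2
    rw [← interior_eq_empty_iff_dense_compl]
    exact Set.not_nonempty_iff_eq_empty.1 this
  obtain ⟨y, hyU, hy⟩ := hd.inter_open_nonempty U hU ⟨x, hxU⟩
  obtain ⟨L, hL, hLy⟩ := hT y
  by_cases hP : P L
  · exact (Set.mem_iInter₂.1 hyU L (Finset.mem_coe.2 (Finset.mem_filter.2 ⟨hL, hP⟩))) hLy
  · exact (Set.mem_iInter₂.1 hy L (Finset.mem_coe.2 (Finset.mem_filter.2 ⟨hL, hP⟩))) hLy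

theorem IsPiecewiseLinear.isSublinear {n : ℕ} {φ : (Fin n → ℝ) → ℝ} (h : IsPiecewiseLinear φ)
    (hφ : ConvexOn ℝ Set.univ φ) : IsSublinear φ := by
  obtain ⟨T, hT, hx⟩ := h.exists_finset
  have hle : ∀ L ∈ T, ∀ z, L z ≤ φ z := fun L hL => le_of_interior_nonempty hφ (hT L hL)
  have h0 : φ 0 = 0 := by
    obtain ⟨L, -, hL⟩ := hx 0
    simpa using hL
  refine ⟨fun x y => ?_, fun t x ht => ?_⟩
  · obtain ⟨L, hL, hxy⟩ := hx (x + y)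
    rw [hxy, map_add]
    exact add_le_add (hle L hL x) (hle L hL y)
  · rcases ht.eq_or_lt with rfl | ht
    · simp [h0]
    apply le_antisymm
    · obtain ⟨L, hL, hxy⟩ := hx (t • x)
      rw [hxy, map_smul, smul_eq_mul]
      exact mul_le_mul_of_nonneg_left (hle L hL x) ht.le
    · obtain ⟨L, hL, hxy⟩ := hx x
      rw [hxy, ← smul_eq_mul, ← map_smul]
      exact hle L hL _

/-- The domains of linearity of a convex piecewise linear function are polyhedral. -/
theorem IsPiecewiseLinear.exists_polyhedral {n : ℕ} {φ : (Fin n → ℝ) → ℝ}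
    (hφ : IsPiecewiseLinear φ) (hconv : ConvexOn ℝ Set.univ φ) {L : (Fin n → ℝ) →ₗ[ℝ] ℝ}
    (hL : ∀ z, L z ≤ φ z) : ∃ s : Finset ((Fin n → ℝ) →ₗ[ℝ] ℝ),
      {x | φ x = L x} = {x | ∀ A ∈ s, A x ≤ 0} := by
  classical
  obtain ⟨T₀, hT₀, hcov⟩ := hφ.exists_finset
  refine ⟨T₀.image fun L' => L' - L, ?_⟩
  ext x
  simp only [Set.mem_ofPred_eq, Finset.forall_mem_image, LinearMap.sub_apply]
  constructor
  · intro h L' hL'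
    linarith [le_of_interior_nonempty hconv (hT₀ L' hL') x]
  · intro h
    obtain ⟨L', hL', hx⟩ := hcov x
    refine le_antisymm ?_ (hL x)
    rw [hx]
    linarith [h hL']

/-- Faces of faces and intersections of faces are extreme subcones of a domain of linearity. Such a
domain is polyhedral, so extreme subcones are exposed. Two domains `φ = L` and `φ = L'` meet in the
face of the first on which `L' - L`, nonpositive there, vanishes. -/
theorem isFan_of_subset_linearityFan {n : ℕ} {φ : (Fin n → ℝ) → ℝ} (hφ : IsPiecewiseLinear φ)
    (hconv : ConvexOn ℝ Set.univ φ) {T : Set (Set (Fin n → ℝ))} (hT : T ⊆ linearityFan φ)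
    (hdown : ∀ C ∈ T, ∀ F ∈ linearityFan φ, F ⊆ C → F ∈ T) (hfin : T.Finite) (hne : T.Nonempty)
    (hrat : ∀ C ∈ T, ∃ s : Set (Fin n → ℝ), s.Finite ∧ s ⊆ lattice n ∧
      C = coneOver (convexHull ℝ s))
    (hpt : ∀ C ∈ T, ∀ x ∈ C, -x ∈ C → x = 0) : IsFan T := by
  have hsub := hφ.isSublinear hconv
  refine ⟨hfin, hne, hrat, hpt, ?_, ?_⟩
  · intro C hC F hFne hF
    obtain ⟨-, K, ⟨hK, L, rfl⟩, hCK⟩ := hT hC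
    have hL := le_of_interior_nonempty hconv hK
    obtain ⟨s, hs⟩ := hφ.exists_polyhedral hconv hL
    have hKc := hsub.isConvexCone hL
    have hCc := hKc.of_isExposed hCK (hFne.mono hF.subset)
    refine hdown C hC F ⟨hFne, _, ⟨hK, L, rfl⟩, ?_⟩ hF.subset
    exact isExposed_of_isExtreme s hs (hCK.isExtreme.trans hF.isExtreme) (hCc.of_isExposed hF hFne)
  · have key : ∀ C ∈ T, ∀ D ∈ T, IsExposed ℝ C (C ∩ D) := by
      intro C hC D hD
      obtain ⟨hCne, K, ⟨hK, L, rfl⟩, hCK⟩ := hT hC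
      obtain ⟨hDne, K', ⟨hK', L', rfl⟩, hDK⟩ := hT hD
      have hL := le_of_interior_nonempty hconv hK
      have hL' := le_of_interior_nonempty hconv hK'
      obtain ⟨s, hs⟩ := hφ.exists_polyhedral hconv hL
      have hKc := hsub.isConvexCone hL
      have hCc := hKc.of_isExposed hCK hCne
      have hDc := (hsub.isConvexCone hL').of_isExposed hDK hDne
      have h1 : IsExposed ℝ {x | φ x = L x} {x ∈ {x | φ x = L x} | (L' - L) x = 0} :=
        isExposed_of_le_zero (L' - L) hKc.zero_mem fun x hx => by
          have hx : φ x = L x := hx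
          rw [LinearMap.sub_apply, ← hx]
          linarith [hL' x]
      have h2 : {x ∈ {x | φ x = L x} | (L' - L) x = 0} = {x | φ x = L x} ∩ {x | φ x = L' x} := by
        ext x
        simp only [Set.mem_ofPred_eq, Set.mem_inter_iff, LinearMap.sub_apply]
        refine and_congr_right fun hx => ?_
        rw [hx, sub_eq_zero, eq_comm]
      rw [h2] at h1
      have h3 : IsExtreme ℝ ({x | φ x = L x} ∩ {x | φ x = L' x}) ({x | φ x = L x} ∩ D) := by
        refine ⟨Set.inter_subset_inter_right _ hDK.subset, ?_⟩
        intro x hx y hy z hz hzs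
        exact ⟨hx.1, hDK.isExtreme.2 hx.2 hy.2 hz.2 hzs⟩
      have h4 : IsExtreme ℝ {x | φ x = L x} (C ∩ D) := by
        have := hCK.isExtreme.inter (h1.isExtreme.trans h3)
        rwa [← Set.inter_assoc, Set.inter_eq_left.2 hCK.subset] at this
      exact (isExposed_of_isExtreme s hs h4 (hCc.inter hDc)).mono hCK.subset
        Set.inter_subset_left
    intro C hC D hD
    refine ⟨key C hC D hD, ?_⟩
    rw [Set.inter_comm]
    exact key D hD C hC

/-- The linear function `x ↦ q ⬝ᵥ x`. -/
noncomputable def dotLin {n : ℕ} (q : Fin n → ℝ) : (Fin n → ℝ) →ₗ[ℝ] ℝ :=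
  ∑ i, q i • LinearMap.proj i

@[simp] theorem dotLin_apply {n : ℕ} (q x : Fin n → ℝ) : dotLin q x = q ⬝ᵥ x := by
  simp [dotLin, dotProduct]

theorem exists_dotLin {n : ℕ} (L : (Fin n → ℝ) →ₗ[ℝ] ℝ) :
    ∃ q, L = dotLin q := by
  refine ⟨fun i => L (Pi.single i 1), LinearMap.ext fun x => ?_⟩
  rw [LinearMap.pi_apply_eq_sum_univ L x, dotLin_apply]
  simp only [dotProduct, smul_eq_mul]
  refine Finset.sum_congr rfl fun i _ => ?_
  rw [mul_comm]
  congr 2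
  ext j
  simp [Pi.single_apply, eq_comm]

/-- An extreme point is determined by its set of active constraints: if `q'` satisfies with equality
all constraints active at `q`, then `q` can be moved a little in both directions along `q' - q`. -/
theorem finite_extremePoints {n : ℕ} (s : Finset (Fin n → ℝ)) (w : (Fin n → ℝ) → ℝ) :
    ({q : Fin n → ℝ | ∀ v ∈ s, q ⬝ᵥ v ≤ w v}.extremePoints ℝ).Finite := by
  classical
  set Q := {q : Fin n → ℝ | ∀ v ∈ s, q ⬝ᵥ v ≤ w v} with hQ
  refine Set.Finite.of_injOn (f := fun q => s.filter fun v => q ⬝ᵥ v = w v)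
    (t := (s.powerset : Set (Finset (Fin n → ℝ)))) ?_ ?_ (Finset.finite_toSet _)
  · intro q _
    exact Finset.mem_coe.2 (Finset.mem_powerset.2 (Finset.filter_subset _ _))
  · intro q hq q' hq' h
    have hqQ : ∀ v ∈ s, q ⬝ᵥ v ≤ w v := hq.1
    have hact : ∀ v ∈ s, q ⬝ᵥ v = w v → q' ⬝ᵥ v = w v := fun v hv hv' => by
      have : v ∈ s.filter fun v => q ⬝ᵥ v = w v := Finset.mem_filter.2 ⟨hv, hv'⟩
      have h' : (s.filter fun v => q ⬝ᵥ v = w v) = s.filter fun v => q' ⬝ᵥ v = w v := h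
      rw [h'] at this
      exact (Finset.mem_filter.1 this).2
    have hcont : ∀ (σ : ℝ) (v : Fin n → ℝ), Filter.Tendsto
        (fun δ : ℝ => q ⬝ᵥ v + δ * (σ * (q' ⬝ᵥ v - q ⬝ᵥ v))) (nhdsWithin 0 (Set.Ioi 0))
        (nhds (q ⬝ᵥ v + 0 * (σ * (q' ⬝ᵥ v - q ⬝ᵥ v)))) := fun σ v =>
      ((by fun_prop : Continuous fun δ : ℝ => q ⬝ᵥ v + δ * (σ * (q' ⬝ᵥ v - q ⬝ᵥ v))).tendsto
        0).mono_left nhdsWithin_le_nhds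
    have hev : ∀ σ : ℝ, ∀ᶠ δ in nhdsWithin (0 : ℝ) (Set.Ioi 0), ∀ v ∈ s,
        q ⬝ᵥ v + δ * (σ * (q' ⬝ᵥ v - q ⬝ᵥ v)) ≤ w v := by
      intro σ
      rw [Filter.eventually_all_finset]
      intro v hv
      by_cases hv' : q ⬝ᵥ v = w v
      · simp [hact v hv hv', hv']
      · refine ((hcont σ v).eventually_lt_const (u := w v) ?_).mono fun δ h => h.le
        simpa using lt_of_le_of_ne (hqQ v hv) hv'
    obtain ⟨δ, ⟨h1, h2⟩, hδ⟩ := (((hev 1).and (hev (-1))).and self_mem_nhdsWithin).exists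
    have hδ : 0 < δ := hδ
    have e1 : q + δ • (q' - q) ∈ Q := fun v hv => by
      have := h1 v hv
      simp only [add_dotProduct, smul_dotProduct, sub_dotProduct, smul_eq_mul]
      linarith
    have e2 : q - δ • (q' - q) ∈ Q := fun v hv => by
      have := h2 v hv
      simp only [smul_dotProduct, sub_dotProduct, smul_eq_mul]
      linarith
    have := hq.2 e1 e2 ⟨1 / 2, 1 / 2, by norm_num, by norm_num, by norm_num, by module⟩
    have h3 : δ • (q' - q) = 0 := by simpa using this
    rcases smul_eq_zero.1 h3 with h | h
    · exact absurd h hδ.ne'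
    · exact (sub_eq_zero.1 h).symm

/-- A sublinear function whose linear minorants are cut out by finitely many inequalities is
piecewise linear. -/
theorem IsSublinear.isPiecewiseLinear {n : ℕ} {φ : (Fin n → ℝ) → ℝ} (h : IsSublinear φ)
    (s : Finset (Fin n → ℝ)) (w : (Fin n → ℝ) → ℝ) (hw : ∀ v ∈ s, φ v ≤ w v)
    (hL : ∀ q : Fin n → ℝ, (∀ v ∈ s, q ⬝ᵥ v ≤ w v) → ∀ x, q ⬝ᵥ x ≤ φ x) :
    IsPiecewiseLinear φ := by
  classical
  set Q := {q : Fin n → ℝ | ∀ v ∈ s, q ⬝ᵥ v ≤ w v} with hQ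
  have hdot : ∀ v : Fin n → ℝ, Continuous fun q : Fin n → ℝ => q ⬝ᵥ v := fun v => by
    simp only [dotProduct]
    fun_prop
  have hclosed : IsClosed Q := by
    have : Q = ⋂ v ∈ s, {q : Fin n → ℝ | q ⬝ᵥ v ≤ w v} := by
      ext; simp [hQ]
    rw [this]
    exact isClosed_biInter fun v _ => isClosed_le (hdot v) continuous_const
  have hcomp : IsCompact Q := by
    refine (isCompact_Icc (a := fun i => - φ (-Pi.single i 1)) (b := fun i => φ (Pi.single i 1))
      ).of_isClosed_subset hclosed fun q hq => ⟨fun i => ?_, fun i => ?_⟩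
    · have := hL q hq (-Pi.single i 1)
      simp only [dotProduct_neg, dotProduct_single, mul_one] at this
      linarith
    · have := hL q hq (Pi.single i 1)
      simpa only [dotProduct_single, mul_one] using this
  have hconv : ConvexOn ℝ Set.univ φ := h.convexOn
  refine ⟨continuousOn_univ.1 (hconv.continuousOn isOpen_univ),
    (finite_extremePoints s w).toFinset.image dotLin, fun x => ?_⟩
  obtain ⟨L, hLx, hLle⟩ := h.exists_linear x
  obtain ⟨q₀, rfl⟩ := exists_dotLin L
  simp only [dotLin_apply] at hLx hLle
  have hq₀ : q₀ ∈ Q := fun v hv => (hLle v).trans (hw v hv)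
  -- The maximum of `q ⬝ᵥ x` over the compact polyhedron of minorants is `φ x`, and the face on
  -- which it is attained has an extreme point. So the finitely many extreme points of `Q` suffice
  -- as linear pieces.
  have hface : IsExposed ℝ Q {q ∈ Q | ∀ q' ∈ Q, q' ⬝ᵥ x ≤ q ⬝ᵥ x} := by
    intro _
    refine ⟨LinearMap.toContinuousLinearMap (dotLin x), ?_⟩
    simp [dotProduct_comm]
  obtain ⟨q, hq⟩ := (hface.isCompact hcomp).extremePoints_nonempty
    ⟨q₀, hq₀, fun q' hq' => (hL q' hq' x).trans hLx.ge⟩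
  refine ⟨dotLin q, Finset.mem_image_of_mem _ ((Set.Finite.mem_toFinset _).2 ?_), ?_⟩
  · exact hface.isExtreme.extremePoints_subset_extremePoints hq
  · rw [dotLin_apply]
    exact le_antisymm (hLx.symm.trans_le (hq.1.2 q₀ hq₀)) (hL q hq.1.1 x)

/-! ### Lower functions -/

theorem dotProduct_isSublinear {n : ℕ} (q : Fin n → ℝ) : IsSublinear fun x => q ⬝ᵥ x :=
  ⟨fun x y => (dotProduct_add q x y).le, fun t x _ => by simp⟩

section LowerFunction

variable {n : ℕ} {S : Set ((Fin n → ℝ) × ℝ)} {ψ : (Fin n → ℝ) → ℝ}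

/-- The epigraph of `ψ` is a convex cone, so it contains the cone over `S` once it contains `S`.
This bounds from below the set whose infimum defines `lowerFunction`, which keeps `sInf` from taking
its default value. -/
theorem IsSublinear.le_of_mem_coneOver (hψ : IsSublinear ψ) (hS : ∀ p ∈ S, ψ p.1 ≤ p.2)
    {x : Fin n → ℝ} {r : ℝ} (h : (x, r) ∈ coneOver (convexHull ℝ S)) : ψ x ≤ r := by
  have hK : IsConvexCone {p : (Fin n → ℝ) × ℝ | ψ p.1 ≤ p.2} := by
    refine ⟨by simp [hψ.map_zero], fun p hp q hq => ?_, fun t ht p hp => ?_⟩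
    · exact (hψ.add_le _ _).trans (add_le_add hp hq)
    · exact (hψ.smul t _ ht).trans_le (mul_le_mul_of_nonneg_left hp ht)
  exact hK.coneOver_subset (S := S) hS h

theorem IsSublinear.le_lowerFunction (hψ : IsSublinear ψ) (hS : ∀ p ∈ S, ψ p.1 ≤ p.2)
    {x : Fin n → ℝ} (hne : ∃ r, (x, r) ∈ coneOver (convexHull ℝ S)) : ψ x ≤ lowerFunction S x :=
  le_csInf hne fun _ hr => hψ.le_of_mem_coneOver hS hr

theorem IsSublinear.lowerFunction_le (hψ : IsSublinear ψ) (hS : ∀ p ∈ S, ψ p.1 ≤ p.2)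
    {x : Fin n → ℝ} {r : ℝ} (h : (x, r) ∈ coneOver (convexHull ℝ S)) : lowerFunction S x ≤ r :=
  csInf_le ⟨ψ x, fun _ hr => hψ.le_of_mem_coneOver hS hr⟩ h

theorem IsSublinear.lowerFunction (hψ : IsSublinear ψ) (hS : ∀ p ∈ S, ψ p.1 ≤ p.2)
    (hne : ∀ x, ∃ r, (x, r) ∈ coneOver (convexHull ℝ S)) : IsSublinear (lowerFunction S) := by
  have hK := isConvexCone_coneOver (convex_convexHull ℝ S)
  have hle : ∀ (t : ℝ) (x : Fin n → ℝ), 0 < t →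
      ConifoldMirror.lowerFunction S (t • x) ≤ t * ConifoldMirror.lowerFunction S x := by
    intro t x ht
    rw [← div_le_iff₀' ht]
    refine le_csInf (hne x) fun r hr => ?_
    rw [div_le_iff₀' ht]
    exact hψ.lowerFunction_le hS (hK.smul_mem t ht.le _ hr)
  refine ⟨fun x y => ?_, fun t x ht => ?_⟩
  · refine le_of_forall_pos_le_add fun δ hδ => ?_
    obtain ⟨r, hr, hr'⟩ := exists_lt_of_csInf_lt (hne x)
      (lt_add_of_pos_right (ConifoldMirror.lowerFunction S x) (half_pos hδ))
    obtain ⟨s, hs, hs'⟩ := exists_lt_of_csInf_lt (hne y)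
      (lt_add_of_pos_right (ConifoldMirror.lowerFunction S y) (half_pos hδ))
    have := hψ.lowerFunction_le hS (hK.add_mem _ hr _ hs)
    linarith
  · rcases ht.eq_or_lt with rfl | ht
    · have h0 : ConifoldMirror.lowerFunction S 0 = 0 := by
        refine le_antisymm (hψ.lowerFunction_le hS hK.zero_mem) ?_
        exact hψ.map_zero.symm.le.trans (hψ.le_lowerFunction hS (hne 0))
      simp [h0]
    · refine le_antisymm (hle t x ht) ?_
      have := hle t⁻¹ (t • x) (inv_pos.2 ht)
      rw [smul_smul, inv_mul_cancel₀ ht.ne', one_smul] at this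
      rwa [inv_mul_eq_div, le_div_iff₀' ht] at this

end LowerFunction

/-! ### The polytope `∇` -/

theorem minCoord_nonpos (x : Fin 5 → ℝ) : minCoord x ≤ 0 := min_le_left _ _

theorem minCoord_le (x : Fin 5 → ℝ) (i : Fin 5) : minCoord x ≤ x i :=
  (min_le_right _ _).trans (ciInf_le (Set.finite_range _).bddBelow i)

theorem minCoord_eq_zero {x : Fin 5 → ℝ} (h : ∀ i, 0 ≤ x i) : minCoord x = 0 :=
  min_eq_left (le_ciInf h)

theorem minCoord_const_neg_one : minCoord (fun _ => (-1 : ℝ)) = -1 := by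
  simp [minCoord]

theorem phi1_apply (x : Fin 5 → ℝ) :
    phi1 x = (x 0 - minCoord x) + (x 1 - minCoord x) + (x 2 - minCoord x) +
      (x 3 - minCoord x) := by
  simp [phi1, plP5, Fin.sum_univ_succ]
  ring

theorem phi2_apply (x : Fin 5 → ℝ) : phi2 x = (x 4 - minCoord x) - minCoord x := by
  simp [phi2, plP5, Fin.sum_univ_succ]
  ring

theorem mem_newt_phi1 {u : Fin 5 → ℝ} : u ∈ newt phi1 ↔
    -1 ≤ u 0 ∧ -1 ≤ u 1 ∧ -1 ≤ u 2 ∧ -1 ≤ u 3 ∧ 0 ≤ u 4 ∧ u 0 + u 1 + u 2 + u 3 + u 4 ≤ 0 := by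
  constructor
  · intro h
    have h0 := h (Pi.single 0 1)
    have h1 := h (Pi.single 1 1)
    have h2 := h (Pi.single 2 1)
    have h3 := h (Pi.single 3 1)
    have h4 := h (Pi.single 4 1)
    have h5 := h (fun _ => -1)
    have hm : ∀ i : Fin 5, minCoord (Pi.single i 1) = 0 := fun i => minCoord_eq_zero fun j => by
      rw [Pi.single_apply]; split_ifs <;> norm_num
    simp [phi1_apply, hm] at h0 h1 h2 h3 h4
    simp [phi1_apply, minCoord_const_neg_one, dotProduct, Fin.sum_univ_succ] at h5
    exact ⟨h0, h1, h2, h3, h4, by linarith⟩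
  · rintro ⟨h0, h1, h2, h3, h4, h5⟩ v
    have hm := minCoord_nonpos v
    have hv := minCoord_le v
    rw [phi1_apply]
    simp only [dotProduct, Fin.sum_univ_five]
    nlinarith [mul_nonneg (sub_nonneg.2 (hv 0)) (by linarith : 0 ≤ u 0 + 1),
      mul_nonneg (sub_nonneg.2 (hv 1)) (by linarith : 0 ≤ u 1 + 1),
      mul_nonneg (sub_nonneg.2 (hv 2)) (by linarith : 0 ≤ u 2 + 1),
      mul_nonneg (sub_nonneg.2 (hv 3)) (by linarith : 0 ≤ u 3 + 1),
      mul_nonneg (sub_nonneg.2 (hv 4)) h4, mul_nonneg_of_nonpos_of_nonpos hm h5]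

theorem mem_newt_phi2 {u : Fin 5 → ℝ} : u ∈ newt phi2 ↔
    0 ≤ u 0 ∧ 0 ≤ u 1 ∧ 0 ≤ u 2 ∧ 0 ≤ u 3 ∧ -1 ≤ u 4 ∧ u 0 + u 1 + u 2 + u 3 + u 4 ≤ 1 := by
  constructor
  · intro h
    have h0 := h (Pi.single 0 1)
    have h1 := h (Pi.single 1 1)
    have h2 := h (Pi.single 2 1)
    have h3 := h (Pi.single 3 1)
    have h4 := h (Pi.single 4 1)
    have h5 := h (fun _ => -1)
    have hm : ∀ i : Fin 5, minCoord (Pi.single i 1) = 0 := fun i => minCoord_eq_zero fun j => by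
      rw [Pi.single_apply]; split_ifs <;> norm_num
    simp [phi2_apply, hm] at h0 h1 h2 h3 h4
    simp [phi2_apply, minCoord_const_neg_one, dotProduct, Fin.sum_univ_succ] at h5
    exact ⟨h0, h1, h2, h3, h4, by linarith⟩
  · rintro ⟨h0, h1, h2, h3, h4, h5⟩ v
    have hm := minCoord_nonpos v
    have hv := minCoord_le v
    rw [phi2_apply]
    simp only [dotProduct, Fin.sum_univ_five]
    nlinarith [mul_nonneg (sub_nonneg.2 (hv 0)) h0, mul_nonneg (sub_nonneg.2 (hv 1)) h1,
      mul_nonneg (sub_nonneg.2 (hv 2)) h2, mul_nonneg (sub_nonneg.2 (hv 3)) h3,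
      mul_nonneg (sub_nonneg.2 (hv 4)) (by linarith : 0 ≤ u 4 + 1),
      mul_nonneg_of_nonpos_of_nonpos hm (by linarith : u 0 + u 1 + u 2 + u 3 + u 4 - 1 ≤ 0)]

/-- The vertices of `∇`: those of `Newt(φ₁)`, followed by those of `Newt(φ₂)`. -/
noncomputable def nablaVertex : Fin 12 → Fin 5 → ℝ :=
  ![![-1, -1, -1, -1, 0], ![3, -1, -1, -1, 0], ![-1, 3, -1, -1, 0], ![-1, -1, 3, -1, 0],
    ![-1, -1, -1, 3, 0], ![-1, -1, -1, -1, 4],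
    ![0, 0, 0, 0, -1], ![2, 0, 0, 0, -1], ![0, 2, 0, 0, -1], ![0, 0, 2, 0, -1],
    ![0, 0, 0, 2, -1], ![0, 0, 0, 0, 1]]

theorem sum_mem_convexHull_range {V ι : Type*} [AddCommGroup V] [Module ℝ V] [Fintype ι]
    (p : ι → V) (c : ι → ℝ) (hc : ∀ i, 0 ≤ c i) (h1 : ∑ i, c i = 1) :
    ∑ i, c i • p i ∈ convexHull ℝ (Set.range p) :=
  (convex_convexHull ℝ (Set.range p)).sum_mem (fun i _ => hc i) h1
    fun i _ => subset_convexHull ℝ _ (Set.mem_range_self i)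

theorem newt_phi1_subset : newt phi1 ⊆ convexHull ℝ (Set.range nablaVertex) := by
  intro u hu
  obtain ⟨h0, h1, h2, h3, h4, h5⟩ := mem_newt_phi1.1 hu
  -- The Newton polytope of `φ₁` is a simplex of side `4`; the weights are the barycentric
  -- coordinates, that is, the slacks of its six inequalities divided by `4`. For `φ₂` the side is
  -- `2`.
  have := sum_mem_convexHull_range nablaVertex
    ![-(u 0 + u 1 + u 2 + u 3 + u 4) / 4, (u 0 + 1) / 4, (u 1 + 1) / 4, (u 2 + 1) / 4,
      (u 3 + 1) / 4, u 4 / 4, 0, 0, 0, 0, 0, 0]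
    (by intro i; fin_cases i <;> simp <;> linarith)
    (by simp [Fin.sum_univ_succ]; ring)
  convert this using 1
  ext i
  fin_cases i <;> simp [Fin.sum_univ_succ, nablaVertex] <;> ring

theorem newt_phi2_subset : newt phi2 ⊆ convexHull ℝ (Set.range nablaVertex) := by
  intro u hu
  obtain ⟨h0, h1, h2, h3, h4, h5⟩ := mem_newt_phi2.1 hu
  have := sum_mem_convexHull_range nablaVertex
    ![0, 0, 0, 0, 0, 0, (1 - (u 0 + u 1 + u 2 + u 3 + u 4)) / 2, u 0 / 2, u 1 / 2, u 2 / 2,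
      u 3 / 2, (1 + u 4) / 2]
    (by intro i; fin_cases i <;> simp <;> linarith)
    (by simp [Fin.sum_univ_succ]; ring)
  convert this using 1
  ext i
  fin_cases i <;> simp [Fin.sum_univ_succ, nablaVertex] <;> ring

theorem nabla_eq : nabla = convexHull ℝ (Set.range nablaVertex) := by
  apply Set.Subset.antisymm
  · exact convexHull_min (Set.union_subset newt_phi1_subset newt_phi2_subset)
      (convex_convexHull ℝ _)
  · refine convexHull_mono ?_
    rintro _ ⟨i, rfl⟩
    rw [Set.mem_union, mem_newt_phi1, mem_newt_phi2]
    fin_cases i <;> simp [nablaVertex] <;> norm_num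

theorem nablaVertex_mem (i : Fin 12) : nablaVertex i ∈ nabla := by
  rw [nabla_eq]
  exact subset_convexHull ℝ _ (Set.mem_range_self i)

theorem convex_nabla : Convex ℝ nabla := convex_convexHull ℝ _

theorem isCompact_nabla : IsCompact nabla := by
  rw [nabla_eq]
  exact (Set.finite_range _).isCompact_convexHull ℝ

theorem IsSublinear.le_of_mem_nabla {ψ : (Fin 5 → ℝ) → ℝ} (hψ : IsSublinear ψ) {r : ℝ}
    (h : ∀ i, ψ (nablaVertex i) ≤ r) {u : Fin 5 → ℝ} (hu : u ∈ nabla) : ψ u ≤ r := by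
  rw [nabla_eq] at hu
  have hc : Convex ℝ {u | ψ u ≤ r} := by
    have := hψ.convexOn.convex_le r
    simpa using this
  exact convexHull_min (s := Set.range nablaVertex) (t := {u | ψ u ≤ r})
    (by rintro _ ⟨i, rfl⟩; exact h i) hc hu

theorem nabla_bounds {u : Fin 5 → ℝ} (hu : u ∈ nabla) (i : Fin 5) : -1 ≤ u i ∧ u i ≤ 4 := by
  constructor
  · have := (dotProduct_isSublinear (-Pi.single i 1 : Fin 5 → ℝ)).le_of_mem_nabla (r := 1) (by
      intro j
      rw [neg_dotProduct, single_one_dotProduct]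
      fin_cases i <;> fin_cases j <;> norm_num [nablaVertex]) hu
    rw [neg_dotProduct, single_one_dotProduct] at this
    linarith
  · have := (dotProduct_isSublinear (Pi.single i 1 : Fin 5 → ℝ)).le_of_mem_nabla (r := 4) (by
      intro j
      rw [single_one_dotProduct]
      fin_cases i <;> fin_cases j <;> norm_num [nablaVertex]) hu
    rwa [single_one_dotProduct] at this

theorem lattice_inter_box_finite {n : ℕ} (a b : ℤ) :
    {x ∈ lattice n | ∀ i, (a : ℝ) ≤ x i ∧ x i ≤ b}.Finite := by
  refine ((Set.finite_Icc (fun _ : Fin n => a) (fun _ => b)).image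
    fun z : Fin n → ℤ => fun i => (z i : ℝ)).subset ?_
  rintro _ ⟨⟨z, rfl⟩, hz⟩
  exact ⟨z, ⟨fun i => Int.cast_le.1 (hz i).1, fun i => Int.cast_le.1 (hz i).2⟩, rfl⟩

theorem nabla_inter_lattice_finite : (nabla ∩ lattice 5).Finite := by
  refine (lattice_inter_box_finite (n := 5) (-1) 4).subset ?_
  rintro u ⟨hu, hu'⟩
  exact ⟨hu', fun i => by simpa using nabla_bounds hu i⟩

theorem single_mem_nabla (i : Fin 5) : (Pi.single i 1 : Fin 5 → ℝ) ∈ nabla := by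
  apply subset_convexHull
  rw [Set.mem_union, mem_newt_phi1, mem_newt_phi2]
  fin_cases i <;> simp [Fin.ext_iff]

theorem neg_single_mem_nabla (i : Fin 5) : (-Pi.single i 1 : Fin 5 → ℝ) ∈ nabla := by
  apply subset_convexHull
  rw [Set.mem_union, mem_newt_phi1, mem_newt_phi2]
  fin_cases i <;> simp [Fin.ext_iff]

theorem single_mem_lattice {n : ℕ} (i : Fin n) : (Pi.single i 1 : Fin n → ℝ) ∈ lattice n :=
  ⟨Pi.single i 1, by ext j; by_cases h : j = i <;> simp [h]⟩

theorem neg_single_mem_lattice {n : ℕ} (i : Fin n) : (-Pi.single i 1 : Fin n → ℝ) ∈ lattice n :=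
  ⟨-Pi.single i 1, by ext j; by_cases h : j = i <;> simp [h]⟩

theorem zero_mem_nabla : (0 : Fin 5 → ℝ) ∈ nabla := by
  apply subset_convexHull
  rw [Set.mem_union, mem_newt_phi1]
  norm_num

/-- Every vector is a nonnegative combination of vectors `±e_i`. -/
theorem exists_sum_signed_single {n : ℕ} (x : Fin n → ℝ) : ∃ p : Fin n → Fin n → ℝ,
    (∀ i, p i = Pi.single i 1 ∨ p i = -Pi.single i 1) ∧ x = ∑ i, |x i| • p i := by
  classical
  refine ⟨fun i => if 0 ≤ x i then Pi.single i 1 else -Pi.single i 1, fun i => ?_, ?_⟩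
  · dsimp only
    split_ifs <;> simp
  · ext j
    rw [Finset.sum_apply, Finset.sum_eq_single j]
    · by_cases h : 0 ≤ x j
      · simp [h, abs_of_nonneg h]
      · simp [h, abs_of_neg (not_le.1 h)]
    · intro i _ hij
      dsimp only
      split_ifs <;> simp [hij.symm]
    · simp

theorem nabla_mem_nhds_zero : nabla ∈ nhds (0 : Fin 5 → ℝ) := by
  -- In the sup norm, radius `1/5` keeps the sum of the five absolute coordinates at most `1`; the
  -- weight left over is put on the origin.
  refine Filter.mem_of_superset (Metric.ball_mem_nhds (0 : Fin 5 → ℝ)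
    (by norm_num : (0 : ℝ) < 1 / 5)) fun x hx => ?_
  obtain ⟨p, hp, hx'⟩ := exists_sum_signed_single x
  have hb : ∀ i, |x i| ≤ 1 / 5 := fun i => by
    have := norm_le_pi_norm x i
    rw [mem_ball_zero_iff] at hx
    rw [Real.norm_eq_abs] at this
    linarith
  have hpm : ∀ i, p i ∈ nabla := fun i => by
    rcases hp i with h | h <;> rw [h]
    exacts [single_mem_nabla i, neg_single_mem_nabla i]
  have hs : ∑ i, |x i| ≤ 1 := by
    simp only [Fin.sum_univ_five]
    linarith [hb 0, hb 1, hb 2, hb 3, hb 4]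
  have := convex_nabla.sum_mem (t := Finset.univ)
    (w := fun o : Option (Fin 5) => o.elim (1 - ∑ i, |x i|) fun i => |x i|)
    (z := fun o : Option (Fin 5) => o.elim 0 p) ?_ ?_ ?_
  · rw [Fintype.sum_option] at this
    simpa [← hx'] using this
  · rintro (_ | i) _
    · simpa using hs
    · simp
  · rw [Fintype.sum_option]
    simp
  · rintro (_ | i) _
    · exact zero_mem_nabla
    · exact hpm i

theorem absorbent_nabla : Absorbent ℝ nabla := absorbent_nhds_zero nabla_mem_nhds_zero

theorem isSublinear_gauge_nabla : IsSublinear (gauge nabla) :=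
  ⟨gauge_add_le convex_nabla absorbent_nabla, fun t x ht => by
    rw [gauge_smul_of_nonneg ht, smul_eq_mul]⟩

theorem le_gauge_nabla {q : Fin 5 → ℝ} (hq : ∀ u ∈ nabla, q ⬝ᵥ u ≤ 1) (x : Fin 5 → ℝ) :
    q ⬝ᵥ x ≤ gauge nabla x := by
  rw [gauge_def]
  refine le_csInf (absorbent_nabla.gauge_set_nonempty) ?_
  rintro r ⟨hr, hx⟩
  obtain ⟨u, hu, rfl⟩ := hx
  have hr : 0 < r := hr
  rw [dotProduct_smul, smul_eq_mul]
  nlinarith [hq u hu]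

theorem eq_zero_of_gauge_nabla_nonpos {x : Fin 5 → ℝ} (h : gauge nabla x ≤ 0) : x = 0 := by
  ext i
  have h1 := le_gauge_nabla (q := -Pi.single i 1) (fun u hu => by
    rw [neg_dotProduct, single_one_dotProduct]
    linarith [(nabla_bounds hu i).1]) x
  have h2 := le_gauge_nabla (q := (1 / 4 : ℝ) • Pi.single i 1) (fun u hu => by
    rw [smul_dotProduct, single_one_dotProduct, smul_eq_mul]
    linarith [(nabla_bounds hu i).2]) x
  rw [neg_dotProduct, single_one_dotProduct] at h1
  rw [smul_dotProduct, single_one_dotProduct, smul_eq_mul] at h2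
  rw [Pi.zero_apply]
  linarith

theorem mem_nabla_of_gauge_le_one {x : Fin 5 → ℝ} (h : gauge nabla x ≤ 1) : x ∈ nabla := by
  have := (gauge_le_one_iff_mem_closure convex_nabla nabla_mem_nhds_zero).1 h
  rwa [isCompact_nabla.isClosed.closure_eq] at this

theorem isPiecewiseLinear_gauge_nabla : IsPiecewiseLinear (gauge nabla) := by
  classical
  refine isSublinear_gauge_nabla.isPiecewiseLinear (Finset.univ.image nablaVertex) (fun _ => 1)
    ?_ ?_
  · simp only [Finset.mem_image, Finset.mem_univ, true_and]
    rintro _ ⟨i, rfl⟩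
    exact gauge_le_one_of_mem (nablaVertex_mem i)
  · intro q hq
    refine le_gauge_nabla fun u hu => (dotProduct_isSublinear q).le_of_mem_nabla (fun i => ?_) hu
    exact hq _ (Finset.mem_image_of_mem _ (Finset.mem_univ i))

/-- A proper nonempty face of a polytope `P` containing the vectors `±e_i` is cut out by a linear
function which is at most `1` on `P`. -/
theorem exists_of_isProperFace {n : ℕ} {P f : Set (Fin n → ℝ)}
    (hP : ∀ i, (Pi.single i 1 : Fin n → ℝ) ∈ P) (hP' : ∀ i, (-Pi.single i 1 : Fin n → ℝ) ∈ P)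
    (hf : IsProperFace P f) (hne : f.Nonempty) :
    ∃ q : Fin n → ℝ, (∀ u ∈ P, q ⬝ᵥ u ≤ 1) ∧ f = {u ∈ P | q ⬝ᵥ u = 1} := by
  obtain ⟨l, hl⟩ := hf.1 hne
  obtain ⟨u₀, hu₀⟩ := hne
  have hu₀' := hu₀
  rw [hl] at hu₀'
  obtain ⟨q, hq⟩ := exists_dotLin (l : (Fin n → ℝ) →ₗ[ℝ] ℝ)
  have hlq : ∀ u, l u = q ⬝ᵥ u := fun u => by
    rw [← dotLin_apply, ← hq]; rfl
  have hpos : 0 < l u₀ := by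
    by_contra hle
    push Not at hle
    have hz : ∀ i, q i = 0 := fun i => by
      have h1 := hu₀'.2 _ (hP i)
      have h2 := hu₀'.2 _ (hP' i)
      rw [hlq, dotProduct_single_one] at h1
      rw [hlq, dotProduct_neg, dotProduct_single_one] at h2
      linarith
    have h0 : ∀ u, l u = 0 := fun u => by
      rw [hlq, show q = 0 from funext hz, zero_dotProduct]
    apply hf.2
    rw [hl]
    ext u
    simp [h0]
  refine ⟨(l u₀)⁻¹ • q, fun u hu => ?_, ?_⟩
  · rw [smul_dotProduct, ← hlq, smul_eq_mul, inv_mul_le_iff₀ hpos, mul_one]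
    exact hu₀'.2 u hu
  · rw [hl]
    ext u
    simp only [Set.mem_ofPred_eq, smul_dotProduct, ← hlq, smul_eq_mul]
    refine and_congr_right fun hu => ?_
    rw [inv_mul_eq_one₀ hpos.ne']
    exact ⟨fun h => le_antisymm (h u₀ hu₀'.1) (hu₀'.2 u hu), fun h v hv => h ▸ hu₀'.2 v hv⟩

/-- The cone over a face is where the gauge agrees with the supporting linear function of the face;
in this form it can be compared with domains of linearity. -/
theorem coneOver_face_eq {f : Set (Fin 5 → ℝ)} {q : Fin 5 → ℝ} (hq : ∀ u ∈ nabla, q ⬝ᵥ u ≤ 1)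
    (hf : f = {u ∈ nabla | q ⬝ᵥ u = 1}) : coneOver f = {x | q ⬝ᵥ x = gauge nabla x} := by
  ext x
  constructor
  · rintro (rfl | ⟨r, hr, u, hu, rfl⟩)
    · simp
    · rw [hf] at hu
      have h1 : gauge nabla u = 1 :=
        le_antisymm (gauge_le_one_of_mem hu.1) (hu.2 ▸ le_gauge_nabla hq u)
      simp only [Set.mem_ofPred_eq]
      rw [dotProduct_smul, hu.2, isSublinear_gauge_nabla.smul r u hr, h1, smul_eq_mul]
  · intro hx
    have hx : q ⬝ᵥ x = gauge nabla x := hx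
    by_cases h0 : gauge nabla x ≤ 0
    · exact Or.inl (eq_zero_of_gauge_nabla_nonpos h0)
    · push Not at h0
      refine Or.inr ⟨gauge nabla x, h0.le, (gauge nabla x)⁻¹ • x, ?_, ?_⟩
      · rw [hf]
        refine ⟨mem_nabla_of_gauge_le_one ?_, ?_⟩
        · rw [isSublinear_gauge_nabla.smul _ _ (inv_nonneg.2 h0.le), inv_mul_cancel₀ h0.ne']
        · rw [dotProduct_smul, hx, smul_eq_mul, inv_mul_cancel₀ h0.ne']
      · rw [smul_smul, mul_inv_cancel₀ h0.ne', one_smul]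

/-! ### The fan `Σ'_{j'}` -/

/-- The vector `x` is a nonnegative combination of lattice points of `∇`, of the smallest possible
total weight, on which `h' ∘ g*` is additive. -/
def HasLatticeLift (h' : (Fin 4 → ℝ) → ℝ) (x : Fin 5 → ℝ) : Prop :=
  ∃ (ι : Type) (_ : Fintype ι) (c : ι → ℝ) (p : ι → Fin 5 → ℝ), (∀ i, 0 ≤ c i) ∧
    (∀ i, p i ∈ nabla ∩ lattice 5) ∧ x = ∑ i, c i • p i ∧ ∑ i, c i ≤ gauge nabla x ∧
    h' (gStar x) = ∑ i, c i * h' (gStar (p i))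

/-- The zero cone over the empty face fits the same description with `q = 0`, because the gauge
vanishes only at the origin. The last clause places generators of gauge `1` in the face itself, as
crepancy requires. -/
theorem exists_of_mem_sigmaPrime {D : Set (Fin 5 → ℝ)} (hD : D ∈ sigmaPrime) :
    ∃ (f : Set (Fin 5 → ℝ)) (q : Fin 5 → ℝ), IsProperFace nabla f ∧
      (∀ u ∈ nabla, q ⬝ᵥ u ≤ 1) ∧ D = {x | q ⬝ᵥ x = gauge nabla x} ∧
      ∀ u ∈ D, gauge nabla u = 1 → u ∈ f := by
  obtain ⟨f, hf, rfl, -, -⟩ := hD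
  rcases f.eq_empty_or_nonempty with rfl | hne
  · have h0 : coneOver (∅ : Set (Fin 5 → ℝ)) = {x | (0 : Fin 5 → ℝ) ⬝ᵥ x = gauge nabla x} := by
      ext x
      simp only [coneOver, Set.mem_empty_iff_false, false_and, exists_false, and_false,
        Set.ofPred_false, insert_empty_eq, Set.mem_singleton_iff, Set.mem_ofPred_eq,
        zero_dotProduct]
      exact ⟨fun h => by rw [h, gauge_zero], fun h => eq_zero_of_gauge_nabla_nonpos h.ge⟩
    refine ⟨∅, 0, hf, fun u _ => by simp, h0, fun u hu hu' => ?_⟩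
    rw [h0] at hu
    have hu : (0 : Fin 5 → ℝ) ⬝ᵥ u = gauge nabla u := hu
    rw [hu', zero_dotProduct] at hu
    norm_num at hu
  · obtain ⟨q, hq, hfq⟩ := exists_of_isProperFace single_mem_nabla neg_single_mem_nabla hf hne
    refine ⟨f, q, hf, hq, coneOver_face_eq hq hfq, fun u hu hu' => ?_⟩
    rw [coneOver_face_eq hq hfq] at hu
    have hu : q ⬝ᵥ u = gauge nabla u := hu
    rw [hfq]
    exact ⟨mem_nabla_of_gauge_le_one hu'.le, hu.trans hu'⟩

theorem zero_mem_sigmaPrime : {0} ∈ sigmaPrime := by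
  refine ⟨∅, ⟨isExposed_empty, fun h => ?_⟩, by simp [coneOver], ?_, by simp [IsRemoved]⟩
  · have := zero_mem_nabla
    rw [← h] at this
    exact this
  · rw [Submodule.span_zero_singleton, finrank_bot]
    norm_num

section JFun

variable {h' : (Fin 4 → ℝ) → ℝ}

theorem IsSublinear.comp_gStar (hh : IsSublinear h') : IsSublinear fun x => h' (gStar x) :=
  ⟨fun x y => by rw [map_add]; exact hh.add_le _ _, fun t x ht => by
    rw [map_smul]; exact hh.smul t _ ht⟩

theorem exists_mem_coneOver_jFun (h' : (Fin 4 → ℝ) → ℝ) (x : Fin 5 → ℝ) :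
    ∃ r, (x, r) ∈ coneOver (convexHull ℝ {p : (Fin 5 → ℝ) × ℝ | p.1 ∈ nabla ∩ lattice 5 ∧
      h' (gStar p.1) ≤ p.2}) := by
  obtain ⟨p, hp, hx⟩ := exists_sum_signed_single x
  have := sum_mem_coneOver (convex_convexHull ℝ {p : (Fin 5 → ℝ) × ℝ | p.1 ∈ nabla ∩ lattice 5 ∧
      h' (gStar p.1) ≤ p.2}) Finset.univ (fun i => |x i|) (fun i => (p i, h' (gStar (p i))))
      (fun i _ => abs_nonneg _) (fun i _ => subset_convexHull ℝ _ ⟨?_, le_rfl⟩)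
  · refine ⟨∑ i, |x i| • h' (gStar (p i)), ?_⟩
    convert this using 1
    rw [Prod.ext_iff, Prod.fst_sum, Prod.snd_sum]
    exact ⟨hx, rfl⟩
  · rcases hp i with h | h <;> simp only [h]
    · exact ⟨single_mem_nabla i, single_mem_lattice i⟩
    · exact ⟨neg_single_mem_nabla i, neg_single_mem_lattice i⟩

theorem IsSublinear.comp_gStar_le_jFun (hh : IsSublinear h') (x : Fin 5 → ℝ) :
    h' (gStar x) ≤ jFun h' x :=
  hh.comp_gStar.le_lowerFunction (fun _ hp => hp.2) (exists_mem_coneOver_jFun h' x)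

theorem IsSublinear.jFun_le (hh : IsSublinear h') {u : Fin 5 → ℝ} (hu : u ∈ nabla ∩ lattice 5) :
    jFun h' u ≤ h' (gStar u) :=
  hh.comp_gStar.lowerFunction_le (fun _ hp => hp.2)
    (subset_coneOver _ (subset_convexHull ℝ _ ⟨hu, le_rfl⟩))

theorem IsSublinear.jFun (hh : IsSublinear h') : IsSublinear (jFun h') :=
  hh.comp_gStar.lowerFunction (fun _ hp => hp.2) (exists_mem_coneOver_jFun h')

theorem IsSublinear.isPiecewiseLinear_jFun (hh : IsSublinear h') :
    IsPiecewiseLinear (ConifoldMirror.jFun h') := by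
  refine hh.jFun.isPiecewiseLinear nabla_inter_lattice_finite.toFinset (fun u => h' (gStar u))
    (fun u hu => hh.jFun_le ((Set.Finite.mem_toFinset _).1 hu)) fun q hq x => ?_
  exact (dotProduct_isSublinear q).le_lowerFunction
    (fun p hp => (hq p.1 ((Set.Finite.mem_toFinset _).2 hp.1)).trans hp.2)
    (exists_mem_coneOver_jFun h' x)

theorem IsSublinear.jPrime (hh : IsSublinear h') : IsSublinear (jPrime h') :=
  hh.jFun.add isSublinear_gauge_nabla

theorem IsSublinear.isPiecewiseLinear_jPrime (hh : IsSublinear h') :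
    IsPiecewiseLinear (ConifoldMirror.jPrime h') :=
  hh.isPiecewiseLinear_jFun.add isPiecewiseLinear_gauge_nabla

/-- Sublinearity of `j` and its bound at lattice points give `≤`; `h' ∘ g*` is itself a minorant of
`j`. -/
theorem HasLatticeLift.jFun_eq (hh : IsSublinear h') {x : Fin 5 → ℝ} (hx : HasLatticeLift h' x) :
    ConifoldMirror.jFun h' x = h' (gStar x) := by
  obtain ⟨ι, _, c, p, hc, hp, rfl, -, hsum⟩ := hx
  refine le_antisymm ?_ (hh.comp_gStar_le_jFun _)
  rw [hsum]
  exact (hh.jFun.sum_le _ c p fun i _ => hc i).trans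
    (Finset.sum_le_sum fun i _ => mul_le_mul_of_nonneg_left (hh.jFun_le (hp i)) (hc i))

/-- The lattice points of `∇` used to express `x` lie in the domains of linearity of `j'`
through `x`, and on the boundary of `∇`. -/
theorem HasLatticeLift.exists_tight (hh : IsSublinear h') {x : Fin 5 → ℝ}
    (hx : HasLatticeLift h' x) {L : (Fin 5 → ℝ) →ₗ[ℝ] ℝ}
    (hL : ∀ z, L z ≤ ConifoldMirror.jPrime h' z) (hxL : ConifoldMirror.jPrime h' x = L x) :
    ∃ (ι : Type) (_ : Fintype ι) (c : ι → ℝ) (p : ι → Fin 5 → ℝ), (∀ i, 0 ≤ c i) ∧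
      x = ∑ i, c i • p i ∧ ∀ i, 0 < c i → p i ∈ nabla ∩ lattice 5 ∧
        ConifoldMirror.jPrime h' (p i) = L (p i) ∧ gauge nabla (p i) = 1 := by
  have hj := hx.jFun_eq hh
  obtain ⟨ι, _, c, p, hc, hp, rfl, hw, hsum⟩ := hx
  refine ⟨ι, inferInstance, c, p, hc, rfl, ?_⟩
  have hg1 : ∀ i, gauge nabla (p i) ≤ 1 := fun i => gauge_le_one_of_mem (hp i).1
  have hjp : ∀ i, ConifoldMirror.jPrime h' (p i) ≤ h' (gStar (p i)) + 1 := fun i =>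
    add_le_add (hh.jFun_le (hp i)) (hg1 i)
  have hLs : L (∑ i, c i • p i) = ∑ i, c i * L (p i) := by simp
  -- Each term is nonnegative because `L ≤ j' ≤ h' ∘ g* + 1` at lattice points of `∇`. The total is
  -- nonpositive because the weight of the lift is at most the gauge. So every term vanishes.
  have h1 : ∑ i, c i * (h' (gStar (p i)) + 1 - L (p i)) ≤ 0 := by
    have e : ∑ i, c i * (h' (gStar (p i)) + 1 - L (p i)) =
        ∑ i, c i * h' (gStar (p i)) + ∑ i, c i - ∑ i, c i * L (p i) := by
      rw [← Finset.sum_add_distrib, ← Finset.sum_sub_distrib]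
      exact Finset.sum_congr rfl fun i _ => by ring
    rw [e, ← hLs, ← hxL, ← hsum]
    have : ConifoldMirror.jPrime h' (∑ i, c i • p i) =
      h' (gStar (∑ i, c i • p i)) + gauge nabla (∑ i, c i • p i) := by rw [← hj]; rfl
    linarith
  have hnn : ∀ i ∈ Finset.univ, 0 ≤ c i * (h' (gStar (p i)) + 1 - L (p i)) := fun i _ =>
    mul_nonneg (hc i) (by linarith [hjp i, hL (p i)])
  have h2 : ∀ i, 0 < c i → ConifoldMirror.jPrime h' (p i) = L (p i) ∧
      h' (gStar (p i)) + 1 = L (p i) := by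
    intro i hi
    have := (Finset.sum_eq_zero_iff_of_nonneg hnn).1
      (le_antisymm h1 (Finset.sum_nonneg hnn)) i (Finset.mem_univ i)
    have := (mul_eq_zero.1 this).resolve_left hi.ne'
    constructor <;> linarith [hjp i, hL (p i)]
  intro i hi
  refine ⟨hp i, (h2 i hi).1, le_antisymm (hg1 i) ?_⟩
  have h3 : ConifoldMirror.jFun h' (p i) + gauge nabla (p i) = L (p i) := (h2 i hi).1
  linarith [(h2 i hi).2, hh.jFun_le (hp i)]

/-- On a segment inside a domain of linearity of `j'` the convex functions `j` and gauge have an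
affine sum, so both are affine. Then gauge minus `q` is affine and nonnegative there, and if it
vanishes at an inner point it vanishes at both ends. This is why `φ_∇` is added to `j`. -/
theorem isExposed_inter_of_mem_sigmaPrime (hh : IsSublinear h') {L : (Fin 5 → ℝ) →ₗ[ℝ] ℝ}
    (hL : ∀ z, L z ≤ ConifoldMirror.jPrime h' z) {D : Set (Fin 5 → ℝ)} (hD : D ∈ sigmaPrime) :
    IsExposed ℝ {x | ConifoldMirror.jPrime h' x = L x} ({x | ConifoldMirror.jPrime h' x = L x} ∩ D) := by
  obtain ⟨f, q, -, hq, rfl, -⟩ := exists_of_mem_sigmaPrime hD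
  have hqg := le_gauge_nabla hq
  obtain ⟨s, hs⟩ := hh.isPiecewiseLinear_jPrime.exists_polyhedral hh.jPrime.convexOn hL
  have hc : IsConvexCone {x | q ⬝ᵥ x = gauge nabla x} := by
    have := isSublinear_gauge_nabla.isConvexCone (L := dotLin q) (by simpa using hqg)
    simpa [eq_comm] using this
  refine isExposed_of_isExtreme s hs ⟨Set.inter_subset_left, ?_⟩
    ((hh.jPrime.isConvexCone hL).inter hc)
  rintro y hy z hz x ⟨hx, hxq⟩ ⟨a, b, ha, hb, hab, rfl⟩
  refine ⟨hy, ?_⟩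
  have hy : ConifoldMirror.jFun h' y + gauge nabla y = L y := hy
  have hz : ConifoldMirror.jFun h' z + gauge nabla z = L z := hz
  have hx : ConifoldMirror.jFun h' (a • y + b • z) + gauge nabla (a • y + b • z) =
    L (a • y + b • z) := hx
  have hxq : q ⬝ᵥ (a • y + b • z) = gauge nabla (a • y + b • z) := hxq
  have h1 := hh.jFun.add_le (a • y) (b • z)
  rw [hh.jFun.smul a y ha.le, hh.jFun.smul b z hb.le] at h1
  simp only [map_add, map_smul, smul_eq_mul] at hx
  simp only [dotProduct_add, dotProduct_smul, smul_eq_mul] at hxq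
  have h2 := hqg y
  have h3 := hqg z
  have : a * (gauge nabla y - q ⬝ᵥ y) ≤ 0 := by
    have e1 : a * L y = a * (ConifoldMirror.jFun h' y) + a * gauge nabla y := by rw [← hy]; ring
    have e2 : b * L z = b * (ConifoldMirror.jFun h' z) + b * gauge nabla z := by rw [← hz]; ring
    nlinarith
  refine le_antisymm h2 ?_
  by_contra hlt
  push Not at hlt
  have := mul_pos ha (sub_pos.2 hlt)
  linarith

/-- The cones of `Σ'_{j'}` are generated by lattice points on the boundary of `∇`. -/
theorem eq_coneOver_of_mem_sigmaPrimeJ (hh : IsSublinear h')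
    (key : ∀ D ∈ sigmaPrime, ∀ x ∈ D, HasLatticeLift h' x) {C : Set (Fin 5 → ℝ)}
    (hC : C ∈ sigmaPrimeJ h') :
    C = coneOver (convexHull ℝ {u ∈ C | u ∈ nabla ∩ lattice 5 ∧ gauge nabla u = 1}) := by
  obtain ⟨⟨hne, K, ⟨hK, L, rfl⟩, hCK⟩, D, hD, hCD⟩ := hC
  have hL := le_of_interior_nonempty hh.jPrime.convexOn hK
  have hKc := hh.jPrime.isConvexCone hL
  apply Set.Subset.antisymm
  · intro x hx
    obtain ⟨ι, _, c, p, hc, rfl, hp⟩ :=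
      (key D hD x (hCD hx)).exists_tight hh hL (hCK.subset hx)
    have hpC := hKc.mem_of_sum_mem hCK hc (fun i hi => (hp i hi).2.1) hx
    classical
    rw [← Finset.sum_filter_of_ne (p := fun i => 0 < c i) fun i _ hi =>
      lt_of_le_of_ne (hc i) fun h => hi (by rw [← h, zero_smul])]
    refine sum_mem_coneOver (convex_convexHull ℝ _) _ c p (fun i _ => hc i) fun i hi => ?_
    have hi := (Finset.mem_filter.1 hi).2
    exact subset_convexHull ℝ _ ⟨hpC i hi, (hp i hi).1, (hp i hi).2.2⟩
  · exact (hKc.of_isExposed hCK hne).coneOver_subset fun u hu => hu.1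

/-- A point of `D` lies in some maximal domain `K` of `j'`, and `K ∩ D` is a face of `K`, hence a
cone of `Σ'_{j'}`. Finiteness, rationality and crepancy come from the generators, which are drawn
from the finitely many lattice points of `∇`; strict convexity holds because `q ⬝ᵥ x` is the
nonnegative gauge on `D`. -/
theorem isPartialCrepantResolution_sigmaPrimeJ (hh : IsSublinear h')
    (key : ∀ D ∈ sigmaPrime, ∀ x ∈ D, HasLatticeLift h' x) :
    IsPartialCrepantResolution nabla (sigmaPrimeJ h') sigmaPrime := by
  have hconv := hh.jPrime.convexOn
  have hcov : ∀ D ∈ sigmaPrime, D = ⋃₀ {C ∈ sigmaPrimeJ h' | C ⊆ D} := by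
    intro D hD
    apply Set.Subset.antisymm
    · intro x hx
      obtain ⟨T, hT, hTx⟩ := hh.isPiecewiseLinear_jPrime.exists_finset
      obtain ⟨L, hL, hxL⟩ := hTx x
      have hexp := isExposed_inter_of_mem_sigmaPrime hh
        (le_of_interior_nonempty hconv (hT L hL)) hD
      have hxm : x ∈ {x | ConifoldMirror.jPrime h' x = L x} ∩ D := ⟨hxL, hx⟩
      exact ⟨_, ⟨⟨⟨⟨x, hxm⟩, _, ⟨hT L hL, L, rfl⟩, hexp⟩, D, hD, Set.inter_subset_right⟩,
        Set.inter_subset_right⟩, hxm⟩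
    · exact Set.sUnion_subset fun C hC => hC.2
  have hgen : ∀ C ∈ sigmaPrimeJ h', ∃ s : Set (Fin 5 → ℝ), s ⊆ nabla ∩ lattice 5 ∧
      (∃ F, IsProperFace nabla F ∧ s ⊆ F) ∧ C = coneOver (convexHull ℝ s) := by
    intro C hC
    obtain ⟨D, hD, hCD⟩ := hC.2
    obtain ⟨f, q, hf, -, -, hDf⟩ := exists_of_mem_sigmaPrime hD
    exact ⟨_, fun u hu => hu.2.1, ⟨f, hf, fun u hu => hDf u (hCD hu.1) hu.2.2⟩,
      eq_coneOver_of_mem_sigmaPrimeJ hh key hC⟩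
  refine ⟨?_, fun C hC => hC.2, hcov, fun C hC => ?_⟩
  · refine isFan_of_subset_linearityFan hh.isPiecewiseLinear_jPrime hconv (fun C hC => hC.1)
      ?_ ?_ ?_ ?_ ?_
    · rintro C ⟨-, D, hD, hCD⟩ F hF hFC
      exact ⟨hF, D, hD, hFC.trans hCD⟩
    · refine (nabla_inter_lattice_finite.finite_subsets.image
        fun s => coneOver (convexHull ℝ s)).subset fun C hC => ?_
      obtain ⟨s, hs, -, rfl⟩ := hgen C hC
      exact ⟨s, hs, rfl⟩
    · have h0 : (0 : Fin 5 → ℝ) ∈ ({0} : Set (Fin 5 → ℝ)) := rfl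
      rw [hcov _ zero_mem_sigmaPrime] at h0
      obtain ⟨C, hC, -⟩ := h0
      exact ⟨C, hC.1⟩
    · intro C hC
      obtain ⟨s, hs, -, hCs⟩ := hgen C hC
      exact ⟨s, nabla_inter_lattice_finite.subset hs, fun u hu => (hs hu).2, hCs⟩
    · rintro C ⟨-, D, hD, hCD⟩ x hx hx'
      obtain ⟨f, q, -, -, rfl, -⟩ := exists_of_mem_sigmaPrime hD
      have h1 : q ⬝ᵥ x = gauge nabla x := hCD hx
      have h2 : q ⬝ᵥ (-x) = gauge nabla (-x) := hCD hx'
      rw [dotProduct_neg] at h2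
      apply eq_zero_of_gauge_nabla_nonpos
      linarith [gauge_nonneg (s := nabla) (-x)]
  · obtain ⟨s, hs, hF, hCs⟩ := hgen C hC
    exact ⟨s, nabla_inter_lattice_finite.subset hs, fun u hu => (hs hu).2, hF, hCs⟩

theorem exists_image_subset_of_mem_sigmaPrimeJ (hpl : IsPiecewiseLinear h')
    (hconv : ConvexOn ℝ Set.univ h')
    (key : ∀ D ∈ sigmaPrime, ∀ x ∈ D, HasLatticeLift h' x) {C : Set (Fin 5 → ℝ)}
    (hC : C ∈ sigmaPrimeJ h') : ∃ D ∈ linearityFan h', gStar '' C ⊆ D := by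
  have hh := hpl.isSublinear hconv
  have hCgen := eq_coneOver_of_mem_sigmaPrimeJ hh key hC
  obtain ⟨⟨hne, K, ⟨hK, L, rfl⟩, hCK⟩, D, hD, hCD⟩ := hC
  have hL := le_of_interior_nonempty hh.jPrime.convexOn hK
  have hCc := (hh.jPrime.isConvexCone hL).of_isExposed hCK hne
  set s := {u ∈ C | u ∈ nabla ∩ lattice 5 ∧ gauge nabla u = 1} with hs
  have hsfin : s.Finite := nabla_inter_lattice_finite.subset fun u hu => hu.2.1
  have hsC : ∀ u ∈ hsfin.toFinset, u ∈ C := fun u hu => (hsfin.mem_toFinset.1 hu).1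
  have hx₀ : ∑ u ∈ hsfin.toFinset, u ∈ C := hCc.sum_mem _ (fun u => u) hsC
  have hjx : ∀ x ∈ C, h' (gStar x) = L x - gauge nabla x := fun x hx => by
    rw [← (key D hD x (hCD hx)).jFun_eq hh]
    have : ConifoldMirror.jFun h' x + gauge nabla x = L x := hCK.subset hx
    linarith
  obtain ⟨T, hT, hTx⟩ := hpl.exists_finset
  -- `L'` is a linear piece of `h'` at the image of the sum of all generators. Since `h' ∘ g* = L -
  -- gauge` on `C`, subadditivity of the gauge makes the total of the nonnegative defects `h' - L'`
  -- at the images of the generators nonpositive.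
  obtain ⟨L', hL', hxL'⟩ := hTx (gStar (∑ u ∈ hsfin.toFinset, u))
  have hle := le_of_interior_nonempty hconv (hT L' hL')
  have hKc := hh.isConvexCone hle
  refine ⟨{y | h' y = L' y}, ⟨⟨_, hxL'⟩, _, ⟨hT L' hL', L', rfl⟩, IsExposed.refl _⟩, ?_⟩
  have hsub : gauge nabla (∑ u ∈ hsfin.toFinset, u) ≤ ∑ u ∈ hsfin.toFinset, gauge nabla u := by
    simpa using isSublinear_gauge_nabla.sum_le hsfin.toFinset (fun _ => 1) (fun u => u)
      fun _ _ => zero_le_one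
  have hsum : ∑ u ∈ hsfin.toFinset, (h' (gStar u) - L' (gStar u)) ≤ 0 := by
    rw [hjx _ hx₀, map_sum, map_sum, map_sum] at hxL'
    rw [Finset.sum_sub_distrib, Finset.sum_congr rfl fun u hu => hjx u (hsC u hu),
      Finset.sum_sub_distrib]
    linarith
  have hnn : ∀ u ∈ hsfin.toFinset, 0 ≤ h' (gStar u) - L' (gStar u) := fun u _ =>
    sub_nonneg.2 (hle _)
  have heq := (Finset.sum_eq_zero_iff_of_nonneg hnn).1
    (le_antisymm hsum (Finset.sum_nonneg hnn))
  have hpre : IsConvexCone {x | h' (gStar x) = L' (gStar x)} :=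
    ⟨by simpa using hKc.zero_mem, fun x hx y hy => by
      have := hKc.add_mem _ hx _ hy
      simpa using this, fun t ht x hx => by
      have := hKc.smul_mem t ht _ hx
      simpa using this⟩
  rintro _ ⟨x, hx, rfl⟩
  rw [hCgen] at hx
  exact hpre.coneOver_subset (fun u hu => sub_eq_zero.1 (heq u (hsfin.mem_toFinset.2 hu))) hx

end JFun

/-! ### The polytope `Δ*_{P(2,4)}` and the function `h_ε` -/

theorem mem_deltaStarP24 {m : Fin 4 → ℝ} : m ∈ deltaStarP24 ↔
    -1 ≤ m 0 ∧ -1 ≤ m 1 ∧ -1 ≤ m 2 ∧ -1 ≤ m 3 ∧ m 0 + m 1 + m 2 ≤ 1 ∧ -1 ≤ m 0 + m 1 - m 3 := by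
  constructor
  · intro h
    have hs : ∀ p ∈ ({![1, 0, 0, 0], ![0, 1, 0, 0], ![0, 0, 1, 0], ![0, 0, 0, 1],
        ![-1, -1, -1, 0], ![1, 1, 0, -1]} : Set (Fin 4 → ℝ)), -1 ≤ p ⬝ᵥ m := fun p hp =>
      h p (subset_convexHull ℝ _ hp)
    simp [dotProduct, Fin.sum_univ_succ] at hs
    obtain ⟨h1, h2, h3, h4, h5, h6⟩ := hs
    exact ⟨h1, h2, h3, h4, by linarith, by linarith⟩
  · rintro ⟨h1, h2, h3, h4, h5, h6⟩ p hp
    have hc : Convex ℝ {p : Fin 4 → ℝ | -1 ≤ p ⬝ᵥ m} := by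
      intro x hx y hy a b ha hb hab
      have hx : -1 ≤ x ⬝ᵥ m := hx
      have hy : -1 ≤ y ⬝ᵥ m := hy
      simp only [Set.mem_ofPred_eq, add_dotProduct, smul_dotProduct, smul_eq_mul]
      nlinarith
    refine convexHull_min (t := {p : Fin 4 → ℝ | -1 ≤ p ⬝ᵥ m}) ?_ hc hp
    simp only [Set.insert_subset_iff, Set.singleton_subset_iff, Set.mem_ofPred_eq]
    simp [dotProduct, Fin.sum_univ_succ]
    refine ⟨h1, h2, h3, h4, by linarith, by linarith⟩

theorem single_mem_deltaStarP24 (i : Fin 4) : (Pi.single i 1 : Fin 4 → ℝ) ∈ deltaStarP24 := by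
  rw [mem_deltaStarP24]
  fin_cases i <;> simp [Fin.ext_iff]

theorem neg_single_mem_deltaStarP24 (i : Fin 4) :
    (-Pi.single i 1 : Fin 4 → ℝ) ∈ deltaStarP24 := by
  rw [mem_deltaStarP24]
  fin_cases i <;> simp [Fin.ext_iff]

/-- The points `v₁, …, v₆, t₁, …, t₄, c`. -/
noncomputable def hPoint : Fin 11 → Fin 4 → ℝ :=
  ![![-1, -1, -1, -1], ![3, -1, -1, -1], ![-1, 3, -1, -1], ![-1, -1, 3, -1],
    ![3, -1, -1, 3], ![-1, 3, -1, 3],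
    ![1, -1, 0, -1], ![-1, 1, 0, 1], ![-1, -1, 2, -1], ![-1, -1, 0, -1], ![1, 1, -1, 1]]

/-- The heights of the points `v₁, …, v₆, t₁, …, t₄, c`. -/
noncomputable def hHeight (ε : ℝ) : Fin 11 → ℝ :=
  ![1, 1, 1, 1, 1, 1, 1 - ε, 1 - ε, 1 - ε, 1 - ε, 1 - ε]

theorem hPoint_mem (p : Fin 11) : hPoint p ∈ deltaStarP24 := by
  rw [mem_deltaStarP24]
  fin_cases p <;> simp [hPoint] <;> norm_num

/-- The points with heights over which the lower boundary is `h_ε`. -/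
def hSet (ε : ℝ) : Set ((Fin 4 → ℝ) × ℝ) :=
  {p | p.1 ∈ vertexPoints ∧ 1 ≤ p.2} ∪ {p | p.1 ∈ loweredPoints ∧ 1 - ε ≤ p.2} ∪
    {p | p.1 = 0 ∧ 0 ≤ p.2}

theorem hPoint_mem_hSet (ε : ℝ) (p : Fin 11) : (hPoint p, hHeight ε p) ∈ hSet ε := by
  fin_cases p <;> simp [hSet, hPoint, hHeight, vertexPoints, loweredPoints]

theorem exists_mem_coneOver_hSet (ε : ℝ) (y : Fin 4 → ℝ) :
    ∃ r, (y, r) ∈ coneOver (convexHull ℝ (hSet ε)) := by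
  have hb : ∀ i, -|y i| ≤ y i ∧ y i ≤ |y i| := fun i => ⟨neg_abs_le _, le_abs_self _⟩
  set R := |y 0| + |y 1| + |y 2| + |y 3| with hR
  -- The relation `2v₁ + v₂ + v₃ + 2v₄ + v₅ + v₆ = 0`, taken `R` times, makes the coefficients of a
  -- signed expression for `y` nonnegative.
  let a : Fin 11 → ℝ := ![-(y 0 + y 1 + y 2) / 4 + 2 * R, (y 0 - y 3) / 4 + R, y 1 / 4 + R,
    y 2 / 4 + 2 * R, y 3 / 4 + R, R, 0, 0, 0, 0, 0]
  have := sum_mem_coneOver (convex_convexHull ℝ (hSet ε)) Finset.univ a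
    (fun i => (hPoint i, hHeight ε i))
    (fun i _ => by
      have h0 := hb 0
      have h1 := hb 1
      have h2 := hb 2
      have h3 := hb 3
      fin_cases i <;> simp [a] <;> linarith)
    (fun i _ => subset_convexHull ℝ _ (hPoint_mem_hSet ε i))
  refine ⟨∑ i, a i • hHeight ε i, ?_⟩
  convert this using 1
  rw [Prod.ext_iff, Prod.fst_sum, Prod.snd_sum]
  refine ⟨?_, rfl⟩
  ext j
  fin_cases j <;> simp [a, hPoint, Fin.sum_univ_succ] <;> ring

theorem le_of_mem_hSet {ε : ℝ} {M : Fin 4 → ℝ} (hM : ∀ p, M ⬝ᵥ hPoint p ≤ hHeight ε p)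
    {p : (Fin 4 → ℝ) × ℝ} (hp : p ∈ hSet ε) : M ⬝ᵥ p.1 ≤ p.2 := by
  obtain ⟨x, r⟩ := p
  rcases hp with (⟨hx, hr⟩ | ⟨hx, hr⟩) | ⟨hx, hr⟩
  · simp only [vertexPoints, Set.mem_insert_iff, Set.mem_singleton_iff] at hx
    refine le_trans ?_ hr
    rcases hx with rfl | rfl | rfl | rfl | rfl | rfl
    exacts [hM 0, hM 1, hM 2, hM 3, hM 4, hM 5]
  · simp only [loweredPoints, Set.mem_insert_iff, Set.mem_singleton_iff] at hx
    refine le_trans ?_ hr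
    rcases hx with rfl | rfl | rfl | rfl | rfl
    exacts [hM 6, hM 7, hM 8, hM 9, hM 10]
  · have hx : x = 0 := hx
    subst hx
    simpa using hr

theorem le_hFun {ε : ℝ} {M : Fin 4 → ℝ} (hM : ∀ p, M ⬝ᵥ hPoint p ≤ hHeight ε p)
    (y : Fin 4 → ℝ) : M ⬝ᵥ y ≤ hFun ε y :=
  (dotProduct_isSublinear M).le_lowerFunction (fun _ hp => le_of_mem_hSet hM hp)
    (exists_mem_coneOver_hSet ε y)

/-- The bound `ε ≤ 1` makes all heights nonnegative, so the zero function is a minorant and the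
infimum is a genuine one. -/
theorem hFun_le {ε : ℝ} (hε : ε ≤ 1) {a : Fin 11 → ℝ} (ha : ∀ p, 0 ≤ a p) :
    hFun ε (∑ p, a p • hPoint p) ≤ ∑ p, a p * hHeight ε p := by
  refine (dotProduct_isSublinear (0 : Fin 4 → ℝ)).lowerFunction_le (S := hSet ε)
    (fun _ hp => le_of_mem_hSet ?_ hp) ?_
  · intro p
    fin_cases p <;> simp [hHeight, hε]
  · have := sum_mem_coneOver (convex_convexHull ℝ (hSet ε)) Finset.univ a
      (fun i => (hPoint i, hHeight ε i)) (fun i _ => ha i)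
      (fun i _ => subset_convexHull ℝ _ (hPoint_mem_hSet ε i))
    convert this using 1
    rw [Prod.ext_iff, Prod.fst_sum, Prod.snd_sum]
    exact ⟨rfl, rfl⟩

/-! ### Decompositions into lattice points -/

/-- A decomposition of `y` as a positive combination of lattice points in a common proper face of
`Δ*_{P(2,4)}`, with respect to which `h'` and `h_ε` are additive. -/
structure IsDecomposition (ε : ℝ) (h' : (Fin 4 → ℝ) → ℝ) (y : Fin 4 → ℝ) {ι : Type} [Fintype ι]
    (c : ι → ℝ) (m : ι → Fin 4 → ℝ) : Prop where
  pos : ∀ i, 0 < c i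
  mem : ∀ i, m i ∈ deltaStarP24 ∩ lattice 4
  eq_sum : y = ∑ i, c i • m i
  map_eq : h' y = ∑ i, c i * h' (m i)
  hFun_eq : hFun ε y = ∑ i, c i * hFun ε (m i)
  face : ∃ q : Fin 4 → ℝ, (∀ u ∈ deltaStarP24, q ⬝ᵥ u ≤ 1) ∧ ∀ i, q ⬝ᵥ m i = 1

/-- A maximal domain of `h'` through `y` is crepant, so it is generated by lattice points of one
proper face; it lies in a cone of `Σ_{h_ε}`, so `h_ε` is linear on it as well. -/
theorem exists_isDecomposition {ε : ℝ} {h' : (Fin 4 → ℝ) → ℝ}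
    (hMPCP : IsMPCPFunction deltaStarP24 h')
    (href : Refines (linearityFan h') (linearityFan (hFun ε))) (y : Fin 4 → ℝ) :
    ∃ (ι : Type) (_ : Fintype ι) (c : ι → ℝ) (m : ι → Fin 4 → ℝ),
      IsDecomposition ε h' y c m := by
  obtain ⟨T, hT, hTy⟩ := hMPCP.piecewiseLinear.exists_finset
  obtain ⟨L, hL, hy⟩ := hTy y
  have hmem : {z | h' z = L z} ∈ linearityFan h' :=
    ⟨⟨y, hy⟩, _, ⟨hT L hL, L, rfl⟩, IsExposed.refl _⟩
  obtain ⟨s, -, hs, ⟨F, hF, hsF⟩, hK⟩ := hMPCP.crepant _ hmem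
  obtain ⟨D, ⟨-, K', ⟨-, L', rfl⟩, hD⟩, hKD⟩ := href _ hmem
  have hy' : y ∈ coneOver (convexHull ℝ s) := hK ▸ hy
  obtain ⟨ι, _, c, m, hc, hm, rfl⟩ := exists_sum_of_mem_coneOver hy'
  have hmK : ∀ i, m i ∈ {z | h' z = L z} := fun i => by
    rw [hK]
    exact subset_coneOver _ (subset_convexHull ℝ _ (hm i))
  have hLm : ∀ i, h' (m i) = L (m i) := hmK
  have hLm' : ∀ z, h' z = L z → hFun ε z = L' z := fun z hz => hD.subset (hKD hz)
  refine ⟨ι, inferInstance, c, m, hc, fun i => ⟨hF.1.subset (hsF (hm i)), hs (hm i)⟩, rfl,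
    ?_, ?_, ?_⟩
  · have hy : h' (∑ i, c i • m i) = L (∑ i, c i • m i) := hy
    rw [hy, map_sum]
    exact Finset.sum_congr rfl fun i _ => by rw [map_smul, smul_eq_mul, hLm]
  · rw [hLm' _ hy, map_sum]
    exact Finset.sum_congr rfl fun i _ => by rw [map_smul, smul_eq_mul, hLm' _ (hLm i)]
  · rcases F.eq_empty_or_nonempty with rfl | hne
    · exact ⟨0, fun u _ => by simp, fun i => absurd (hsF (hm i)) (Set.notMem_empty _)⟩
    · obtain ⟨q, hq, hFq⟩ :=
        exists_of_isProperFace single_mem_deltaStarP24 neg_single_mem_deltaStarP24 hF hne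
      refine ⟨q, hq, fun i => ?_⟩
      have := hsF (hm i)
      rw [hFq] at this
      exact this.2

namespace IsDecomposition

variable {ε : ℝ} {h' : (Fin 4 → ℝ) → ℝ} {y : Fin 4 → ℝ} {ι : Type} [Fintype ι] {c : ι → ℝ}
  {m : ι → Fin 4 → ℝ}

theorem dotProduct_eq (d : IsDecomposition ε h' y c m) (q : Fin 4 → ℝ) :
    q ⬝ᵥ y = ∑ i, c i * (q ⬝ᵥ m i) := by
  rw [d.eq_sum, dotProduct_sum]
  exact Finset.sum_congr rfl fun i _ => by rw [dotProduct_smul, smul_eq_mul]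

/-- Points of a common face give an expression of least weight: `q` equals `1` on them and is at
most `1` on `Δ*`. -/
theorem sum_le (d : IsDecomposition ε h' y c m) {κ : Type*} [Fintype κ] {a : κ → ℝ}
    {p : κ → Fin 4 → ℝ} (ha : ∀ k, 0 ≤ a k) (hp : ∀ k, p k ∈ deltaStarP24)
    (hy : y = ∑ k, a k • p k) : ∑ i, c i ≤ ∑ k, a k := by
  obtain ⟨q, hq, hqm⟩ := d.face
  have h1 := d.dotProduct_eq q
  simp only [hqm, mul_one] at h1
  rw [← h1, hy, dotProduct_sum]
  refine Finset.sum_le_sum fun k _ => ?_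
  rw [dotProduct_smul, smul_eq_mul]
  exact mul_le_of_le_one_right (ha k) (hq _ (hp k))

/-- If `y` lies in the cone over the face of `Δ*_{P(2,4)}` on which `u = -1`, then so do the
lattice points in a decomposition of `y`. -/
theorem face_eq (d : IsDecomposition ε h' y c m) {a : Fin 11 → ℝ} (ha : ∀ p, 0 ≤ a p)
    (hy : y = ∑ p, a p • hPoint p) {u : Fin 4 → ℝ} (hu : ∀ z ∈ deltaStarP24, -1 ≤ u ⬝ᵥ z)
    (huy : u ⬝ᵥ y = -∑ p, a p) (i : ι) : u ⬝ᵥ m i = -1 := by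
  have h1 := d.sum_le ha hPoint_mem hy
  have h2 := d.dotProduct_eq u
  have hnn : ∀ i ∈ Finset.univ, 0 ≤ c i * (1 + u ⬝ᵥ m i) := fun i _ =>
    mul_nonneg (d.pos i).le (by linarith [hu _ (d.mem i).1])
  have hs : ∑ i, c i * (1 + u ⬝ᵥ m i) ≤ 0 := by
    simp only [mul_add, mul_one, Finset.sum_add_distrib]
    linarith
  have := (Finset.sum_eq_zero_iff_of_nonneg hnn).1 (le_antisymm hs (Finset.sum_nonneg hnn)) i
    (Finset.mem_univ i)
  have := (mul_eq_zero.1 this).resolve_left (d.pos i).ne'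
  linarith

/-- If `M` is a linear function below `h_ε` that agrees with `h_ε` at `y`, and `M + N` is below
`h_ε`, then `N` is nonpositive at the lattice points in a decomposition of `y`. -/
theorem separate (d : IsDecomposition ε h' y c m) (hε : ε ≤ 1) {a : Fin 11 → ℝ}
    (ha : ∀ p, 0 ≤ a p) (hy : y = ∑ p, a p • hPoint p) {M N : Fin 4 → ℝ}
    (hM : ∀ p, M ⬝ᵥ hPoint p ≤ hHeight ε p) (hN : ∀ p, (M + N) ⬝ᵥ hPoint p ≤ hHeight ε p)
    (hMy : ∑ p, a p * hHeight ε p ≤ M ⬝ᵥ y) (i : ι) : N ⬝ᵥ m i ≤ 0 := by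
  have h1 := hFun_le hε ha
  rw [← hy, d.hFun_eq] at h1
  -- Since `h_ε` is additive along the decomposition and `M ≤ h_ε` is an equality at `y`, it is an
  -- equality at every `m i`; there `M + N ≤ h_ε = M`.
  have hnn : ∀ i ∈ Finset.univ, 0 ≤ c i * (hFun ε (m i) - M ⬝ᵥ m i) := fun i _ =>
    mul_nonneg (d.pos i).le (sub_nonneg.2 (le_hFun hM _))
  have hs : ∑ i, c i * (hFun ε (m i) - M ⬝ᵥ m i) ≤ 0 := by
    simp only [mul_sub, Finset.sum_sub_distrib]
    rw [← d.dotProduct_eq]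
    linarith
  have := (Finset.sum_eq_zero_iff_of_nonneg hnn).1 (le_antisymm hs (Finset.sum_nonneg hnn)) i
    (Finset.mem_univ i)
  have := (mul_eq_zero.1 this).resolve_left (d.pos i).ne'
  have h2 := le_hFun hN (m i)
  rw [add_dotProduct] at h2
  linarith

end IsDecomposition

/-! ### Lifting lattice points along `g*` -/

theorem gStar_apply (x : Fin 5 → ℝ) : gStar x =
    ![-x 1 - x 2 - x 3 - x 4, x 1 + x 4, x 2, -x 0 - x 2 - x 3 - x 4] := by
  ext i
  simp only [gStar, gMatrix, Matrix.mulVecLin_apply, Matrix.mulVec, dotProduct,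
    Fin.sum_univ_five, Matrix.transpose_apply]
  fin_cases i <;> simp <;> ring

/-- The point of the fibre of `g*` over `m` with last coordinate `r`. -/
noncomputable def fibrePoint (m : Fin 4 → ℝ) (r : ℝ) : Fin 5 → ℝ :=
  ![m 0 + m 1 - m 3 - r, m 1 - r, m 2, -m 0 - m 1 - m 2, r]

theorem gStar_fibrePoint (m : Fin 4 → ℝ) (r : ℝ) : gStar (fibrePoint m r) = m := by
  rw [gStar_apply]
  ext i
  fin_cases i <;> simp [fibrePoint]
  ring

theorem eq_of_gStar_eq {x x' : Fin 5 → ℝ} (h : gStar x = gStar x') (h4 : x 4 = x' 4) : x = x' := by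
  rw [gStar_apply, gStar_apply] at h
  have h0 := congrFun h 0
  have h1 := congrFun h 1
  have h2 := congrFun h 2
  have h3 := congrFun h 3
  simp at h0 h1 h2 h3
  ext i
  fin_cases i <;> simp <;> linarith

/-- One more than the smallest last coordinate of a point of `∇` over `m`. -/
noncomputable def fibreLower (m : Fin 4 → ℝ) : ℝ :=
  max 0 (m 1 - m 3) + max 0 (max (-m 2) (m 0 + m 1 + m 2))

/-- One minus the largest last coordinate of a point of `∇` over `m`. -/
noncomputable def fibreUpper (m : Fin 4 → ℝ) : ℝ :=
  max (-m 1) (m 3 - m 0 - m 1)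

/-- Integrality places the point in one of the two Newton polytopes, not only in their hull. If `0 ≤
r` and `z 1 - z 3 ≤ r`, it lies in `Newt(φ₁)`. Otherwise `r = -1` or `z 1 - z 3 ≥ r + 1`; then `hl`
forces the second maximum to be zero, and the point lies in `Newt(φ₂)`. -/
theorem fibrePoint_mem_of_int {z : Fin 4 → ℤ} {r : ℤ}
    (hz : -1 ≤ z 0 ∧ -1 ≤ z 1 ∧ -1 ≤ z 2 ∧ -1 ≤ z 3 ∧ z 0 + z 1 + z 2 ≤ 1 ∧
      -1 ≤ z 0 + z 1 - z 3)
    (hl : max 0 (z 1 - z 3) + max 0 (max (-z 2) (z 0 + z 1 + z 2)) ≤ r + 1)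
    (hu : max (-z 1) (z 3 - z 0 - z 1) ≤ 1 - r) :
    fibrePoint (fun i => (z i : ℝ)) r ∈ nabla ∩ lattice 5 := by
  refine ⟨subset_convexHull ℝ _ ?_, ![z 0 + z 1 - z 3 - r, z 1 - r, z 2, -z 0 - z 1 - z 2, r], ?_⟩
  · have h : (-1 ≤ z 0 + z 1 - z 3 - r ∧ -1 ≤ z 1 - r ∧ -1 ≤ z 2 ∧ -1 ≤ -z 0 - z 1 - z 2 ∧
        0 ≤ r ∧ (z 0 + z 1 - z 3 - r) + (z 1 - r) + z 2 + (-z 0 - z 1 - z 2) + r ≤ 0) ∨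
      (0 ≤ z 0 + z 1 - z 3 - r ∧ 0 ≤ z 1 - r ∧ 0 ≤ z 2 ∧ 0 ≤ -z 0 - z 1 - z 2 ∧
        -1 ≤ r ∧ (z 0 + z 1 - z 3 - r) + (z 1 - r) + z 2 + (-z 0 - z 1 - z 2) + r ≤ 1) := by
      omega
    rw [Set.mem_union, mem_newt_phi1, mem_newt_phi2]
    simp only [fibrePoint, Matrix.cons_val]
    exact_mod_cast h
  · ext i
    fin_cases i <;> simp [fibrePoint]

theorem fibrePoint_mem {m : Fin 4 → ℝ} (hm : m ∈ deltaStarP24 ∩ lattice 4) :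
    fibrePoint m (fibreLower m - 1) ∈ nabla ∩ lattice 5 ∧
      fibrePoint m (1 - fibreUpper m) ∈ nabla ∩ lattice 5 := by
  obtain ⟨hm, z, rfl⟩ := hm
  rw [mem_deltaStarP24] at hm
  beta_reduce at hm
  have hz : -1 ≤ z 0 ∧ -1 ≤ z 1 ∧ -1 ≤ z 2 ∧ -1 ≤ z 3 ∧ z 0 + z 1 + z 2 ≤ 1 ∧
      -1 ≤ z 0 + z 1 - z 3 := by exact_mod_cast hm
  constructor
  · have := fibrePoint_mem_of_int (z := z)
      (r := max 0 (z 1 - z 3) + max 0 (max (-z 2) (z 0 + z 1 + z 2)) - 1) hz (by omega) (by omega)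
    simpa [fibreLower] using this
  · have := fibrePoint_mem_of_int (z := z)
      (r := 1 - max (-z 1) (z 3 - z 0 - z 1)) hz (by omega) (by omega)
    simpa [fibreUpper] using this

/-- Lifting every `m i` to the lower end, or every one to the upper end, gives two points over
`g*(x)` that differ only along the kernel of `g*`. The hypotheses place `x` between them, and mixing
them changes neither the weight nor the value of `h' ∘ g*`. -/
theorem hasLatticeLift_of_sum_eq {h' : (Fin 4 → ℝ) → ℝ} {x : Fin 5 → ℝ} {ι : Type} [Fintype ι]
    {c : ι → ℝ} {m : ι → Fin 4 → ℝ} (hc : ∀ i, 0 ≤ c i)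
    (hm : ∀ i, m i ∈ deltaStarP24 ∩ lattice 4) (hx : gStar x = ∑ i, c i • m i)
    (hh : h' (gStar x) = ∑ i, c i * h' (m i)) (hg : ∑ i, c i ≤ gauge nabla x)
    (hl : ∑ i, c i * fibreLower (m i) ≤ x 4 + ∑ i, c i)
    (hu : ∑ i, c i * fibreUpper (m i) ≤ ∑ i, c i - x 4) : HasLatticeLift h' x := by
  have e1 : ∑ i, c i * (fibreLower (m i) - 1) = ∑ i, c i * fibreLower (m i) - ∑ i, c i := by
    simp only [mul_sub, mul_one, Finset.sum_sub_distrib]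
  have e2 : ∑ i, c i * (1 - fibreUpper (m i)) = ∑ i, c i - ∑ i, c i * fibreUpper (m i) := by
    simp only [mul_sub, mul_one, Finset.sum_sub_distrib]
  have hseg : x 4 ∈ segment ℝ (∑ i, c i * (fibreLower (m i) - 1))
      (∑ i, c i * (1 - fibreUpper (m i))) := by
    rw [segment_eq_Icc (by linarith)]
    exact ⟨by linarith, by linarith⟩
  obtain ⟨s, t, hs, ht, hst, hx4⟩ := hseg
  have hsum : ∀ F : (Fin 4 → ℝ) → ℝ, ∑ k : ι ⊕ ι,
      (Sum.elim (fun i => s * c i) (fun i => t * c i) k) * F (Sum.elim m m k) =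
      ∑ i, c i * F (m i) := fun F => by
    rw [Fintype.sum_sum_type, ← Finset.sum_add_distrib]
    refine Finset.sum_congr rfl fun i _ => ?_
    simp only [Sum.elim_inl, Sum.elim_inr]
    rw [← add_mul, ← add_mul, hst, one_mul]
  have hgp : ∀ k : ι ⊕ ι, gStar (Sum.elim (fun i => fibrePoint (m i) (fibreLower (m i) - 1))
      (fun i => fibrePoint (m i) (1 - fibreUpper (m i))) k) = Sum.elim m m k := by
    rintro (i | i) <;> exact gStar_fibrePoint _ _
  refine ⟨ι ⊕ ι, inferInstance, Sum.elim (fun i => s * c i) (fun i => t * c i),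
    Sum.elim (fun i => fibrePoint (m i) (fibreLower (m i) - 1))
      (fun i => fibrePoint (m i) (1 - fibreUpper (m i))), ?_, ?_, ?_, ?_, ?_⟩
  · rintro (i | i)
    exacts [mul_nonneg hs (hc i), mul_nonneg ht (hc i)]
  · rintro (i | i)
    exacts [(fibrePoint_mem (hm i)).1, (fibrePoint_mem (hm i)).2]
  · apply eq_of_gStar_eq
    · rw [map_sum, hx]
      ext j
      simp only [map_smul, hgp, Finset.sum_apply, Pi.smul_apply, smul_eq_mul]
      exact (hsum fun v => v j).symm
    · rw [← hx4, Fintype.sum_sum_type]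
      simp [Finset.sum_apply, fibrePoint, Finset.mul_sum, mul_assoc]
  · refine le_of_eq_of_le ?_ hg
    simpa using hsum fun _ => 1
  · rw [hh]
    simp only [hgp]
    exact (hsum h').symm

theorem zero_mem_deltaStarP24_inter_lattice :
    (0 : Fin 4 → ℝ) ∈ deltaStarP24 ∩ lattice 4 :=
  ⟨by rw [mem_deltaStarP24]; norm_num, 0, by ext; simp⟩

/-- The weight missing from `Φ` is put on the origin of `Δ*`. There `fibreLower`, `fibreUpper` and
`h'` all vanish, and the fibre has the lattice ends `±(1, 1, 0, 0, -1)`. -/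
theorem IsDecomposition.hasLatticeLift {ε : ℝ} {h' : (Fin 4 → ℝ) → ℝ} (hh : IsSublinear h')
    {x : Fin 5 → ℝ} {ι : Type} [Fintype ι] {c : ι → ℝ} {m : ι → Fin 4 → ℝ}
    (d : IsDecomposition ε h' (gStar x) c m) {Φ : ℝ} (hΦ : Φ ≤ gauge nabla x)
    (hc : ∑ i, c i ≤ Φ) (hl : ∑ i, c i * fibreLower (m i) ≤ x 4 + Φ)
    (hu : ∑ i, c i * fibreUpper (m i) ≤ Φ - x 4) : HasLatticeLift h' x := by
  have hsum : ∑ o : Option ι, o.elim (Φ - ∑ i, c i) c = Φ := by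
    rw [Fintype.sum_option]
    simp
  refine hasLatticeLift_of_sum_eq (ι := Option ι) (c := fun o => o.elim (Φ - ∑ i, c i) c)
    (m := fun o => o.elim 0 m) ?_ ?_ ?_ ?_ ?_ ?_ ?_
  · rintro (_ | i)
    exacts [sub_nonneg.2 hc, (d.pos i).le]
  · rintro (_ | i)
    exacts [zero_mem_deltaStarP24_inter_lattice, d.mem i]
  · rw [Fintype.sum_option, d.eq_sum]
    simp
  · rw [Fintype.sum_option, d.map_eq]
    simp [hh.map_zero]
  · rwa [hsum]
  · rw [hsum, Fintype.sum_option]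
    simpa [fibreLower] using hl
  · rw [hsum, Fintype.sum_option]
    simpa [fibreUpper] using hu

/-! ### Coordinates, and the walls of `h_ε` respected by decompositions -/

theorem sum_smul_hPoint (a : Fin 11 → ℝ) : ∑ p, a p • hPoint p =
    ![-a 0 + 3 * a 1 - a 2 - a 3 + 3 * a 4 - a 5 + a 6 - a 7 - a 8 - a 9 + a 10,
      -a 0 - a 1 + 3 * a 2 - a 3 - a 4 + 3 * a 5 - a 6 + a 7 - a 8 - a 9 + a 10,
      -a 0 - a 1 - a 2 + 3 * a 3 - a 4 - a 5 + 2 * a 8 - a 10,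
      -a 0 - a 1 - a 2 - a 3 + 3 * a 4 + 3 * a 5 - a 6 + a 7 - a 8 - a 9 + a 10] := by
  ext j
  fin_cases j <;> simp [hPoint, Fin.sum_univ_succ] <;> ring

theorem sum_mul_hHeight (ε : ℝ) (a : Fin 11 → ℝ) : ∑ p, a p * hHeight ε p =
    a 0 + a 1 + a 2 + a 3 + a 4 + a 5 + (1 - ε) * (a 6 + a 7 + a 8 + a 9 + a 10) := by
  simp [hHeight, Fin.sum_univ_succ]
  ring

theorem forall_dotProduct_hPoint_le {ε M₀ M₁ M₂ M₃ : ℝ} :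
    (∀ p, ![M₀, M₁, M₂, M₃] ⬝ᵥ hPoint p ≤ hHeight ε p) ↔
      -M₀ - M₁ - M₂ - M₃ ≤ 1 ∧ 3 * M₀ - M₁ - M₂ - M₃ ≤ 1 ∧ -M₀ + 3 * M₁ - M₂ - M₃ ≤ 1 ∧
      -M₀ - M₁ + 3 * M₂ - M₃ ≤ 1 ∧ 3 * M₀ - M₁ - M₂ + 3 * M₃ ≤ 1 ∧
      -M₀ + 3 * M₁ - M₂ + 3 * M₃ ≤ 1 ∧ M₀ - M₁ - M₃ ≤ 1 - ε ∧ -M₀ + M₁ + M₃ ≤ 1 - ε ∧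
      -M₀ - M₁ + 2 * M₂ - M₃ ≤ 1 - ε ∧ -M₀ - M₁ - M₃ ≤ 1 - ε ∧
      M₀ + M₁ - M₂ + M₃ ≤ 1 - ε := by
  constructor
  · intro h
    have h0 := h 0
    have h1 := h 1
    have h2 := h 2
    have h3 := h 3
    have h4 := h 4
    have h5 := h 5
    have h6 := h 6
    have h7 := h 7
    have h8 := h 8
    have h9 := h 9
    have h10 := h 10
    simp only [hPoint, hHeight, dotProduct, Fin.sum_univ_four, Matrix.cons_val] at *
    refine ⟨?_, ?_, ?_, ?_, ?_, ?_, ?_, ?_, ?_, ?_, ?_⟩ <;> linarith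
  · rintro ⟨h0, h1, h2, h3, h4, h5, h6, h7, h8, h9, h10⟩ p
    fin_cases p <;> simp [hPoint, hHeight, dotProduct, Fin.sum_univ_four] <;> linarith

namespace IsDecomposition

variable {ε : ℝ} {h' : (Fin 4 → ℝ) → ℝ} {y : Fin 4 → ℝ} {ι : Type} [Fintype ι] {c : ι → ℝ}
  {m : ι → Fin 4 → ℝ}

/-- `separate`, in coordinates. -/
theorem separate_coord (d : IsDecomposition ε h' y c m) (hε : ε ≤ 1) {a : Fin 11 → ℝ}
    (ha : ∀ p, 0 ≤ a p) (hy : y = ∑ p, a p • hPoint p) (M₀ M₁ M₂ M₃ N₀ N₁ N₂ N₃ : ℝ)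
    (hM : ∀ p, ![M₀, M₁, M₂, M₃] ⬝ᵥ hPoint p ≤ hHeight ε p)
    (hN : ∀ p, ![M₀ + N₀, M₁ + N₁, M₂ + N₂, M₃ + N₃] ⬝ᵥ hPoint p ≤ hHeight ε p)
    (hMy : a 0 + a 1 + a 2 + a 3 + a 4 + a 5 + (1 - ε) * (a 6 + a 7 + a 8 + a 9 + a 10) ≤
      M₀ * y 0 + M₁ * y 1 + M₂ * y 2 + M₃ * y 3) (i : ι) :
    N₀ * m i 0 + N₁ * m i 1 + N₂ * m i 2 + N₃ * m i 3 ≤ 0 := by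
  have := d.separate hε ha hy (M := ![M₀, M₁, M₂, M₃]) (N := ![N₀, N₁, N₂, N₃]) hM
    (by simpa using hN) (by
      rw [sum_mul_hHeight]
      simpa [dotProduct, Fin.sum_univ_four] using hMy) i
  simpa [dotProduct, Fin.sum_univ_four] using this

/-- `face_eq`, in coordinates. -/
theorem face_coord (d : IsDecomposition ε h' y c m) {a : Fin 11 → ℝ} (ha : ∀ p, 0 ≤ a p)
    (hy : y = ∑ p, a p • hPoint p) (u₀ u₁ u₂ u₃ : ℝ)
    (hu : ∀ z ∈ deltaStarP24, -1 ≤ u₀ * z 0 + u₁ * z 1 + u₂ * z 2 + u₃ * z 3)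
    (huy : u₀ * y 0 + u₁ * y 1 + u₂ * y 2 + u₃ * y 3 = -(a 0 + a 1 + a 2 + a 3 + a 4 + a 5 +
      a 6 + a 7 + a 8 + a 9 + a 10)) (i : ι) :
    u₀ * m i 0 + u₁ * m i 1 + u₂ * m i 2 + u₃ * m i 3 = -1 := by
  have := d.face_eq ha hy (u := ![u₀, u₁, u₂, u₃])
    (by simpa [dotProduct, Fin.sum_univ_four] using hu) (by
      have e : ∑ p, a p = a 0 + a 1 + a 2 + a 3 + a 4 + a 5 + a 6 + a 7 + a 8 + a 9 + a 10 := by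
        simp [Fin.sum_univ_succ]
        ring
      rw [e, ← huy]
      simp [dotProduct, Fin.sum_univ_four]) i
  simpa [dotProduct, Fin.sum_univ_four] using this

/-- The cones over the four triangles into which the square face of `Δ*_{P(2,4)}` is divided,
joined with `v₄`. -/
theorem square_join_four (d : IsDecomposition ε h' y c m) (hε : 0 < ε) (hε' : ε < 1 / 10)
    {α₂ α₃ α₄ α₅ α₆ γ s₁ s₂ : ℝ} (h₂ : 0 ≤ α₂) (h₃ : 0 ≤ α₃) (h₄ : 0 ≤ α₄)
    (h₅ : 0 ≤ α₅) (h₆ : 0 ≤ α₆) (hγ : 0 ≤ γ)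
    (hs₁ : s₁ = 1 ∧ α₆ = 0 ∨ s₁ = -1 ∧ α₂ = 0) (hs₂ : s₂ = 1 ∧ α₅ = 0 ∨ s₂ = -1 ∧ α₃ = 0)
    (hy : y = ∑ p, ![0, α₂, α₃, α₄, α₅, α₆, 0, 0, 0, 0, γ] p • hPoint p) (i : ι) :
    s₁ * (m i 3 - m i 0) ≤ 0 ∧ s₂ * (m i 3 - m i 1) ≤ 0 := by
  have ha : ∀ p, 0 ≤ (![0, α₂, α₃, α₄, α₅, α₆, 0, 0, 0, 0, γ] : Fin 11 → ℝ) p := by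
    intro p
    fin_cases p <;> simp [*]
  have hy' := hy
  rw [sum_smul_hPoint] at hy'
  simp only [Matrix.cons_val] at hy'
  -- `M` takes the prescribed heights at `v₄`, at `c` and at the two vertices picked by the signs:
  -- `v₂` or `v₆` by `s₁`, `v₃` or `v₅` by `s₂`.
  have sep := d.separate_coord (by linarith) ha hy ((1 - ε) + ε * (s₁ + 1) / 4)
    ((1 - ε) + ε * (s₂ + 1) / 4) ((1 - ε) + ε / 2) (-ε * (s₁ + s₂) / 4)
  simp only [forall_dotProduct_hPoint_le, Matrix.cons_val] at sep
  -- `m₃ - m₀` vanishes at `c`, `v₃`, `v₄`, `v₅` and has opposite signs at `v₂` and `v₆`. At the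
  -- vertex not picked `M` has slack `2ε`, so a tilt of size `ε / 8` stays below the heights.
  have h1 := sep (-s₁ * (ε / 8)) 0 0 (s₁ * (ε / 8))
  have h2 := sep 0 (-s₂ * (ε / 8)) 0 (s₂ * (ε / 8))
  clear sep ha hy
  have key : s₁ * (ε / 8) * (m i 3 - m i 0) ≤ 0 ∧ s₂ * (ε / 8) * (m i 3 - m i 1) ≤ 0 := by
    rcases hs₁ with ⟨rfl, rfl⟩ | ⟨rfl, rfl⟩ <;> rcases hs₂ with ⟨rfl, rfl⟩ | ⟨rfl, rfl⟩ <;>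
    · constructor
      · refine le_of_eq_of_le ?_ (h1 ?_ ?_ ?_ i)
        · ring
        · refine ⟨?_, ?_, ?_, ?_, ?_, ?_, ?_, ?_, ?_, ?_, ?_⟩ <;> linarith
        · refine ⟨?_, ?_, ?_, ?_, ?_, ?_, ?_, ?_, ?_, ?_, ?_⟩ <;> linarith
        · rw [hy']
          simp only [Matrix.cons_val]
          apply le_of_eq
          ring
      · refine le_of_eq_of_le ?_ (h2 ?_ ?_ ?_ i)
        · ring
        · refine ⟨?_, ?_, ?_, ?_, ?_, ?_, ?_, ?_, ?_, ?_, ?_⟩ <;> linarith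
        · refine ⟨?_, ?_, ?_, ?_, ?_, ?_, ?_, ?_, ?_, ?_, ?_⟩ <;> linarith
        · rw [hy']
          simp only [Matrix.cons_val]
          apply le_of_eq
          ring
  constructor <;> nlinarith [key.1, key.2]

/-- The cones over the four triangles into which the square face of `Δ*_{P(2,4)}` is divided,
joined with `v₁`. -/
theorem square_join_one (d : IsDecomposition ε h' y c m) (hε : 0 < ε) (hε' : ε < 1 / 10)
    {α₁ α₂ α₃ α₅ α₆ γ s₁ s₂ : ℝ} (h₁ : 0 ≤ α₁) (h₂ : 0 ≤ α₂) (h₃ : 0 ≤ α₃)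
    (h₅ : 0 ≤ α₅) (h₆ : 0 ≤ α₆) (hγ : 0 ≤ γ)
    (hs₁ : s₁ = 1 ∧ α₆ = 0 ∨ s₁ = -1 ∧ α₂ = 0) (hs₂ : s₂ = 1 ∧ α₅ = 0 ∨ s₂ = -1 ∧ α₃ = 0)
    (hy : y = ∑ p, ![α₁, α₂, α₃, 0, α₅, α₆, 0, 0, 0, 0, γ] p • hPoint p) (i : ι) :
    s₁ * (m i 3 - m i 0) ≤ 0 ∧ s₂ * (m i 3 - m i 1) ≤ 0 := by
  have ha : ∀ p, 0 ≤ (![α₁, α₂, α₃, 0, α₅, α₆, 0, 0, 0, 0, γ] : Fin 11 → ℝ) p := by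
    intro p
    fin_cases p <;> simp [*]
  have hy' := hy
  rw [sum_smul_hPoint] at hy'
  simp only [Matrix.cons_val] at hy'
  -- As for the join with `v₄`, starting from the facet `m₂ = -1` and with height `1` at `v₁`.
  have sep := d.separate_coord (by linarith) ha hy (ε * (s₁ - 1) / 4)
    (ε * (s₂ - 1) / 4) (-(1 - ε) - ε / 2) (-ε * (s₁ + s₂) / 4)
  simp only [forall_dotProduct_hPoint_le, Matrix.cons_val] at sep
  have h1 := sep (-s₁ * (ε / 8)) 0 0 (s₁ * (ε / 8))
  have h2 := sep 0 (-s₂ * (ε / 8)) 0 (s₂ * (ε / 8))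
  clear sep ha hy
  have key : s₁ * (ε / 8) * (m i 3 - m i 0) ≤ 0 ∧ s₂ * (ε / 8) * (m i 3 - m i 1) ≤ 0 := by
    rcases hs₁ with ⟨rfl, rfl⟩ | ⟨rfl, rfl⟩ <;> rcases hs₂ with ⟨rfl, rfl⟩ | ⟨rfl, rfl⟩ <;>
    · constructor
      · refine le_of_eq_of_le ?_ (h1 ?_ ?_ ?_ i)
        · ring
        · refine ⟨?_, ?_, ?_, ?_, ?_, ?_, ?_, ?_, ?_, ?_, ?_⟩ <;> linarith
        · refine ⟨?_, ?_, ?_, ?_, ?_, ?_, ?_, ?_, ?_, ?_, ?_⟩ <;> linarith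
        · rw [hy']
          simp only [Matrix.cons_val]
          apply le_of_eq
          ring
      · refine le_of_eq_of_le ?_ (h2 ?_ ?_ ?_ i)
        · ring
        · refine ⟨?_, ?_, ?_, ?_, ?_, ?_, ?_, ?_, ?_, ?_, ?_⟩ <;> linarith
        · refine ⟨?_, ?_, ?_, ?_, ?_, ?_, ?_, ?_, ?_, ?_, ?_⟩ <;> linarith
        · rw [hy']
          simp only [Matrix.cons_val]
          apply le_of_eq
          ring
  constructor <;> nlinarith [key.1, key.2]

/-- The cones over the two triangles `v₁v₂v₄` and `v₁v₆v₄`. -/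
theorem triangle_face (d : IsDecomposition ε h' y c m) {α₁ α₂ α₄ α₆ β₁ β₂ β₃ β₄ : ℝ}
    (ha : ∀ p, 0 ≤ (![α₁, α₂, 0, α₄, 0, α₆, β₁, β₂, β₃, β₄, 0] : Fin 11 → ℝ) p)
    (hs : α₆ = 0 ∧ β₂ = 0 ∨ α₂ = 0 ∧ β₁ = 0)
    (hy : y = ∑ p, ![α₁, α₂, 0, α₄, 0, α₆, β₁, β₂, β₃, β₄, 0] p • hPoint p) (i : ι) :
    m i 1 = m i 3 := by
  have hy' := hy
  rw [sum_smul_hPoint] at hy'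
  simp only [Matrix.cons_val] at hy'
  have face := d.face_coord ha hy
  simp only [Matrix.cons_val] at face
  -- Each triangle lies in two facets of `Δ*`: `m₁ = m₃ = -1` for `v₁v₂v₄`, and `m₀ = m₀ + m₁ - m₃ =
  -- -1` for `v₁v₆v₄`.
  rcases hs with ⟨rfl, rfl⟩ | ⟨rfl, rfl⟩
  · have h1 := face 0 1 0 0 (fun z hz => by linarith [(mem_deltaStarP24.1 hz).2.1])
      (by rw [hy']; simp only [Matrix.cons_val]; ring) i
    have h3 := face 0 0 0 1 (fun z hz => by linarith [(mem_deltaStarP24.1 hz).2.2.2.1])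
      (by rw [hy']; simp only [Matrix.cons_val]; ring) i
    linarith
  · have h1 := face 1 0 0 0 (fun z hz => by linarith [(mem_deltaStarP24.1 hz).1])
      (by rw [hy']; simp only [Matrix.cons_val]; ring) i
    have h3 := face 1 1 0 (-1) (fun z hz => by linarith [(mem_deltaStarP24.1 hz).2.2.2.2.2])
      (by rw [hy']; simp only [Matrix.cons_val]; ring) i
    linarith

theorem fibreLower_of_eq {z : Fin 4 → ℝ} (h : z 1 = z 3) :
    fibreLower z = max 0 (max (-z 2) (z 0 + z 1 + z 2)) := by
  simp [fibreLower, h]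

/-- The cones over the triangles `t₁t₃t₄` and `t₂t₃t₄`. -/
theorem fibreLower_eq_zero (d : IsDecomposition ε h' y c m) (hε : 0 < ε) (hε' : ε < 1 / 10)
    {β₁ β₂ β₃ β₄ : ℝ}
    (ha : ∀ p, 0 ≤ (![0, 0, 0, 0, 0, 0, β₁, β₂, β₃, β₄, 0] : Fin 11 → ℝ) p)
    (hs : β₂ = 0 ∨ β₁ = 0)
    (hy : y = ∑ p, ![0, 0, 0, 0, 0, 0, β₁, β₂, β₃, β₄, 0] p • hPoint p) (i : ι) :
    fibreLower (m i) = 0 := by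
  rw [fibreLower_of_eq (d.triangle_face ha (by simpa using hs) hy i)]
  have hy' := hy
  rw [sum_smul_hPoint] at hy'
  simp only [Matrix.cons_val] at hy'
  have key : m i 0 + m i 1 + m i 2 ≤ 0 ∧ -m i 2 ≤ 0 := by
    rcases hs with ⟨rfl⟩ | ⟨rfl⟩
    -- `M` is `1 - ε` times the average of the two facet functions of the triangle, so it is
    -- constant on it: exact at the `tᵢ`, with slack `ε` at its vertices.
    · have sep := d.separate_coord (by linarith) ha hy (0) (-(1 - ε) / 2 + 0) (0)
        (-(1 - ε) / 2)
      simp only [forall_dotProduct_hPoint_le, Matrix.cons_val] at sep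
      have h1 := sep (ε / 8) (ε / 8) (ε / 8) 0
      have h2 := sep 0 0 (-(ε / 8)) 0
      clear sep ha hy
      constructor
      · have := h1 ?_ ?_ ?_ i
        · nlinarith
        · refine ⟨?_, ?_, ?_, ?_, ?_, ?_, ?_, ?_, ?_, ?_, ?_⟩ <;> linarith
        · refine ⟨?_, ?_, ?_, ?_, ?_, ?_, ?_, ?_, ?_, ?_, ?_⟩ <;> linarith
        · rw [hy']
          simp only [Matrix.cons_val]
          apply le_of_eq
          ring
      · have := h2 ?_ ?_ ?_ i
        · nlinarith
        · refine ⟨?_, ?_, ?_, ?_, ?_, ?_, ?_, ?_, ?_, ?_, ?_⟩ <;> linarith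
        · refine ⟨?_, ?_, ?_, ?_, ?_, ?_, ?_, ?_, ?_, ?_, ?_⟩ <;> linarith
        · rw [hy']
          simp only [Matrix.cons_val]
          apply le_of_eq
          ring
    · have sep := d.separate_coord (by linarith) ha hy (-(1 - ε) + 0)
        (-(1 - ε) / 2 + 0) (0) ((1 - ε) / 2)
      simp only [forall_dotProduct_hPoint_le, Matrix.cons_val] at sep
      have h1 := sep (ε / 8) (ε / 8) (ε / 8) 0
      have h2 := sep 0 0 (-(ε / 8)) 0
      clear sep ha hy
      constructor
      · have := h1 ?_ ?_ ?_ i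
        · nlinarith
        · refine ⟨?_, ?_, ?_, ?_, ?_, ?_, ?_, ?_, ?_, ?_, ?_⟩ <;> linarith
        · refine ⟨?_, ?_, ?_, ?_, ?_, ?_, ?_, ?_, ?_, ?_, ?_⟩ <;> linarith
        · rw [hy']
          simp only [Matrix.cons_val]
          apply le_of_eq
          ring
      · have := h2 ?_ ?_ ?_ i
        · nlinarith
        · refine ⟨?_, ?_, ?_, ?_, ?_, ?_, ?_, ?_, ?_, ?_, ?_⟩ <;> linarith
        · refine ⟨?_, ?_, ?_, ?_, ?_, ?_, ?_, ?_, ?_, ?_, ?_⟩ <;> linarith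
        · rw [hy']
          simp only [Matrix.cons_val]
          apply le_of_eq
          ring
  rw [max_eq_left (max_le key.2 key.1)]

/-- The cones over the trapezoids `v₂v₄t₃t₁` and `v₆v₄t₃t₂`. -/
theorem fibreLower_eq_add (d : IsDecomposition ε h' y c m) (hε : 0 < ε) (hε' : ε < 1 / 10)
    {α₂ α₄ α₆ β₁ β₂ β₃ : ℝ}
    (ha : ∀ p, 0 ≤ (![0, α₂, 0, α₄, 0, α₆, β₁, β₂, β₃, 0, 0] : Fin 11 → ℝ) p)
    (hs : α₆ = 0 ∧ β₂ = 0 ∨ α₂ = 0 ∧ β₁ = 0)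
    (hy : y = ∑ p, ![0, α₂, 0, α₄, 0, α₆, β₁, β₂, β₃, 0, 0] p • hPoint p) (i : ι) :
    fibreLower (m i) = m i 0 + m i 1 + m i 2 := by
  rw [fibreLower_of_eq (d.triangle_face ha (by simpa using hs) hy i)]
  have hy' := hy
  rw [sum_smul_hPoint] at hy'
  simp only [Matrix.cons_val] at hy'
  have key : -(m i 0 + m i 1 + m i 2) ≤ 0 ∧ -(m i 0 + m i 1 + m i 2 + m i 2) ≤ 0 := by
    rcases hs with ⟨rfl, rfl⟩ | ⟨rfl, rfl⟩
    -- Adding `ε (m₀ + m₁ + m₂)` to the averaged facet function raises it to `1` at `v₂` and `v₄`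
    -- and changes nothing at `t₁` and `t₃`. The tilts test the two walls bounding the region where
    -- `m₀ + m₁ + m₂` is the largest of the three terms of `fibreLower`.
    · have sep := d.separate_coord (by linarith) ha hy (ε) (-(1 - ε) / 2 + ε) (ε)
        (-(1 - ε) / 2)
      simp only [forall_dotProduct_hPoint_le, Matrix.cons_val] at sep
      have h1 := sep (-(ε / 8)) (-(ε / 8)) (-(ε / 8)) 0
      have h2 := sep (-(ε / 8)) (-(ε / 8)) (-(ε / 4)) 0
      clear sep ha hy
      constructor
      · have := h1 ?_ ?_ ?_ i
        · nlinarith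
        · refine ⟨?_, ?_, ?_, ?_, ?_, ?_, ?_, ?_, ?_, ?_, ?_⟩ <;> linarith
        · refine ⟨?_, ?_, ?_, ?_, ?_, ?_, ?_, ?_, ?_, ?_, ?_⟩ <;> linarith
        · rw [hy']
          simp only [Matrix.cons_val]
          apply le_of_eq
          ring
      · have := h2 ?_ ?_ ?_ i
        · nlinarith
        · refine ⟨?_, ?_, ?_, ?_, ?_, ?_, ?_, ?_, ?_, ?_, ?_⟩ <;> linarith
        · refine ⟨?_, ?_, ?_, ?_, ?_, ?_, ?_, ?_, ?_, ?_, ?_⟩ <;> linarith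
        · rw [hy']
          simp only [Matrix.cons_val]
          apply le_of_eq
          ring
    · have sep := d.separate_coord (by linarith) ha hy (-(1 - ε) + ε)
        (-(1 - ε) / 2 + ε) (ε) ((1 - ε) / 2)
      simp only [forall_dotProduct_hPoint_le, Matrix.cons_val] at sep
      have h1 := sep (-(ε / 8)) (-(ε / 8)) (-(ε / 8)) 0
      have h2 := sep (-(ε / 8)) (-(ε / 8)) (-(ε / 4)) 0
      clear sep ha hy
      constructor
      · have := h1 ?_ ?_ ?_ i
        · nlinarith
        · refine ⟨?_, ?_, ?_, ?_, ?_, ?_, ?_, ?_, ?_, ?_, ?_⟩ <;> linarith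
        · refine ⟨?_, ?_, ?_, ?_, ?_, ?_, ?_, ?_, ?_, ?_, ?_⟩ <;> linarith
        · rw [hy']
          simp only [Matrix.cons_val]
          apply le_of_eq
          ring
      · have := h2 ?_ ?_ ?_ i
        · nlinarith
        · refine ⟨?_, ?_, ?_, ?_, ?_, ?_, ?_, ?_, ?_, ?_, ?_⟩ <;> linarith
        · refine ⟨?_, ?_, ?_, ?_, ?_, ?_, ?_, ?_, ?_, ?_, ?_⟩ <;> linarith
        · rw [hy']
          simp only [Matrix.cons_val]
          apply le_of_eq
          ring
  have e : max (-m i 2) (m i 0 + m i 1 + m i 2) = m i 0 + m i 1 + m i 2 :=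
    max_eq_right (by linarith [key.2])
  rw [e, max_eq_right (by linarith [key.1])]

/-- The cones over the trapezoids `v₂v₁t₄t₁` and `v₆v₁t₄t₂`. -/
theorem fibreLower_eq_neg (d : IsDecomposition ε h' y c m) (hε : 0 < ε) (hε' : ε < 1 / 10)
    {α₁ α₂ α₆ β₁ β₂ β₄ : ℝ}
    (ha : ∀ p, 0 ≤ (![α₁, α₂, 0, 0, 0, α₆, β₁, β₂, 0, β₄, 0] : Fin 11 → ℝ) p)
    (hs : α₆ = 0 ∧ β₂ = 0 ∨ α₂ = 0 ∧ β₁ = 0)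
    (hy : y = ∑ p, ![α₁, α₂, 0, 0, 0, α₆, β₁, β₂, 0, β₄, 0] p • hPoint p) (i : ι) :
    fibreLower (m i) = -m i 2 := by
  rw [fibreLower_of_eq (d.triangle_face ha (by simpa using hs) hy i)]
  have hy' := hy
  rw [sum_smul_hPoint] at hy'
  simp only [Matrix.cons_val] at hy'
  have key : m i 2 ≤ 0 ∧ m i 0 + m i 1 + m i 2 + m i 2 ≤ 0 := by
    rcases hs with ⟨rfl, rfl⟩ | ⟨rfl, rfl⟩
    -- Here the correction is `-ε m₂`, which is `ε` at `v₁` and `v₂` and zero at `t₁` and `t₄`.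
    · have sep := d.separate_coord (by linarith) ha hy (0) (-(1 - ε) / 2 + 0) (-ε)
        (-(1 - ε) / 2)
      simp only [forall_dotProduct_hPoint_le, Matrix.cons_val] at sep
      have h1 := sep 0 0 (ε / 8) 0
      have h2 := sep (ε / 8) (ε / 8) (ε / 4) 0
      clear sep ha hy
      constructor
      · have := h1 ?_ ?_ ?_ i
        · nlinarith
        · refine ⟨?_, ?_, ?_, ?_, ?_, ?_, ?_, ?_, ?_, ?_, ?_⟩ <;> linarith
        · refine ⟨?_, ?_, ?_, ?_, ?_, ?_, ?_, ?_, ?_, ?_, ?_⟩ <;> linarith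
        · rw [hy']
          simp only [Matrix.cons_val]
          apply le_of_eq
          ring
      · have := h2 ?_ ?_ ?_ i
        · nlinarith
        · refine ⟨?_, ?_, ?_, ?_, ?_, ?_, ?_, ?_, ?_, ?_, ?_⟩ <;> linarith
        · refine ⟨?_, ?_, ?_, ?_, ?_, ?_, ?_, ?_, ?_, ?_, ?_⟩ <;> linarith
        · rw [hy']
          simp only [Matrix.cons_val]
          apply le_of_eq
          ring
    · have sep := d.separate_coord (by linarith) ha hy (-(1 - ε) + 0)
        (-(1 - ε) / 2 + 0) (-ε) ((1 - ε) / 2)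
      simp only [forall_dotProduct_hPoint_le, Matrix.cons_val] at sep
      have h1 := sep 0 0 (ε / 8) 0
      have h2 := sep (ε / 8) (ε / 8) (ε / 4) 0
      clear sep ha hy
      constructor
      · have := h1 ?_ ?_ ?_ i
        · nlinarith
        · refine ⟨?_, ?_, ?_, ?_, ?_, ?_, ?_, ?_, ?_, ?_, ?_⟩ <;> linarith
        · refine ⟨?_, ?_, ?_, ?_, ?_, ?_, ?_, ?_, ?_, ?_, ?_⟩ <;> linarith
        · rw [hy']
          simp only [Matrix.cons_val]
          apply le_of_eq
          ring
      · have := h2 ?_ ?_ ?_ i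
        · nlinarith
        · refine ⟨?_, ?_, ?_, ?_, ?_, ?_, ?_, ?_, ?_, ?_, ?_⟩ <;> linarith
        · refine ⟨?_, ?_, ?_, ?_, ?_, ?_, ?_, ?_, ?_, ?_, ?_⟩ <;> linarith
        · rw [hy']
          simp only [Matrix.cons_val]
          apply le_of_eq
          ring
  have e : max (-m i 2) (m i 0 + m i 1 + m i 2) = -m i 2 := max_eq_left (by linarith [key.2])
  rw [e, max_eq_right (by linarith [key.1])]

/-- A criterion for lifting a decomposition of `g*(x)`, in terms of linear bounds for the ends of
the fibres of `∇` over the lattice points in it. -/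
theorem hasLatticeLift_of_le {x : Fin 5 → ℝ} (hh : IsSublinear h')
    (d : IsDecomposition ε h' (gStar x) c m) {Φ : ℝ} (hΦ : Φ ≤ gauge nabla x)
    (hc : ∑ i, c i ≤ Φ) (l₀ l₁ l₂ l₃ κ u₀ u₁ u₂ u₃ κ' : ℝ) (hκ : 0 ≤ κ) (hκ' : 0 ≤ κ')
    (hl : ∀ i, fibreLower (m i) ≤ l₀ * m i 0 + l₁ * m i 1 + l₂ * m i 2 + l₃ * m i 3 + κ)
    (hl' : l₀ * gStar x 0 + l₁ * gStar x 1 + l₂ * gStar x 2 + l₃ * gStar x 3 + κ * Φ ≤ x 4 + Φ)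
    (hu : ∀ i, fibreUpper (m i) ≤ u₀ * m i 0 + u₁ * m i 1 + u₂ * m i 2 + u₃ * m i 3 + κ')
    (hu' : u₀ * gStar x 0 + u₁ * gStar x 1 + u₂ * gStar x 2 + u₃ * gStar x 3 + κ' * Φ ≤
      Φ - x 4) : HasLatticeLift h' x := by
  have key : ∀ (F : (Fin 4 → ℝ) → ℝ) (q₀ q₁ q₂ q₃ k : ℝ), 0 ≤ k →
      (∀ i, F (m i) ≤ q₀ * m i 0 + q₁ * m i 1 + q₂ * m i 2 + q₃ * m i 3 + k) →
      ∑ i, c i * F (m i) ≤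
        q₀ * gStar x 0 + q₁ * gStar x 1 + q₂ * gStar x 2 + q₃ * gStar x 3 + k * Φ := by
    intro F q₀ q₁ q₂ q₃ k hk hF
    have h1 := d.dotProduct_eq ![q₀, q₁, q₂, q₃]
    simp only [dotProduct, Fin.sum_univ_four, Matrix.cons_val] at h1
    rw [h1]
    refine (Finset.sum_le_sum fun i _ => mul_le_mul_of_nonneg_left (hF i) (d.pos i).le).trans ?_
    have e : ∑ i, c i * (q₀ * m i 0 + q₁ * m i 1 + q₂ * m i 2 + q₃ * m i 3 + k) =
        ∑ i, c i * (q₀ * m i 0 + q₁ * m i 1 + q₂ * m i 2 + q₃ * m i 3) + k * ∑ i, c i := by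
      rw [Finset.mul_sum, ← Finset.sum_add_distrib]
      exact Finset.sum_congr rfl fun i _ => by ring
    rw [e]
    linarith [mul_le_mul_of_nonneg_left hc hk]
  exact d.hasLatticeLift hh hΦ hc ((key _ _ _ _ _ _ hκ hl).trans hl')
    ((key _ _ _ _ _ _ hκ' hu).trans hu')

end IsDecomposition

/-! ### Lifting over the individual faces of `∇` -/

theorem fibreLower_le {z : Fin 4 → ℝ} (hz : z ∈ deltaStarP24) :
    fibreLower z ≤ max 0 (z 1 - z 3) + 1 := by
  obtain ⟨-, -, h2, -, h4, -⟩ := mem_deltaStarP24.1 hz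
  exact add_le_add le_rfl (max_le zero_le_one (max_le (by linarith) h4))

theorem fibreLower_le_one {z : Fin 4 → ℝ} (hz : z ∈ deltaStarP24) (h : z 1 ≤ z 3) :
    fibreLower z ≤ 1 := by
  have := fibreLower_le hz
  rwa [max_eq_left (by linarith), zero_add] at this

theorem fibreLower_le_sub {z : Fin 4 → ℝ} (hz : z ∈ deltaStarP24) (h : z 3 ≤ z 1) :
    fibreLower z ≤ z 1 - z 3 + 1 := by
  have := fibreLower_le hz
  rwa [max_eq_right (by linarith)] at this

theorem fibreUpper_le_one {z : Fin 4 → ℝ} (hz : z ∈ deltaStarP24) : fibreUpper z ≤ 1 := by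
  obtain ⟨-, h1, -, -, -, h5⟩ := mem_deltaStarP24.1 hz
  exact max_le (by linarith) (by linarith)

/-- Trades the common part of two coefficients for a third one. This is used with `v₂ + v₆ = v₃ + v₅
= 2c` on the square and with `t₁ + t₂ = 0`. -/
theorem exists_sign_split (p q : ℝ) (hp : 0 ≤ p) (hq : 0 ≤ q) :
    ∃ s α β γ : ℝ, 0 ≤ α ∧ 0 ≤ β ∧ 0 ≤ γ ∧ p = α + γ ∧ q = β + γ ∧
      (s = 1 ∧ β = 0 ∨ s = -1 ∧ α = 0) := by
  rcases le_total q p with h | h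
  · exact ⟨1, p - q, 0, q, by linarith, le_rfl, hq, by ring, by ring, Or.inl ⟨rfl, rfl⟩⟩
  · exact ⟨-1, 0, q - p, p, le_rfl, by linarith, hp, by ring, by ring, Or.inr ⟨rfl, rfl⟩⟩

/-- A combination of the vertices of `∇` other than `(0,0,0,0,±1)`. -/
noncomputable def vertexSum (a₀ a₁ a₂ a₃ a₄ a₅ b₁ b₂ b₃ b₄ : ℝ) : Fin 5 → ℝ :=
  ![-a₀ + 3 * a₁ - a₂ - a₃ - a₄ - a₅ + 2 * b₁, -a₀ - a₁ + 3 * a₂ - a₃ - a₄ - a₅ + 2 * b₂,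
    -a₀ - a₁ - a₂ + 3 * a₃ - a₄ - a₅ + 2 * b₃, -a₀ - a₁ - a₂ - a₃ + 3 * a₄ - a₅ + 2 * b₄,
    4 * a₅ - b₁ - b₂ - b₃ - b₄]

theorem gStar_vertexSum (a₀ a₁ a₂ a₃ a₄ a₅ b₁ b₂ b₃ b₄ : ℝ) :
    gStar (vertexSum a₀ a₁ a₂ a₃ a₄ a₅ b₁ b₂ b₃ b₄) =
      ![3 * a₀ + 3 * a₁ - a₂ - a₃ - a₄ - a₅ + b₁ - b₂ - b₃ - b₄,
        -a₀ - a₁ + 3 * a₂ - a₃ - a₄ + 3 * a₅ - b₁ + b₂ - b₃ - b₄,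
        -a₀ - a₁ - a₂ + 3 * a₃ - a₄ - a₅ + 2 * b₃,
        3 * a₀ - a₁ + 3 * a₂ - a₃ - a₄ - a₅ - b₁ + b₂ - b₃ - b₄] := by
  rw [gStar_apply]
  ext i
  fin_cases i <;> simp [vertexSum] <;> ring

section Lift

variable {ε : ℝ} {h' : (Fin 4 → ℝ) → ℝ} {ι : Type} [Fintype ι] {c : ι → ℝ} {m : ι → Fin 4 → ℝ}
  {a₀ a₁ a₂ a₃ a₄ a₅ b₁ b₂ b₃ b₄ : ℝ}

/-- `IsDecomposition.hasLatticeLift_of_le` for a point given as a combination of vertices. -/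
theorem hasLatticeLift_vertexSum (hh : IsSublinear h')
    (d : IsDecomposition ε h' (gStar (vertexSum a₀ a₁ a₂ a₃ a₄ a₅ b₁ b₂ b₃ b₄)) c m)
    (hΦ : a₀ + a₁ + a₂ + a₃ + a₄ + a₅ + b₁ + b₂ + b₃ + b₄ ≤
      gauge nabla (vertexSum a₀ a₁ a₂ a₃ a₄ a₅ b₁ b₂ b₃ b₄))
    (ha : 0 ≤ a₀ ∧ 0 ≤ a₁ ∧ 0 ≤ a₂ ∧ 0 ≤ a₃ ∧ 0 ≤ a₄ ∧ 0 ≤ a₅)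
    (hb : 0 ≤ b₁ ∧ 0 ≤ b₂ ∧ 0 ≤ b₃ ∧ 0 ≤ b₄)
    (l₀ l₁ l₂ l₃ κ u₀ u₁ u₂ u₃ κ' : ℝ) (hκ : 0 ≤ κ) (hκ' : 0 ≤ κ')
    (hl : ∀ i, fibreLower (m i) ≤ l₀ * m i 0 + l₁ * m i 1 + l₂ * m i 2 + l₃ * m i 3 + κ)
    (hl' : l₀ * (3 * a₀ + 3 * a₁ - a₂ - a₃ - a₄ - a₅ + b₁ - b₂ - b₃ - b₄) +
      l₁ * (-a₀ - a₁ + 3 * a₂ - a₃ - a₄ + 3 * a₅ - b₁ + b₂ - b₃ - b₄) +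
      l₂ * (-a₀ - a₁ - a₂ + 3 * a₃ - a₄ - a₅ + 2 * b₃) +
      l₃ * (3 * a₀ - a₁ + 3 * a₂ - a₃ - a₄ - a₅ - b₁ + b₂ - b₃ - b₄) +
      κ * (a₀ + a₁ + a₂ + a₃ + a₄ + a₅ + b₁ + b₂ + b₃ + b₄) ≤
        a₀ + a₁ + a₂ + a₃ + a₄ + 5 * a₅)
    (hu : ∀ i, fibreUpper (m i) ≤ u₀ * m i 0 + u₁ * m i 1 + u₂ * m i 2 + u₃ * m i 3 + κ')
    (hu' : u₀ * (3 * a₀ + 3 * a₁ - a₂ - a₃ - a₄ - a₅ + b₁ - b₂ - b₃ - b₄) +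
      u₁ * (-a₀ - a₁ + 3 * a₂ - a₃ - a₄ + 3 * a₅ - b₁ + b₂ - b₃ - b₄) +
      u₂ * (-a₀ - a₁ - a₂ + 3 * a₃ - a₄ - a₅ + 2 * b₃) +
      u₃ * (3 * a₀ - a₁ + 3 * a₂ - a₃ - a₄ - a₅ - b₁ + b₂ - b₃ - b₄) +
      κ' * (a₀ + a₁ + a₂ + a₃ + a₄ + a₅ + b₁ + b₂ + b₃ + b₄) ≤
        a₀ + a₁ + a₂ + a₃ + a₄ - 3 * a₅ + 2 * (b₁ + b₂ + b₃ + b₄)) :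
    HasLatticeLift h' (vertexSum a₀ a₁ a₂ a₃ a₄ a₅ b₁ b₂ b₃ b₄) := by
  have hc : ∑ i, c i ≤ a₀ + a₁ + a₂ + a₃ + a₄ + a₅ + b₁ + b₂ + b₃ + b₄ := by
    -- `g*` carries the vertices with coefficients `a₄, a₁, a₅, a₃, a₀, a₂` to `v₁, …, v₆` and those
    -- with coefficients `bᵢ` to `tᵢ`.
    have := d.sum_le (a := ![a₄, a₁, a₅, a₃, a₀, a₂, b₁, b₂, b₃, b₄, 0]) (by
      intro p
      fin_cases p <;> simp [ha, hb]) hPoint_mem (by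
      rw [sum_smul_hPoint, gStar_vertexSum]
      simp only [Matrix.cons_val]
      ext j
      fin_cases j <;> simp <;> ring)
    refine this.trans_eq ?_
    simp [Fin.sum_univ_succ]
    ring
  have h4 : vertexSum a₀ a₁ a₂ a₃ a₄ a₅ b₁ b₂ b₃ b₄ 4 = 4 * a₅ - b₁ - b₂ - b₃ - b₄ := rfl
  refine d.hasLatticeLift_of_le hh hΦ hc l₀ l₁ l₂ l₃ κ u₀ u₁ u₂ u₃ κ' hκ hκ' hl ?_ hu ?_
  · rw [h4, gStar_vertexSum]
    simp only [Matrix.cons_val]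
    linarith
  · rw [h4, gStar_vertexSum]
    simp only [Matrix.cons_val]
    linarith

/-- The image lies over the face `v₅v₄v₁`, where `m₁ = -1 ≤ m₃`, so the crude bound `1` for both
ends of the fibres is enough. -/
theorem hasLatticeLift_zero_three_four (hh : IsSublinear h')
    (d : IsDecomposition ε h' (gStar (vertexSum a₀ 0 0 a₃ a₄ 0 0 0 0 0)) c m)
    (hΦ : a₀ + 0 + 0 + a₃ + a₄ + 0 + 0 + 0 + 0 + 0 ≤
      gauge nabla (vertexSum a₀ 0 0 a₃ a₄ 0 0 0 0 0))
    (h₀ : 0 ≤ a₀) (h₃ : 0 ≤ a₃) (h₄ : 0 ≤ a₄) :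
    HasLatticeLift h' (vertexSum a₀ 0 0 a₃ a₄ 0 0 0 0 0) := by
  have hy : gStar (vertexSum a₀ 0 0 a₃ a₄ 0 0 0 0 0) =
      ∑ p, ![a₄, 0, 0, a₃, a₀, 0, 0, 0, 0, 0, 0] p • hPoint p := by
    rw [sum_smul_hPoint, gStar_vertexSum]
    simp only [Matrix.cons_val]
    ext j
    fin_cases j <;> simp <;> ring
  have hm := d.face_coord (by intro p; fin_cases p <;> simp [*]) hy 0 1 0 0
    (fun z hz => by linarith [(mem_deltaStarP24.1 hz).2.1])
    (by rw [gStar_vertexSum]; simp only [Matrix.cons_val]; ring)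
  refine hasLatticeLift_vertexSum hh d hΦ (by simp [*]) (by simp) 0 0 0 0 1 0 0 0 0 1 zero_le_one
    zero_le_one (fun i => ?_) (by linarith) (fun i => ?_) (by linarith)
  · linarith [fibreLower_le_one (d.mem i).1
      (by linarith [hm i, (mem_deltaStarP24.1 (d.mem i).1).2.2.2.1])]
  · linarith [fibreUpper_le_one (d.mem i).1]

/-- The image lies over the face `v₃v₄v₁`. There `m₃ = -1` settles both relevant maxima: `m₃ ≤ m₁`
and `m₃ ≤ m₀`. -/
theorem hasLatticeLift_five_three_four (hh : IsSublinear h')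
    (d : IsDecomposition ε h' (gStar (vertexSum 0 0 0 a₃ a₄ a₅ 0 0 0 0)) c m)
    (hΦ : 0 + 0 + 0 + a₃ + a₄ + a₅ + 0 + 0 + 0 + 0 ≤
      gauge nabla (vertexSum 0 0 0 a₃ a₄ a₅ 0 0 0 0))
    (h₃ : 0 ≤ a₃) (h₄ : 0 ≤ a₄) (h₅ : 0 ≤ a₅) :
    HasLatticeLift h' (vertexSum 0 0 0 a₃ a₄ a₅ 0 0 0 0) := by
  have hy : gStar (vertexSum 0 0 0 a₃ a₄ a₅ 0 0 0 0) =
      ∑ p, ![a₄, 0, a₅, a₃, 0, 0, 0, 0, 0, 0, 0] p • hPoint p := by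
    rw [sum_smul_hPoint, gStar_vertexSum]
    simp only [Matrix.cons_val]
    ext j
    fin_cases j <;> simp <;> ring
  have hm := d.face_coord (by intro p; fin_cases p <;> simp [*]) hy 0 0 0 1
    (fun z hz => by linarith [(mem_deltaStarP24.1 hz).2.2.2.1])
    (by rw [gStar_vertexSum]; simp only [Matrix.cons_val]; ring)
  refine hasLatticeLift_vertexSum hh d hΦ (by simp [*]) (by simp) 0 1 0 (-1) 1 0 (-1) 0 0 0
    zero_le_one le_rfl (fun i => ?_) (by linarith) (fun i => ?_) (by linarith)
  · linarith [fibreLower_le_sub (d.mem i).1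
      (by linarith [hm i, (mem_deltaStarP24.1 (d.mem i).1).2.1])]
  · obtain ⟨h0, -⟩ := mem_deltaStarP24.1 (d.mem i).1
    refine max_le (by linarith) ?_
    linarith [hm i]

/-- The case of points over the two facets of `Δ*_{P(2,4)}` containing the square face. -/
theorem hasLatticeLift_square (hε : 0 < ε) (hε' : ε < 1 / 10) (hh : IsSublinear h')
    (d : IsDecomposition ε h' (gStar (vertexSum a₀ a₁ a₂ a₃ a₄ a₅ 0 0 0 0)) c m)
    (hΦ : a₀ + a₁ + a₂ + a₃ + a₄ + a₅ + 0 + 0 + 0 + 0 ≤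
      gauge nabla (vertexSum a₀ a₁ a₂ a₃ a₄ a₅ 0 0 0 0))
    (ha : 0 ≤ a₀ ∧ 0 ≤ a₁ ∧ 0 ≤ a₂ ∧ 0 ≤ a₃ ∧ 0 ≤ a₄ ∧ 0 ≤ a₅) (h34 : a₃ = 0 ∨ a₄ = 0) :
    HasLatticeLift h' (vertexSum a₀ a₁ a₂ a₃ a₄ a₅ 0 0 0 0) := by
  obtain ⟨h₀, h₁, h₂, h₃, h₄, h₅⟩ := ha
  obtain ⟨s₁, α₂, α₆, γ, hα₂, hα₆, hγ, h12, h16, hs₁⟩ := exists_sign_split a₁ a₂ h₁ h₂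
  obtain ⟨s₂, α₃, α₅, δ, hα₃, hα₅, hδ, h23, h25, hs₂⟩ := exists_sign_split a₅ a₀ h₅ h₀
  have hsign : ∀ i, s₁ * (m i 3 - m i 0) ≤ 0 ∧ s₂ * (m i 3 - m i 1) ≤ 0 := by
    rcases h34 with h | h
    · refine d.square_join_one hε hε' (α₁ := a₄) (α₂ := α₂) (α₃ := α₃) (α₅ := α₅) (α₆ := α₆)
        (γ := 2 * (γ + δ)) h₄ hα₂ hα₃ hα₅ hα₆ (by linarith) hs₁ hs₂ ?_
      rw [sum_smul_hPoint, gStar_vertexSum, h, h12, h16, h23, h25]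
      simp only [Matrix.cons_val]
      ext j
      fin_cases j <;> simp <;> ring
    · refine d.square_join_four hε hε' (α₂ := α₂) (α₃ := α₃) (α₄ := a₃) (α₅ := α₅) (α₆ := α₆)
        (γ := 2 * (γ + δ)) hα₂ hα₃ h₃ hα₅ hα₆ (by linarith) hs₁ hs₂ ?_
      rw [sum_smul_hPoint, gStar_vertexSum, h, h12, h16, h23, h25]
      simp only [Matrix.cons_val]
      ext j
      fin_cases j <;> simp <;> ring
  -- `l` is the slope of `max 0 (m₁ - m₃)` on the chosen side of the wall `m₃ = m₁`.
  obtain ⟨l, hl, hl', hlb⟩ : ∃ l : ℝ, (l = 0 ∨ l = 1) ∧ l * (a₅ - a₀) ≤ a₅ ∧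
      ∀ i, fibreLower (m i) ≤ 0 * m i 0 + l * m i 1 + 0 * m i 2 + -l * m i 3 + 1 := by
    rcases hs₂ with ⟨rfl, -⟩ | ⟨rfl, -⟩
    · refine ⟨1, Or.inr rfl, by linarith, fun i => ?_⟩
      linarith [fibreLower_le_sub (d.mem i).1 (by linarith [(hsign i).2])]
    · refine ⟨0, Or.inl rfl, by linarith, fun i => ?_⟩
      linarith [fibreLower_le_one (d.mem i).1 (by linarith [(hsign i).2])]
  rcases hs₁ with ⟨rfl, -⟩ | ⟨rfl, -⟩
  · refine hasLatticeLift_vertexSum hh d hΦ ⟨h₀, h₁, h₂, h₃, h₄, h₅⟩ (by simp) 0 l 0 (-l) 1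
      0 (-1) 0 0 0 zero_le_one le_rfl hlb (by linarith) (fun i => ?_) (by linarith)
    refine max_le (by linarith) (by linarith [(hsign i).1])
  · refine hasLatticeLift_vertexSum hh d hΦ ⟨h₀, h₁, h₂, h₃, h₄, h₅⟩ (by simp) 0 l 0 (-l) 1
      (-1) (-1) 0 1 0 zero_le_one le_rfl hlb (by linarith) (fun i => ?_) (by linarith)
    refine max_le (by linarith [(hsign i).1]) (by linarith)

/-- The case of points over the facet of `Newt(φ₂)` opposite to `(0,0,0,0,1)`. -/
theorem hasLatticeLift_newt_phi2 (hε : 0 < ε) (hε' : ε < 1 / 10) (hh : IsSublinear h')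
    (d : IsDecomposition ε h' (gStar (vertexSum 0 0 0 0 0 0 b₁ b₂ b₃ b₄)) c m)
    (hΦ : 0 + 0 + 0 + 0 + 0 + 0 + b₁ + b₂ + b₃ + b₄ ≤
      gauge nabla (vertexSum 0 0 0 0 0 0 b₁ b₂ b₃ b₄))
    (hb : 0 ≤ b₁ ∧ 0 ≤ b₂ ∧ 0 ≤ b₃ ∧ 0 ≤ b₄) :
    HasLatticeLift h' (vertexSum 0 0 0 0 0 0 b₁ b₂ b₃ b₄) := by
  -- Here the last coordinate of `x` is minus the total weight, so the lower ends must sum to zero.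
  -- Cancelling `t₁ + t₂ = 0` moves the image into one of the triangles `t₁t₃t₄`, `t₂t₃t₄`, where
  -- `fibreLower` vanishes.
  obtain ⟨s, α, β, γ, hα, hβ, hγ, h1, h2, hs⟩ := exists_sign_split b₁ b₂ hb.1 hb.2.1
  have hm : ∀ i, fibreLower (m i) = 0 := by
    refine d.fibreLower_eq_zero hε hε' (β₁ := α) (β₂ := β) (β₃ := b₃) (β₄ := b₄) ?_ ?_ ?_
    · intro p
      fin_cases p <;> simp [*]
    · exact hs.imp And.right And.right
    · rw [sum_smul_hPoint, gStar_vertexSum, h1, h2]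
      simp only [Matrix.cons_val]
      ext j
      fin_cases j <;> simp <;> ring
  refine hasLatticeLift_vertexSum hh d hΦ (by simp) hb 0 0 0 0 0 0 0 0 0 1 le_rfl
    zero_le_one (fun i => ?_) (by linarith) (fun i => ?_) (by linarith)
  · linarith [hm i]
  · linarith [fibreUpper_le_one (d.mem i).1]

/-- Over these trapezoids `fibreLower` is the single linear function `m₀ + m₁ + m₂`, and its bound
is attained; the upper bound `1` suffices because the last coordinate of `x` is nonpositive. -/
theorem hasLatticeLift_trapezoid_three (hε : 0 < ε) (hε' : ε < 1 / 10) (hh : IsSublinear h')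
    (d : IsDecomposition ε h' (gStar (vertexSum 0 a₁ a₂ a₃ 0 0 b₁ b₂ b₃ 0)) c m)
    (hΦ : 0 + a₁ + a₂ + a₃ + 0 + 0 + b₁ + b₂ + b₃ + 0 ≤
      gauge nabla (vertexSum 0 a₁ a₂ a₃ 0 0 b₁ b₂ b₃ 0))
    (ha : 0 ≤ a₁ ∧ 0 ≤ a₂ ∧ 0 ≤ a₃) (hb : 0 ≤ b₁ ∧ 0 ≤ b₂ ∧ 0 ≤ b₃)
    (h : a₂ = 0 ∧ b₂ = 0 ∨ a₁ = 0 ∧ b₁ = 0) :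
    HasLatticeLift h' (vertexSum 0 a₁ a₂ a₃ 0 0 b₁ b₂ b₃ 0) := by
  have hm : ∀ i, fibreLower (m i) = m i 0 + m i 1 + m i 2 := by
    refine d.fibreLower_eq_add hε hε' (α₂ := a₁) (α₄ := a₃) (α₆ := a₂) (β₁ := b₁) (β₂ := b₂)
      (β₃ := b₃) ?_ h ?_
    · intro p
      fin_cases p <;> simp [*]
    · rw [sum_smul_hPoint, gStar_vertexSum]
      simp only [Matrix.cons_val]
      ext j
      fin_cases j <;> simp <;> ring
  refine hasLatticeLift_vertexSum hh d hΦ (by simp [*]) (by simp [*]) 1 1 1 0 0 0 0 0 0 1 le_rfl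
    zero_le_one (fun i => ?_) (by linarith) (fun i => ?_) (by linarith)
  · linarith [hm i]
  · linarith [fibreUpper_le_one (d.mem i).1]

theorem hasLatticeLift_trapezoid_four (hε : 0 < ε) (hε' : ε < 1 / 10) (hh : IsSublinear h')
    (d : IsDecomposition ε h' (gStar (vertexSum 0 a₁ a₂ 0 a₄ 0 b₁ b₂ 0 b₄)) c m)
    (hΦ : 0 + a₁ + a₂ + 0 + a₄ + 0 + b₁ + b₂ + 0 + b₄ ≤
      gauge nabla (vertexSum 0 a₁ a₂ 0 a₄ 0 b₁ b₂ 0 b₄))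
    (ha : 0 ≤ a₁ ∧ 0 ≤ a₂ ∧ 0 ≤ a₄) (hb : 0 ≤ b₁ ∧ 0 ≤ b₂ ∧ 0 ≤ b₄)
    (h : a₂ = 0 ∧ b₂ = 0 ∨ a₁ = 0 ∧ b₁ = 0) :
    HasLatticeLift h' (vertexSum 0 a₁ a₂ 0 a₄ 0 b₁ b₂ 0 b₄) := by
  have hm : ∀ i, fibreLower (m i) = -m i 2 := by
    refine d.fibreLower_eq_neg hε hε' (α₁ := a₄) (α₂ := a₁) (α₆ := a₂) (β₁ := b₁) (β₂ := b₂)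
      (β₄ := b₄) ?_ h ?_
    · intro p
      fin_cases p <;> simp [*]
    · rw [sum_smul_hPoint, gStar_vertexSum]
      simp only [Matrix.cons_val]
      ext j
      fin_cases j <;> simp <;> ring
  refine hasLatticeLift_vertexSum hh d hΦ (by simp [*]) (by simp [*]) 0 0 (-1) 0 0 0 0 0 0 1
    le_rfl zero_le_one (fun i => ?_) (by linarith) (fun i => ?_) (by linarith)
  · linarith [hm i]
  · linarith [fibreUpper_le_one (d.mem i).1]

theorem hasLatticeLift_trapezoid_three_four (hε : 0 < ε) (hε' : ε < 1 / 10)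
    (hh : IsSublinear h')
    (d : IsDecomposition ε h' (gStar (vertexSum 0 0 0 a₃ a₄ 0 0 0 b₃ b₄)) c m)
    (hΦ : 0 + 0 + 0 + a₃ + a₄ + 0 + 0 + 0 + b₃ + b₄ ≤
      gauge nabla (vertexSum 0 0 0 a₃ a₄ 0 0 0 b₃ b₄))
    (h₃ : 0 ≤ a₃) (h₄ : 0 ≤ a₄) (hb₃ : 0 ≤ b₃) (hb₄ : 0 ≤ b₄) :
    HasLatticeLift h' (vertexSum 0 0 0 a₃ a₄ 0 0 0 b₃ b₄) := by
  have hu : ∀ i, fibreUpper (m i) ≤ 0 * m i 0 + 0 * m i 1 + 0 * m i 2 + 0 * m i 3 + 1 := fun i => by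
    linarith [fibreUpper_le_one (d.mem i).1]
  -- The image lies in the cone over the edge `v₁v₄`, which contains `t₄` and `t₃`. The two
  -- quantities tested are `m₂` and `m₀ + m₁ + m₂` at `g*(x)`; their signs select the segment
  -- `v₁t₄`, `t₄t₃` or `t₃v₄`.
  rcases le_total (3 * a₃ - a₄ + 2 * b₃) 0 with h2 | h2
  · have hm : ∀ i, fibreLower (m i) = -m i 2 := by
      refine d.fibreLower_eq_neg hε hε' (α₁ := -(3 * a₃ - a₄ + 2 * b₃)) (α₂ := 0) (α₆ := 0)
        (β₁ := 0) (β₂ := 0) (β₄ := 4 * a₃ + 3 * b₃ + b₄) ?_ (by simp) ?_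
      · intro p
        fin_cases p <;> simp <;> linarith
      · rw [sum_smul_hPoint, gStar_vertexSum]
        simp only [Matrix.cons_val]
        ext j
        fin_cases j <;> simp <;> ring
    refine hasLatticeLift_vertexSum hh d hΦ (by simp [*]) (by simp [*]) 0 0 (-1) 0 0 0 0 0 0 1
      le_rfl zero_le_one (fun i => ?_) (by linarith) hu (by linarith)
    linarith [hm i]
  rcases le_total 0 (a₃ - 3 * a₄ - 2 * b₄) with h3 | h3
  · have hm : ∀ i, fibreLower (m i) = m i 0 + m i 1 + m i 2 := by
      refine d.fibreLower_eq_add hε hε' (α₂ := 0) (α₄ := a₃ - 3 * a₄ - 2 * b₄) (α₆ := 0)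
        (β₁ := 0) (β₂ := 0) (β₃ := 4 * a₄ + b₃ + 3 * b₄) ?_ (by simp) ?_
      · intro p
        fin_cases p <;> simp <;> linarith
      · rw [sum_smul_hPoint, gStar_vertexSum]
        simp only [Matrix.cons_val]
        ext j
        fin_cases j <;> simp <;> ring
    refine hasLatticeLift_vertexSum hh d hΦ (by simp [*]) (by simp [*]) 1 1 1 0 0 0 0 0 0 1
      le_rfl zero_le_one (fun i => ?_) (by linarith) hu (by linarith)
    linarith [hm i]
  · have hm : ∀ i, fibreLower (m i) = 0 := by
      refine d.fibreLower_eq_zero hε hε' (β₁ := 0) (β₂ := 0) (β₃ := (3 * a₃ - a₄ + 2 * b₃) / 2)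
        (β₄ := -(a₃ - 3 * a₄ - 2 * b₄) / 2) ?_ (by simp) ?_
      · intro p
        fin_cases p <;> simp <;> linarith
      · rw [sum_smul_hPoint, gStar_vertexSum]
        simp only [Matrix.cons_val]
        ext j
        fin_cases j <;> simp <;> ring
    refine hasLatticeLift_vertexSum hh d hΦ (by simp [*]) (by simp [*]) 0 0 0 0 0 0 0 0 0 1
      le_rfl zero_le_one (fun i => ?_) (by linarith) hu (by linarith)
    linarith [hm i]

theorem hasLatticeLift_trapezoid_one_two (hε : 0 < ε) (hε' : ε < 1 / 10) (hh : IsSublinear h')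
    (d : IsDecomposition ε h' (gStar (vertexSum 0 a₁ a₂ 0 0 0 b₁ b₂ 0 0)) c m)
    (hΦ : 0 + a₁ + a₂ + 0 + 0 + 0 + b₁ + b₂ + 0 + 0 ≤
      gauge nabla (vertexSum 0 a₁ a₂ 0 0 0 b₁ b₂ 0 0))
    (h₁ : 0 ≤ a₁) (h₂ : 0 ≤ a₂) (hb₁ : 0 ≤ b₁) (hb₂ : 0 ≤ b₂) :
    HasLatticeLift h' (vertexSum 0 a₁ a₂ 0 0 0 b₁ b₂ 0 0) := by
  suffices hm : ∀ i, fibreLower (m i) ≤ -m i 2 by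
    refine hasLatticeLift_vertexSum hh d hΦ (by simp [*]) (by simp [*]) 0 0 (-1) 0 0 0 0 0 0 1
      le_rfl zero_le_one (fun i => ?_) (by linarith) (fun i => ?_) (by linarith)
    · linarith [hm i]
    · linarith [fibreUpper_le_one (d.mem i).1]
  -- As `v₂ = c + 2t₁`, `v₆ = c - 2t₁` and `t₂ = -t₁`, the image is `S c + 2D t₁` in a half-plane,
  -- cut by the rays through `v₂`, `c` and `v₆` into four sectors. The comparison of `|D|` with `S`
  -- and the sign of `D` select one.
  obtain ⟨S, hS⟩ : ∃ S, S = a₁ + a₂ := ⟨_, rfl⟩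
  obtain ⟨D, hD⟩ : ∃ D, D = a₁ - a₂ + (b₁ - b₂) / 2 := ⟨_, rfl⟩
  have hy : gStar (vertexSum 0 a₁ a₂ 0 0 0 b₁ b₂ 0 0) =
      ![S + 2 * D, S - 2 * D, -S, S - 2 * D] := by
    rw [gStar_vertexSum, hS, hD]
    ext j
    fin_cases j <;> simp <;> ring
  have hS0 : 0 ≤ S := by linarith
  have hmid : ∀ α β, 0 ≤ α → 0 ≤ β → (β = 0 ∨ α = 0) → α + β ≤ S → D = α - β →
      ∀ i, fibreLower (m i) ≤ -m i 2 := by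
    intro α β hα hβ hαβ hle hDαβ i
    obtain ⟨s, hs⟩ : ∃ s : ℝ, s = 1 ∧ β = 0 ∨ s = -1 ∧ α = 0 := by
      rcases hαβ with h | h
      exacts [⟨1, Or.inl ⟨rfl, h⟩⟩, ⟨-1, Or.inr ⟨rfl, h⟩⟩]
    have hy' : gStar (vertexSum 0 a₁ a₂ 0 0 0 b₁ b₂ 0 0) =
        ∑ p, ![0, α, 0, 0, 0, β, 0, 0, 0, 0, S - (α + β)] p • hPoint p := by
      rw [sum_smul_hPoint, hy, hDαβ]
      simp only [Matrix.cons_val]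
      ext j
      fin_cases j <;> simp <;> ring
    have h1 := d.square_join_four hε hε' (s₂ := 1) hα le_rfl le_rfl le_rfl hβ (by linarith) hs
      (Or.inl ⟨rfl, rfl⟩) hy' i
    -- The image involves neither `v₃` nor `v₅`, so both values of `s₂` are allowed; the value `-1`
    -- gives `m₁ ≤ m₃`.
    have h2 := d.square_join_four hε hε' (s₂ := -1) hα le_rfl le_rfl le_rfl hβ (by linarith) hs
      (Or.inr ⟨rfl, rfl⟩) hy' i
    have h3 := d.face_coord (by
      intro p
      fin_cases p <;> simp <;> linarith) hy' 0 0 1 0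
      (fun z hz => by linarith [(mem_deltaStarP24.1 hz).2.2.1])
      (by rw [hy]; simp only [Matrix.cons_val]; ring) i
    linarith [fibreLower_le_one (d.mem i).1 (by linarith [h2.2])]
  rcases le_total 0 D with h0 | h0
  · rcases le_total D S with h | h
    · exact hmid D 0 h0 le_rfl (Or.inl rfl) (by linarith) (by ring)
    · refine fun i => (d.fibreLower_eq_neg hε hε' (α₁ := 0) (α₂ := S) (α₆ := 0)
        (β₁ := 2 * D - 2 * S) (β₂ := 0) (β₄ := 0) ?_ (by simp) ?_ i).le
      · intro p
        fin_cases p <;> simp <;> linarith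
      · rw [sum_smul_hPoint, hy]
        simp only [Matrix.cons_val]
        ext j
        fin_cases j <;> simp <;> ring
  · rcases le_total (-D) S with h | h
    · exact hmid 0 (-D) le_rfl (by linarith) (Or.inr rfl) (by linarith) (by ring)
    · refine fun i => (d.fibreLower_eq_neg hε hε' (α₁ := 0) (α₂ := 0) (α₆ := S)
        (β₁ := 0) (β₂ := -2 * D - 2 * S) (β₄ := 0) ?_ (by simp) ?_ i).le
      · intro p
        fin_cases p <;> simp <;> linarith
      · rw [sum_smul_hPoint, hy]
        simp only [Matrix.cons_val]
        ext j
        fin_cases j <;> simp <;> ring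

end Lift

/-! ### The list of faces of `∇` that remain -/

theorem hasLatticeLift_of_complementary {ε : ℝ} {h' : (Fin 4 → ℝ) → ℝ} (hε : 0 < ε)
    (hε' : ε < 1 / 10) (hh : IsSublinear h')
    (hd : ∀ y, ∃ (ι : Type) (_ : Fintype ι) (c : ι → ℝ) (m : ι → Fin 4 → ℝ),
      IsDecomposition ε h' y c m)
    {a₀ a₁ a₂ a₃ a₄ a₅ b₁ b₂ b₃ b₄ q₁ q₂ q₃ q₄ q₅ Q : ℝ}
    (h₀ : 0 ≤ a₀) (h₁ : 0 ≤ a₁) (h₂ : 0 ≤ a₂) (h₃ : 0 ≤ a₃) (h₄ : 0 ≤ a₄) (h₅ : 0 ≤ a₅)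
    (hb₁ : 0 ≤ b₁) (hb₂ : 0 ≤ b₂) (hb₃ : 0 ≤ b₃) (hb₄ : 0 ≤ b₄)
    (hQ₁ : Q + 4 * q₁ ≤ 1) (hQ₂ : Q + 4 * q₂ ≤ 1) (hQ₃ : Q + 4 * q₃ ≤ 1) (hQ₄ : Q + 4 * q₄ ≤ 1)
    (hR₁ : 2 * q₁ - q₅ ≤ 1) (hR₂ : 2 * q₂ - q₅ ≤ 1) (hR₃ : 2 * q₃ - q₅ ≤ 1)
    (hR₄ : 2 * q₄ - q₅ ≤ 1) (hq₅ : -1 < q₅) (hq₅' : q₅ < 1)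
    (e₀ : a₀ = 0 ∨ Q = 1) (e₁ : a₁ = 0 ∨ Q + 4 * q₁ = 1) (e₂ : a₂ = 0 ∨ Q + 4 * q₂ = 1)
    (e₃ : a₃ = 0 ∨ Q + 4 * q₃ = 1) (e₄ : a₄ = 0 ∨ Q + 4 * q₄ = 1) (e₅ : a₅ = 0 ∨ Q + 4 * q₅ = 1)
    (f₁ : b₁ = 0 ∨ 2 * q₁ - q₅ = 1) (f₂ : b₂ = 0 ∨ 2 * q₂ - q₅ = 1)
    (f₃ : b₃ = 0 ∨ 2 * q₃ - q₅ = 1) (f₄ : b₄ = 0 ∨ 2 * q₄ - q₅ = 1)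
    (h123 : Q + 4 * q₁ = 1 → Q + 4 * q₂ = 1 → Q + 4 * q₃ ≠ 1)
    (h124 : Q + 4 * q₁ = 1 → Q + 4 * q₂ = 1 → Q + 4 * q₄ ≠ 1)
    (h134 : Q + 4 * q₁ = 1 → Q + 4 * q₃ = 1 → Q + 4 * q₄ ≠ 1)
    (h234 : Q + 4 * q₂ = 1 → Q + 4 * q₃ = 1 → Q + 4 * q₄ ≠ 1)
    (hdim : Q = 1 → Q + 4 * q₃ = 1 → Q + 4 * q₄ = 1 → Q + 4 * q₅ ≠ 1)
    (hΦ : a₀ + a₁ + a₂ + a₃ + a₄ + a₅ + b₁ + b₂ + b₃ + b₄ ≤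
      gauge nabla (vertexSum a₀ a₁ a₂ a₃ a₄ a₅ b₁ b₂ b₃ b₄)) :
    HasLatticeLift h' (vertexSum a₀ a₁ a₂ a₃ a₄ a₅ b₁ b₂ b₃ b₄) := by
  obtain ⟨ι, _, c, m, d⟩ := hd (gStar (vertexSum a₀ a₁ a₂ a₃ a₄ a₅ b₁ b₂ b₃ b₄))
  by_cases hb : b₁ = 0 ∧ b₂ = 0 ∧ b₃ = 0 ∧ b₄ = 0
  · obtain ⟨rfl, rfl, rfl, rfl⟩ := hb
    rcases e₃ with e₃ | e₃
    · exact hasLatticeLift_square hε hε' hh d hΦ ⟨h₀, h₁, h₂, h₃, h₄, h₅⟩ (Or.inl e₃)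
    rcases e₄ with e₄ | e₄
    · exact hasLatticeLift_square hε hε' hh d hΦ ⟨h₀, h₁, h₂, h₃, h₄, h₅⟩ (Or.inr e₄)
    -- With two of the four removal vertices already on the face, the other two are excluded; the
    -- bound on the dimension then excludes having vertices `0` and `5` together.
    obtain rfl := e₁.resolve_right fun h => h134 h e₃ e₄
    obtain rfl := e₂.resolve_right fun h => h234 h e₃ e₄
    rcases e₅ with rfl | e₅
    · exact hasLatticeLift_zero_three_four hh d hΦ h₀ h₃ h₄
    · obtain rfl := e₀.resolve_right fun h => hdim h e₃ e₄ e₅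
      exact hasLatticeLift_five_three_four hh d hΦ h₃ h₄ h₅
  have hr : 2 * q₁ - q₅ = 1 ∨ 2 * q₂ - q₅ = 1 ∨ 2 * q₃ - q₅ = 1 ∨ 2 * q₄ - q₅ = 1 := by
    by_contra! h
    exact hb ⟨f₁.resolve_right h.1, f₂.resolve_right h.2.1, f₃.resolve_right h.2.2.1,
      f₄.resolve_right h.2.2.2⟩
  -- An active `bᵢ` means `2qᵢ = 1 + q₅`. Since `-1 < q₅ < 1`, this makes `Q` and `Q + 4q₅` less
  -- than `1`, so `a₀ = a₅ = 0`.
  have hQ : Q + 2 * (1 + q₅) ≤ 1 := by rcases hr with h | h | h | h <;> linarith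
  obtain rfl := e₀.resolve_right (by intro; linarith)
  obtain rfl := e₅.resolve_right (by intro; linarith)
  by_cases ha : a₁ = 0 ∧ a₂ = 0 ∧ a₃ = 0 ∧ a₄ = 0
  · obtain ⟨rfl, rfl, rfl, rfl⟩ := ha
    exact hasLatticeLift_newt_phi2 hε hε' hh d hΦ ⟨hb₁, hb₂, hb₃, hb₄⟩
  have hs : Q + 4 * q₁ = 1 ∨ Q + 4 * q₂ = 1 ∨ Q + 4 * q₃ = 1 ∨ Q + 4 * q₄ = 1 := by
    by_contra! h
    exact ha ⟨e₁.resolve_right h.1, e₂.resolve_right h.2.1, e₃.resolve_right h.2.2.1,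
      e₄.resolve_right h.2.2.2⟩
  -- With some `aᵢ` active as well, equality holds, so an active `bᵢ` forces the removal vertex of
  -- the same index onto the face. At most two indices can therefore occur, which leaves the
  -- trapezoids.
  have hQ' : 1 ≤ Q + 2 * (1 + q₅) := by rcases hs with h | h | h | h <;> linarith
  have e₁' : a₁ = 0 ∧ b₁ = 0 ∨ Q + 4 * q₁ = 1 := by
    rcases f₁ with f | f
    · exact e₁.imp_left fun e => ⟨e, f⟩
    · exact Or.inr (by linarith)
  have e₂' : a₂ = 0 ∧ b₂ = 0 ∨ Q + 4 * q₂ = 1 := by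
    rcases f₂ with f | f
    · exact e₂.imp_left fun e => ⟨e, f⟩
    · exact Or.inr (by linarith)
  have e₃' : a₃ = 0 ∧ b₃ = 0 ∨ Q + 4 * q₃ = 1 := by
    rcases f₃ with f | f
    · exact e₃.imp_left fun e => ⟨e, f⟩
    · exact Or.inr (by linarith)
  have e₄' : a₄ = 0 ∧ b₄ = 0 ∨ Q + 4 * q₄ = 1 := by
    rcases f₄ with f | f
    · exact e₄.imp_left fun e => ⟨e, f⟩
    · exact Or.inr (by linarith)
  rcases e₃' with ⟨rfl, rfl⟩ | e₃'
  · rcases e₄' with ⟨rfl, rfl⟩ | e₄'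
    · exact hasLatticeLift_trapezoid_one_two hε hε' hh d hΦ h₁ h₂ hb₁ hb₂
    · refine hasLatticeLift_trapezoid_four hε hε' hh d hΦ ⟨h₁, h₂, h₄⟩ ⟨hb₁, hb₂, hb₄⟩ ?_
      rcases e₂' with e | e
      · exact Or.inl e
      · exact Or.inr (e₁'.resolve_right fun h => h124 h e e₄')
  · rcases e₄' with ⟨rfl, rfl⟩ | e₄'
    · refine hasLatticeLift_trapezoid_three hε hε' hh d hΦ ⟨h₁, h₂, h₃⟩ ⟨hb₁, hb₂, hb₃⟩ ?_
      rcases e₂' with e | e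
      · exact Or.inl e
      · exact Or.inr (e₁'.resolve_right fun h => h123 h e e₃')
    · obtain ⟨rfl, rfl⟩ := e₁'.resolve_right fun h => h134 h e₃' e₄'
      obtain ⟨rfl, rfl⟩ := e₂'.resolve_right fun h => h234 h e₃' e₄'
      exact hasLatticeLift_trapezoid_three_four hε hε' hh d hΦ h₃ h₄ hb₃ hb₄

/-- The points of the cone over a face are the combinations of the vertices in the face. -/
theorem exists_sum_nablaVertex {f : Set (Fin 5 → ℝ)} {q x : Fin 5 → ℝ}
    (hq : ∀ u ∈ nabla, q ⬝ᵥ u ≤ 1) (hf : f = {u ∈ nabla | q ⬝ᵥ u = 1}) (hx : x ∈ coneOver f) :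
    ∃ a : Fin 12 → ℝ, (∀ k, 0 ≤ a k) ∧ (∀ k, a k = 0 ∨ q ⬝ᵥ nablaVertex k = 1) ∧
      x = ∑ k, a k • nablaVertex k := by
  rcases hx with rfl | ⟨r, hr, u, hu, rfl⟩
  · exact ⟨0, fun _ => le_rfl, fun _ => Or.inl rfl, by simp⟩
  have hsub : nabla ⊆ {u | ∃ w : Fin 12 → ℝ, (∀ k, 0 ≤ w k) ∧ ∑ k, w k = 1 ∧
      u = ∑ k, w k • nablaVertex k} := by
    rw [nabla_eq]
    refine convexHull_min ?_ ?_
    · rintro _ ⟨k, rfl⟩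
      refine ⟨Pi.single k 1, fun i => ?_, by simp, by simp [Pi.single_apply]⟩
      by_cases h : i = k <;> simp [h]
    · rintro _ ⟨w, hw, hw1, rfl⟩ _ ⟨w', hw', hw1', rfl⟩ s t hs ht hst
      refine ⟨fun k => s * w k + t * w' k, fun k => ?_, ?_, ?_⟩
      · exact add_nonneg (mul_nonneg hs (hw k)) (mul_nonneg ht (hw' k))
      · rw [Finset.sum_add_distrib, ← Finset.mul_sum, ← Finset.mul_sum, hw1, hw1']
        linarith
      · simp only [Finset.smul_sum, smul_smul, add_smul, Finset.sum_add_distrib]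
  rw [hf] at hu
  obtain ⟨hu, hqu⟩ := hu
  obtain ⟨w, hw, hw1, rfl⟩ := hsub hu
  have hsum : ∑ k, w k * (1 - q ⬝ᵥ nablaVertex k) = 0 := by
    rw [dotProduct_sum] at hqu
    simp only [dotProduct_smul, smul_eq_mul] at hqu
    simp only [mul_sub, mul_one, Finset.sum_sub_distrib, hw1, hqu, sub_self]
  have hzero := (Finset.sum_eq_zero_iff_of_nonneg fun k _ =>
    mul_nonneg (hw k) (sub_nonneg.2 (hq _ (nablaVertex_mem k)))).1 hsum
  refine ⟨fun k => r * w k, fun k => mul_nonneg hr (hw k), fun k => ?_, ?_⟩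
  · rcases mul_eq_zero.1 (hzero k (Finset.mem_univ k)) with h | h
    · exact Or.inl (mul_eq_zero_of_right r h)
    · exact Or.inr (by linarith)
  · simp only [Finset.smul_sum, smul_smul]

theorem linearIndependent_nablaVertex :
    LinearIndependent ℝ ![nablaVertex 0, nablaVertex 3, nablaVertex 4, nablaVertex 5] := by
  rw [Fintype.linearIndependent_iff]
  intro g hg
  have h := fun j => congrFun hg j
  simp only [Fin.sum_univ_four, Matrix.cons_val, Pi.add_apply, Pi.smul_apply, smul_eq_mul,
    nablaVertex, Pi.zero_apply] at h
  have h0 := h 0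
  have h2 := h 2
  have h3 := h 3
  have h4 := h 4
  simp only [Matrix.cons_val] at h0 h2 h3 h4
  intro i
  fin_cases i <;> simp only [Fin.zero_eta, Fin.mk_one, Fin.reduceFinMk] <;> linarith

/-- Over the face with vertices `0, 3, 4, 5` the two special arguments for `0, 3, 4` and `5, 3, 4`
do not combine; its cone is excluded only by its dimension, which is four. -/
theorem not_subset_of_finrank_le {D : Set (Fin 5 → ℝ)}
    (hD : Module.finrank ℝ (Submodule.span ℝ D) ≤ 3) :
    ¬ ∀ i, ![nablaVertex 0, nablaVertex 3, nablaVertex 4, nablaVertex 5] i ∈ D := by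
  intro h
  have h1 := finrank_span_eq_card linearIndependent_nablaVertex
  have h2 := Submodule.finrank_mono (R := ℝ) (Submodule.span_mono (Set.range_subset_iff.2 h))
  rw [h1, Fintype.card_fin] at h2
  omega

theorem two_lt_ncard_inter_removalPoints {f : Set (Fin 5 → ℝ)} {i j k : Fin 12}
    (hi : nablaVertex i ∈ f ∩ removalPoints) (hj : nablaVertex j ∈ f ∩ removalPoints)
    (hk : nablaVertex k ∈ f ∩ removalPoints) (hij : nablaVertex i ≠ nablaVertex j)
    (hik : nablaVertex i ≠ nablaVertex k) (hjk : nablaVertex j ≠ nablaVertex k) :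
    2 < (f ∩ removalPoints).ncard := by
  have hfin : (f ∩ removalPoints).Finite := by
    refine Set.Finite.inter_of_right ?_ f
    simp [removalPoints]
  exact (Set.two_lt_ncard_iff hfin).2 ⟨_, _, _, hi, hj, hk, hij, hik, hjk⟩

theorem hasLatticeLift_of_mem_sigmaPrime {ε : ℝ} {h' : (Fin 4 → ℝ) → ℝ} (hε : 0 < ε)
    (hε' : ε < 1 / 10) (hMPCP : IsMPCPFunction deltaStarP24 h')
    (href : Refines (linearityFan h') (linearityFan (hFun ε))) {D : Set (Fin 5 → ℝ)}
    (hD : D ∈ sigmaPrime) {x : Fin 5 → ℝ} (hx : x ∈ D) : HasLatticeLift h' x := by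
  have hh := hMPCP.piecewiseLinear.isSublinear hMPCP.convex
  obtain ⟨f, hf, rfl, hrank, hrem⟩ := hD
  rcases f.eq_empty_or_nonempty with rfl | hne
  · obtain rfl : x = 0 := by
      rcases hx with rfl | ⟨-, -, u, hu, -⟩
      · rfl
      · exact absurd hu (Set.notMem_empty u)
    exact ⟨Empty, inferInstance, 0, fun _ => 0, by simp, by simp, by simp, by simp,
      by simpa using hh.map_zero⟩
  obtain ⟨q, hq, hfq⟩ := exists_of_isProperFace single_mem_nabla neg_single_mem_nabla hf hne
  obtain ⟨a, ha, hz, rfl⟩ := exists_sum_nablaVertex hq hfq hx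
  have hmem : ∀ k, q ⬝ᵥ nablaVertex k = 1 → nablaVertex k ∈ f := fun k hk => by
    rw [hfq]
    exact ⟨nablaVertex_mem k, hk⟩
  have hle : ∀ k, q ⬝ᵥ nablaVertex k ≤ 1 := fun k => hq _ (nablaVertex_mem k)
  have hne6 : q ⬝ᵥ nablaVertex 6 ≠ 1 := fun h => hrem (Or.inr (Or.inl (hmem 6 h)))
  have hne11 : q ⬝ᵥ nablaVertex 11 ≠ 1 := fun h => hrem (Or.inl (hmem 11 h))
  have hR : ∀ k ∈ ({1, 2, 3, 4} : Set (Fin 12)), nablaVertex k ∈ removalPoints := by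
    rintro k (rfl | rfl | rfl | rfl) <;> simp [nablaVertex, removalPoints]
  have hcount : ∀ i ∈ ({1, 2, 3, 4} : Set (Fin 12)), ∀ j ∈ ({1, 2, 3, 4} : Set (Fin 12)),
      ∀ k ∈ ({1, 2, 3, 4} : Set (Fin 12)), nablaVertex i ≠ nablaVertex j →
      nablaVertex i ≠ nablaVertex k → nablaVertex j ≠ nablaVertex k →
      q ⬝ᵥ nablaVertex i = 1 → q ⬝ᵥ nablaVertex j = 1 → q ⬝ᵥ nablaVertex k ≠ 1 :=
    fun i hi j hj k hk hij hik hjk h1 h2 h3 => hrem (Or.inr (Or.inr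
      (two_lt_ncard_inter_removalPoints ⟨hmem i h1, hR i hi⟩ ⟨hmem j h2, hR j hj⟩
        ⟨hmem k h3, hR k hk⟩ hij hik hjk)))
  have hdim : q ⬝ᵥ nablaVertex 0 = 1 → q ⬝ᵥ nablaVertex 3 = 1 → q ⬝ᵥ nablaVertex 4 = 1 →
      q ⬝ᵥ nablaVertex 5 ≠ 1 := fun h0 h3 h4 h5 => by
    refine not_subset_of_finrank_le hrank fun i => subset_coneOver f ?_
    fin_cases i
    exacts [hmem 0 h0, hmem 3 h3, hmem 4 h4, hmem 5 h5]
  have hΦ : ∑ k, a k ≤ gauge nabla (∑ k, a k • nablaVertex k) := by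
    refine le_trans (le_of_eq ?_) (le_gauge_nabla hq _)
    rw [dotProduct_sum]
    refine Finset.sum_congr rfl fun k _ => ?_
    rw [dotProduct_smul, smul_eq_mul]
    rcases hz k with h | h <;> simp [h]
  have h6 : a 6 = 0 := (hz 6).resolve_right hne6
  have h11 : a 11 = 0 := (hz 11).resolve_right hne11
  have hsum : ∑ k, a k • nablaVertex k = vertexSum (a 0) (a 1) (a 2) (a 3) (a 4) (a 5)
      (a 7) (a 8) (a 9) (a 10) := by
    ext j
    simp only [Fin.sum_univ_succ, Finset.sum_apply, Pi.smul_apply, smul_eq_mul]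
    fin_cases j <;> simp [nablaVertex, vertexSum, h6, h11] <;> ring
  have hexp : ∀ k, q ⬝ᵥ nablaVertex k = q 0 * nablaVertex k 0 + q 1 * nablaVertex k 1 +
      q 2 * nablaVertex k 2 + q 3 * nablaVertex k 3 + q 4 * nablaVertex k 4 :=
    fun k => Fin.sum_univ_five _
  -- Vertices `1` to `5` are vertex `0` plus four times a basis vector, so all values of `q` on the
  -- simplex are expressed through `Q`.
  obtain ⟨Q, hQ⟩ : ∃ Q, Q = q ⬝ᵥ nablaVertex 0 := ⟨_, rfl⟩
  have hQ' : Q = -q 0 - q 1 - q 2 - q 3 := by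
    rw [hQ, hexp]; simp only [nablaVertex, Matrix.cons_val]; ring
  have h1 : q ⬝ᵥ nablaVertex 1 = Q + 4 * q 0 := by
    rw [hQ', hexp]; simp only [nablaVertex, Matrix.cons_val]; ring
  have h2 : q ⬝ᵥ nablaVertex 2 = Q + 4 * q 1 := by
    rw [hQ', hexp]; simp only [nablaVertex, Matrix.cons_val]; ring
  have h3 : q ⬝ᵥ nablaVertex 3 = Q + 4 * q 2 := by
    rw [hQ', hexp]; simp only [nablaVertex, Matrix.cons_val]; ring
  have h4 : q ⬝ᵥ nablaVertex 4 = Q + 4 * q 3 := by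
    rw [hQ', hexp]; simp only [nablaVertex, Matrix.cons_val]; ring
  have h5 : q ⬝ᵥ nablaVertex 5 = Q + 4 * q 4 := by
    rw [hQ', hexp]; simp only [nablaVertex, Matrix.cons_val]; ring
  have h6' : q ⬝ᵥ nablaVertex 6 = -q 4 := by
    rw [hexp]; simp only [nablaVertex, Matrix.cons_val]; ring
  have h7 : q ⬝ᵥ nablaVertex 7 = 2 * q 0 - q 4 := by
    rw [hexp]; simp only [nablaVertex, Matrix.cons_val]; ring
  have h8 : q ⬝ᵥ nablaVertex 8 = 2 * q 1 - q 4 := by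
    rw [hexp]; simp only [nablaVertex, Matrix.cons_val]; ring
  have h9 : q ⬝ᵥ nablaVertex 9 = 2 * q 2 - q 4 := by
    rw [hexp]; simp only [nablaVertex, Matrix.cons_val]; ring
  have h10 : q ⬝ᵥ nablaVertex 10 = 2 * q 3 - q 4 := by
    rw [hexp]; simp only [nablaVertex, Matrix.cons_val]; ring
  have h11' : q ⬝ᵥ nablaVertex 11 = q 4 := by
    rw [hexp]; simp only [nablaVertex, Matrix.cons_val]; ring
  have hd0 : ∀ i ∈ ({2, 3, 4} : Set (Fin 12)), nablaVertex 1 ≠ nablaVertex i := by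
    intro i hi h
    have := congrFun h 0
    rcases hi with rfl | rfl | rfl <;>
      (simp only [nablaVertex, Matrix.cons_val] at this; linarith)
  have hd1 : ∀ i ∈ ({3, 4} : Set (Fin 12)), nablaVertex 2 ≠ nablaVertex i := by
    intro i hi h
    have := congrFun h 1
    rcases hi with rfl | rfl <;>
      (simp only [nablaVertex, Matrix.cons_val] at this; linarith)
  have hd2 : nablaVertex 3 ≠ nablaVertex 4 := by
    intro h
    have := congrFun h 2
    simp only [nablaVertex, Matrix.cons_val] at this
    linarith
  have h123 := hcount 1 (by simp) 2 (by simp) 3 (by simp) (hd0 2 (by simp)) (hd0 3 (by simp))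
    (hd1 3 (by simp))
  have h124 := hcount 1 (by simp) 2 (by simp) 4 (by simp) (hd0 2 (by simp)) (hd0 4 (by simp))
    (hd1 4 (by simp))
  have h134 := hcount 1 (by simp) 3 (by simp) 4 (by simp) (hd0 3 (by simp)) (hd0 4 (by simp)) hd2
  have h234 := hcount 2 (by simp) 3 (by simp) 4 (by simp) (hd1 3 (by simp)) (hd1 4 (by simp)) hd2
  have hΦ' : a 0 + a 1 + a 2 + a 3 + a 4 + a 5 + a 7 + a 8 + a 9 + a 10 = ∑ k, a k := by
    simp only [Fin.sum_univ_succ]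
    simp [h6, h11]
    ring
  rw [hsum, ← hΦ'] at hΦ
  rw [hsum]
  have hz0 := hz 0
  rw [← hQ] at hz0 hdim
  rw [h1, h2] at h123 h124
  rw [h3] at h123 h134 h234 hdim
  rw [h4] at h124 h134 h234 hdim
  rw [h1] at h134
  rw [h2] at h234
  rw [h5] at hdim
  have hq6 : -1 < q 4 := by
    have := lt_of_le_of_ne (hle 6) hne6
    linarith
  have hq11 : q 4 < 1 := h11' ▸ lt_of_le_of_ne (hle 11) hne11
  exact hasLatticeLift_of_complementary hε hε' hh (exists_isDecomposition hMPCP href)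
    (ha 0) (ha 1) (ha 2) (ha 3) (ha 4) (ha 5) (ha 7) (ha 8) (ha 9) (ha 10)
    (h1 ▸ hle 1) (h2 ▸ hle 2) (h3 ▸ hle 3) (h4 ▸ hle 4) (h7 ▸ hle 7) (h8 ▸ hle 8) (h9 ▸ hle 9)
    (h10 ▸ hle 10) hq6 hq11 hz0 (h1 ▸ hz 1) (h2 ▸ hz 2) (h3 ▸ hz 3) (h4 ▸ hz 4) (h5 ▸ hz 5)
    (h7 ▸ hz 7) (h8 ▸ hz 8) (h9 ▸ hz 9) (h10 ▸ hz 10) h123 h124 h134 h234 hdim hΦ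

end ConifoldMirror

theorem proposition5p9 :
    ∃ ε₀ : ℝ, 0 < ε₀ ∧ ∀ ε : ℝ, 0 < ε → ε < ε₀ →
      ∀ h' : (Fin 4 → ℝ) → ℝ,
        ConifoldMirror.IsMPCPFunction ConifoldMirror.deltaStarP24 h' →
        ConifoldMirror.Refines (ConifoldMirror.linearityFan h')
          (ConifoldMirror.linearityFan (ConifoldMirror.hFun ε)) →
        ConifoldMirror.IsPartialCrepantResolution ConifoldMirror.nabla
            (ConifoldMirror.sigmaPrimeJ h') ConifoldMirror.sigmaPrime ∧
          ∀ C ∈ ConifoldMirror.sigmaPrimeJ h',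
            ∃ D ∈ ConifoldMirror.linearityFan h', ConifoldMirror.gStar '' C ⊆ D := by
  -- The bound `1/10` is small enough for every comparison of a tilted linear function with the
  -- heights of the points defining `h_ε`.
  refine ⟨1 / 10, by norm_num, fun ε hε hε' h' hMPCP href => ?_⟩
  have key := fun D hD x hx =>
    ConifoldMirror.hasLatticeLift_of_mem_sigmaPrime hε hε' hMPCP href (D := D) hD (x := x) hx
  exact ⟨ConifoldMirror.isPartialCrepantResolution_sigmaPrimeJ
      (hMPCP.piecewiseLinear.isSublinear hMPCP.convex) key,
    fun C hC => ConifoldMirror.exists_image_subset_of_mem_sigmaPrimeJ hMPCP.piecewiseLinear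
      hMPCP.convex key hC⟩
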